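/- Let $\mathbb F$ be a field of characteristic $0$, $n\ge 2$ and $1\le n_1\le n_2\le n$. On $\mathscr B=\mathbb F[x_1,\dots,x_n,y_1,\dots,y_n]$ let $\mathfrak{sl}(n,\mathbb F)$ act by $E_{i,j}|_{\mathscr B}=E^x_{i,j}-E^y_{j,i}$, where $$E^x_{i,j}=\begin{cases}-x_j\partial_{x_i}-\delta_{i,j}& i,j\le n_1\\ \partial_{x_i}\partial_{x_j}& i\le n_1<j\\ -x_ix_j& j\le n_1<i\\ x_i\partial_{x_j}& i,j>n_1\end{cases}\qquad E^y_{i,j}=\begin{cases}y_i\partial_{y_j}& i,j\le n_2\\ -y_iy_j& i\le n_2<j\\ \partial_{y_i}\partial_{y_j}& j\le n_2<i\\ -y_j\partial_{y_i}-\delta_{i,j}& i,j>n_2.\end{cases}$$ Let $\mathscr D=-\sum_{i\le n_1}x_i\partial_{y_i}+\sum_{n_1<r\le n_2}\partial_{x_r}\partial_{y_r}-\sum_{s>n_2}y_s\partial_{x_s}$. For $\ell_1,\ell_2\in\mathbb Z$ let $\mathscr B_{\langle\ell_1,\ell_2\rangle}$ be the span of the monomials $x^\alpha y^\beta$ with $\sum_{r>n_1}\alpha_r-\sum_{i\le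 n_1}\alpha_i=\ell_1$ and $\sum_{i\le n_2}\beta_i-\sum_{r>n_2}\beta_r=\ell_2$, and let $\mathscr H_{\langle\ell_1,\ell_2\rangle}=\{f\in\mathscr B_{\langle\ell_1,\ell_2\rangle}\mid\mathscr D(f)=0\}$, an $\mathfrak{sl}(n,\mathbb F)$-submodule of $\mathscr B$. Weights are taken with respect to the diagonal Cartan subalgebra, $\lambda_1,\dots,\lambda_{n-1}$ are the fundamental weights, and $\lambda_0=0$. A highest-weight vector is a nonzero weight vector killed by all $E_{i,j}$ with $i<j$. A module is called completely pointed if it is an infinite-dimensional weight module (the direct sum of its weight spaces) and all its nonzero weight spaces are one-dimensional. The module $\mathscr H_{\langle\ell_1,\ell_2\rangle}$ is irreducible and completely pointed if and only if it is one of the following; in each case the given $v_\lambda$ lies in $\mathscr H_{\langle\ell_1,\ell_2\rangle}$ and is a highest-weight vector of the given weight $\lambda$. Here $m,m_1,m_2$ denote arbitrary nonnegative integers, subject to the stated conditions. 1. $n_1+1<n_2=n$: - $\langle\ell_1,\ell_2\rangle=\langle m,0\rangle$, $v_\lambda=x_{n_1+1}^{m}$, $\lambda=-(m+1)\lambda_{n_1}+m\lambda_{n_1+1}$;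 - $\langle\ell_1,\ell_2\rangle=\langle -m,0\rangle$, $v_\lambda=x_{n_1}^{m}$, $\lambda=m\lambda_{n_1-1}-(m+1)\lambda_{n_1}$. 2. $n_1+1=n_2=n$: - $\langle -m,0\rangle$, $v_\lambda=x_{n-1}^{m}$, $\lambda=m\lambda_{n-2}-(m+1)\lambda_{n-1}$; - $\langle m,0\rangle$, $v_\lambda=x_n^{m}$, $\lambda=-(m+1)\lambda_{n-1}$; - $n=2$, $m_2\le m_1$, $\langle -m_1,m_2\rangle$, $v_\lambda=x_1^{m_1}y_2^{m_2}$, $\lambda=(m_2-m_1-1)\lambda_1$; - $n=2$, $m_1,m_2\ge1$, $\langle m_1,m_2\rangle$, $v_\lambda=\sum_{j=0}^{m_2}\binom{m_1+m_2}{j}\frac{m_2!}{(m_2-j)!}\,x_1^{m_2-j}y_1^{j}x_2^{m_1+m_2-j}y_2^{m_2-j}$, $\lambda=-(m_1+m_2+1)\lambda_1$. 3. $n_1=n_2=1$: - $\langle -m,0\rangle$, $v_\lambda=x_1^{m}$, $\lambda=-(m+2)\lambda_1$; - $n=3$, $\langle m+1,-m-1\rangle$, $v_\lambda=\zeta_2^{m+1}$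 with $\zeta_2=x_2y_3-x_3y_2$, $\lambda=-(m+3)\lambda_1$; - $n=2$, $\langle -m_1,-m_2\rangle$, $v_\lambda=x_1^{m_1}y_2^{m_2}$, $\lambda=-(m_1+m_2+2)\lambda_1$. 4. $n_1=n_2=n-1$: - $\langle 0,-m\rangle$, $v_\lambda=y_n^{m}$, $\lambda=-(m+2)\lambda_{n-1}$; - $n=3$, $\langle -m-1,m+1\rangle$, $v_\lambda=\zeta_1^{m+1}$ with $\zeta_1=x_1y_2-x_2y_1$, $\lambda=-(m+3)\lambda_2$. -/

import Mathlib

open MvPolynomial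

attribute [local instance 100] LieRing.ofAssociativeRing

noncomputable section

namespace OscRep

/-- The polynomial algebra `ℬ = 𝔽[x₁,…,xₙ,y₁,…,yₙ]`.  The label `Sum.inl i` stands for the variable
`x_{i+1}` and `Sum.inr i` for `y_{i+1}`, where `i : Fin n` runs through `0,…,n-1`.  The parameters
`n₁ ≤ n₂` do not enter the algebra, but they determine the action of `sl(n,𝔽)` on it below. -/
def Osc (F : Type*) [Field F] (n _n₁ _n₂ : ℕ) : Type _ := MvPolynomial (Fin n ⊕ Fin n) F

section Operators

variable (F : Type*) [Field F] (n n₁ n₂ : ℕ)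

instance : CommRing (Osc F n n₁ n₂) :=
  inferInstanceAs (CommRing (MvPolynomial (Fin n ⊕ Fin n) F))

instance : Algebra F (Osc F n n₁ n₂) :=
  inferInstanceAs (Algebra F (MvPolynomial (Fin n ⊕ Fin n) F))

/-- The variable with label `s`. -/
def var (s : Fin n ⊕ Fin n) : Osc F n n₁ n₂ :=
  (X s : MvPolynomial (Fin n ⊕ Fin n) F)

/-- Multiplication by the variable with label `s`. -/
def mulVar (s : Fin n ⊕ Fin n) : Module.End F (Osc F n n₁ n₂) :=
  LinearMap.mulLeft F (var F n n₁ n₂ s)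

/-- The partial derivative with respect to the variable with label `s`. -/
def dVar (s : Fin n ⊕ Fin n) : Module.End F (Osc F n n₁ n₂) :=
  ((pderiv (R := F) s).toLinearMap :
    MvPolynomial (Fin n ⊕ Fin n) F →ₗ[F] MvPolynomial (Fin n ⊕ Fin n) F)

/-- Multiplication by `x_{i+1}`. -/
def mx (i : Fin n) : Module.End F (Osc F n n₁ n₂) := mulVar F n n₁ n₂ (.inl i)

/-- Multiplication by `y_{i+1}`. -/
def my (i : Fin n) : Module.End F (Osc F n n₁ n₂) := mulVar F n n₁ n₂ (.inr i)

/-- The partial derivative with respect to `x_{i+1}`. -/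
def dx (i : Fin n) : Module.End F (Osc F n n₁ n₂) := dVar F n n₁ n₂ (.inl i)

/-- The partial derivative with respect to `y_{i+1}`. -/
def dy (i : Fin n) : Module.End F (Osc F n n₁ n₂) := dVar F n n₁ n₂ (.inr i)

/-- The operator `E_{i,j}^x`; the position of `i` is among `1,…,n₁` iff `i.val < n₁`. -/
def opX (i j : Fin n) : Module.End F (Osc F n n₁ n₂) :=
  if i.val < n₁ then
    if j.val < n₁ then -(mx F n n₁ n₂ j * dx F n n₁ n₂ i) - (if i = j then 1 else 0)
    else dx F n n₁ n₂ i * dx F n n₁ n₂ j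
  else
    if j.val < n₁ then -(mx F n n₁ n₂ i * mx F n n₁ n₂ j)
    else mx F n n₁ n₂ i * dx F n n₁ n₂ j

/-- The operator `E_{i,j}^y`; the position of `i` is among `1,…,n₂` iff `i.val < n₂`. -/
def opY (i j : Fin n) : Module.End F (Osc F n n₁ n₂) :=
  if i.val < n₂ then
    if j.val < n₂ then my F n n₁ n₂ i * dy F n n₁ n₂ j
    else -(my F n n₁ n₂ i * my F n n₁ n₂ j)
  else
    if j.val < n₂ then dy F n n₁ n₂ i * dy F n n₁ n₂ j
    else -(my F n n₁ n₂ j * dy F n n₁ n₂ i) - (if i = j then 1 else 0)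

/-- The operator `E_{i,j}|_ℬ = E_{i,j}^x - E_{j,i}^y` by which a matrix unit acts. -/
def opE (i j : Fin n) : Module.End F (Osc F n n₁ n₂) :=
  opX F n n₁ n₂ i j - opY F n n₁ n₂ j i

/-- The variated Laplace operator `𝒟`. -/
def laplace : Module.End F (Osc F n n₁ n₂) :=
  ∑ i : Fin n,
    if i.val < n₁ then -(mx F n n₁ n₂ i * dy F n n₁ n₂ i)
    else if i.val < n₂ then dx F n n₁ n₂ i * dy F n n₁ n₂ i
    else -(my F n n₁ n₂ i * dx F n n₁ n₂ i)

/-- The `ℤ²`-degree of the variables. -/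
def degVar : Fin n ⊕ Fin n → ℤ × ℤ
  | .inl i => if i.val < n₁ then (-1, 0) else (1, 0)
  | .inr i => if i.val < n₂ then (0, 1) else (0, -1)

/-- The graded piece `ℬ_⟨ℓ₁,ℓ₂⟩`: the polynomials all of whose monomials `x^α y^β` satisfy
`∑_{r>n₁} α_r - ∑_{i≤n₁} α_i = ℓ₁` and `∑_{i≤n₂} β_i - ∑_{r>n₂} β_r = ℓ₂`. -/
def gradedPiece (ℓ₁ ℓ₂ : ℤ) : Submodule F (Osc F n n₁ n₂) :=
  (weightedHomogeneousSubmodule F (degVar n n₁ n₂) (ℓ₁, ℓ₂) :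
    Submodule F (MvPolynomial (Fin n ⊕ Fin n) F))

end Operators

section Commutators

variable {F : Type*} [Field F] {n n₁ n₂ : ℕ}

theorem mulVar_comm (s t : Fin n ⊕ Fin n) :
    mulVar F n n₁ n₂ s * mulVar F n n₁ n₂ t = mulVar F n n₁ n₂ t * mulVar F n n₁ n₂ s := by
  refine LinearMap.ext fun f => ?_
  change var F n n₁ n₂ s * (var F n n₁ n₂ t * f) = var F n n₁ n₂ t * (var F n n₁ n₂ s * f)
  ring

theorem dVar_comm (s t : Fin n ⊕ Fin n) :
    dVar F n n₁ n₂ s * dVar F n n₁ n₂ t = dVar F n n₁ n₂ t * dVar F n n₁ n₂ s := by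
  have h : ⁅pderiv (R := F) s, pderiv (R := F) t⁆ = 0 := by
    classical
    refine MvPolynomial.derivation_ext fun i => ?_
    rw [Derivation.commutator_apply, pderiv_X, pderiv_X]
    have c : ∀ (p : Prop) [Decidable p] (u : Fin n ⊕ Fin n),
        pderiv u (if p then (1 : MvPolynomial (Fin n ⊕ Fin n) F) else 0) = 0 := by
      intro p _ u
      split_ifs <;> simp
    simp [Pi.single_apply, c]
  refine LinearMap.ext fun f => ?_
  have h' := Derivation.commutator_apply (D1 := pderiv (R := F) s) (D2 := pderiv (R := F) t) f
  rw [h] at h'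
  exact (sub_eq_zero.mp h'.symm)

theorem dVar_mulVar (s t : Fin n ⊕ Fin n) :
    dVar F n n₁ n₂ s * mulVar F n n₁ n₂ t =
      mulVar F n n₁ n₂ t * dVar F n n₁ n₂ s + (if s = t then 1 else 0) := by
  classical
  refine LinearMap.ext fun f => ?_
  by_cases h : s = t
  · subst h
    rw [if_pos rfl]
    have key : ∀ g : MvPolynomial (Fin n ⊕ Fin n) F,
        pderiv s (X s * g) = X s * pderiv s g + g := fun g => by simp
    exact key f
  · rw [if_neg h, add_zero]
    have key : ∀ g : MvPolynomial (Fin n ⊕ Fin n) F,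
        pderiv s (X t * g) = X t * pderiv s g := fun g => by simp [pderiv_X, h]
    exact key f

/-- The operator that replaces `x_i`. -/
def uX (i : Fin n) : Module.End F (Osc F n n₁ n₂) :=
  if i.val < n₁ then dx F n n₁ n₂ i else mx F n n₁ n₂ i

/-- The operator that replaces `∂_{x_i}`. -/
def vX (i : Fin n) : Module.End F (Osc F n n₁ n₂) :=
  if i.val < n₁ then -mx F n n₁ n₂ i else dx F n n₁ n₂ i

/-- The operator that replaces `y_i`. -/
def uY (i : Fin n) : Module.End F (Osc F n n₁ n₂) :=
  if i.val < n₂ then my F n n₁ n₂ i else dy F n n₁ n₂ i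

/-- The operator that replaces `∂_{y_i}`. -/
def vY (i : Fin n) : Module.End F (Osc F n n₁ n₂) :=
  if i.val < n₂ then dy F n n₁ n₂ i else -my F n n₁ n₂ i

theorem opX_eq (i j : Fin n) : opX F n n₁ n₂ i j = uX i * vX j := by
  unfold opX uX vX mx dx
  by_cases hi : i.val < n₁ <;> by_cases hj : j.val < n₁ <;> simp only [hi, hj, if_true, if_false]
  · rw [mul_neg, dVar_mulVar]
    by_cases h : i = j <;> simp [h] <;> abel
  · rw [mul_neg]

theorem opY_eq (i j : Fin n) : opY F n n₁ n₂ i j = uY i * vY j := by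
  unfold opY uY vY my dy
  by_cases hi : i.val < n₂ <;> by_cases hj : j.val < n₂ <;> simp only [hi, hj, if_true, if_false]
  · rw [mul_neg]
  · rw [mul_neg, dVar_mulVar]
    by_cases h : i = j <;> simp [h] <;> abel

theorem laplace_eq (h12 : n₁ ≤ n₂) :
    laplace F n n₁ n₂ = ∑ i : Fin n, vX i * vY i := by
  unfold laplace
  refine Finset.sum_congr rfl fun i _ => ?_
  unfold vX vY mx my dx dy
  by_cases h1 : i.val < n₁
  · have h2 : i.val < n₂ := lt_of_lt_of_le h1 h12
    simp [h1, h2]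
  · by_cases h2 : i.val < n₂
    · simp [h1, h2]
    · simp only [h1, h2, if_false]
      rw [mul_neg, dVar_mulVar]
      simp

theorem vX_uX (i j : Fin n) :
    (vX i * uX j : Module.End F (Osc F n n₁ n₂)) = uX j * vX i + (if i = j then 1 else 0) := by
  unfold uX vX mx dx
  by_cases hi : i.val < n₁ <;> by_cases hj : j.val < n₁ <;> simp only [hi, hj, if_true, if_false]
  · rw [mul_neg, dVar_mulVar]
    by_cases h : i = j <;> simp [h, eq_comm]
  · have h : i ≠ j := fun h => hj (h ▸ hi)
    rw [neg_mul, mul_neg, mulVar_comm]; simp [h]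
  · have h : i ≠ j := fun h => hi (h ▸ hj)
    rw [dVar_comm]; simp [h]
  · rw [dVar_mulVar]; simp

theorem vY_uY (i j : Fin n) :
    (vY i * uY j : Module.End F (Osc F n n₁ n₂)) = uY j * vY i + (if i = j then 1 else 0) := by
  unfold uY vY my dy
  by_cases hi : i.val < n₂ <;> by_cases hj : j.val < n₂ <;> simp only [hi, hj, if_true, if_false]
  · rw [dVar_mulVar]; simp
  · have h : i ≠ j := fun h => hj (h ▸ hi)
    rw [dVar_comm]; simp [h]
  · have h : i ≠ j := fun h => hi (h ▸ hj)
    rw [neg_mul, mul_neg, mulVar_comm]; simp [h]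
  · rw [mul_neg, dVar_mulVar]
    by_cases h : i = j <;> simp [h, eq_comm]

theorem uX_comm (i j : Fin n) : (uX i * uX j : Module.End F (Osc F n n₁ n₂)) = uX j * uX i := by
  unfold uX mx dx
  by_cases hi : i.val < n₁ <;> by_cases hj : j.val < n₁ <;> simp only [hi, hj, if_true, if_false]
  · rw [dVar_comm]
  · have h : i ≠ j := fun h => hj (h ▸ hi)
    rw [dVar_mulVar]; simp [h]
  · have h : j ≠ i := fun h => hi (h ▸ hj)
    rw [dVar_mulVar]; simp [h]
  · rw [mulVar_comm]

theorem vX_comm (i j : Fin n) : (vX i * vX j : Module.End F (Osc F n n₁ n₂)) = vX j * vX i := by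
  unfold vX mx dx
  by_cases hi : i.val < n₁ <;> by_cases hj : j.val < n₁ <;> simp only [hi, hj, if_true, if_false]
  · rw [neg_mul_neg, neg_mul_neg, mulVar_comm]
  · have h : j ≠ i := fun h => hj (h ▸ hi)
    rw [neg_mul, mul_neg, dVar_mulVar]; simp [h]
  · have h : i ≠ j := fun h => hi (h ▸ hj)
    rw [neg_mul, mul_neg, dVar_mulVar]; simp [h]
  · rw [dVar_comm]

theorem uY_comm (i j : Fin n) : (uY i * uY j : Module.End F (Osc F n n₁ n₂)) = uY j * uY i := by
  unfold uY my dy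
  by_cases hi : i.val < n₂ <;> by_cases hj : j.val < n₂ <;> simp only [hi, hj, if_true, if_false]
  · rw [mulVar_comm]
  · have h : j ≠ i := fun h => hj (h ▸ hi)
    rw [dVar_mulVar]; simp [h]
  · have h : i ≠ j := fun h => hi (h ▸ hj)
    rw [dVar_mulVar]; simp [h]
  · rw [dVar_comm]

theorem vY_comm (i j : Fin n) : (vY i * vY j : Module.End F (Osc F n n₁ n₂)) = vY j * vY i := by
  unfold vY my dy
  by_cases hi : i.val < n₂ <;> by_cases hj : j.val < n₂ <;> simp only [hi, hj, if_true, if_false]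
  · rw [dVar_comm]
  · have h : i ≠ j := fun h => hj (h ▸ hi)
    rw [neg_mul, mul_neg, dVar_mulVar]; simp [h]
  · have h : j ≠ i := fun h => hi (h ▸ hj)
    rw [neg_mul, mul_neg, dVar_mulVar]; simp [h]
  · rw [neg_mul_neg, neg_mul_neg, mulVar_comm]

theorem mulVar_dVar_xy (i j : Fin n) :
    mulVar F n n₁ n₂ (.inl i) * dVar F n n₁ n₂ (.inr j) =
      dVar F n n₁ n₂ (.inr j) * mulVar F n n₁ n₂ (.inl i) := by
  rw [dVar_mulVar]; simp

theorem dVar_mulVar_xy (i j : Fin n) :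
    dVar F n n₁ n₂ (.inl i) * mulVar F n n₁ n₂ (.inr j) =
      mulVar F n n₁ n₂ (.inr j) * dVar F n n₁ n₂ (.inl i) := by
  rw [dVar_mulVar]; simp

theorem uX_uY (i j : Fin n) : (uX i * uY j : Module.End F (Osc F n n₁ n₂)) = uY j * uX i := by
  unfold uX uY mx my dx dy
  by_cases hi : i.val < n₁ <;> by_cases hj : j.val < n₂ <;>
    simp only [hi, hj, if_true, if_false, neg_mul, mul_neg, neg_neg,
      mulVar_comm (.inl i), dVar_comm (.inl i), mulVar_dVar_xy, dVar_mulVar_xy]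

theorem uX_vY (i j : Fin n) : (uX i * vY j : Module.End F (Osc F n n₁ n₂)) = vY j * uX i := by
  unfold uX vY mx my dx dy
  by_cases hi : i.val < n₁ <;> by_cases hj : j.val < n₂ <;>
    simp only [hi, hj, if_true, if_false, neg_mul, mul_neg, neg_neg,
      mulVar_comm (.inl i), dVar_comm (.inl i), mulVar_dVar_xy, dVar_mulVar_xy]

theorem vX_uY (i j : Fin n) : (vX i * uY j : Module.End F (Osc F n n₁ n₂)) = uY j * vX i := by
  unfold vX uY mx my dx dy
  by_cases hi : i.val < n₁ <;> by_cases hj : j.val < n₂ <;>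
    simp only [hi, hj, if_true, if_false, neg_mul, mul_neg, neg_neg,
      mulVar_comm (.inl i), dVar_comm (.inl i), mulVar_dVar_xy, dVar_mulVar_xy]

theorem vX_vY (i j : Fin n) : (vX i * vY j : Module.End F (Osc F n n₁ n₂)) = vY j * vX i := by
  unfold vX vY mx my dx dy
  by_cases hi : i.val < n₁ <;> by_cases hj : j.val < n₂ <;>
    simp only [hi, hj, if_true, if_false, neg_mul, mul_neg, neg_neg,
      mulVar_comm (.inl i), dVar_comm (.inl i), mulVar_dVar_xy, dVar_mulVar_xy]

theorem opE_eq (i j : Fin n) : opE F n n₁ n₂ i j = uX i * vX j - uY j * vY i := by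
  rw [opE, opX_eq, opY_eq]

theorem commutator_aux {R : Type*} [Ring R] {a b c d e e' : R} (hac : a * c = c * a)
    (hbd : b * d = d * b) (hbc : b * c = c * b + e) (hda : d * a = a * d + e') :
    a * b * (c * d) - c * d * (a * b) = a * e * d - c * e' * b := by
  have h1 : a * b * (c * d) = c * a * (d * b) + a * e * d := by
    calc a * b * (c * d) = a * (b * c) * d := by noncomm_ring
      _ = a * c * (b * d) + a * e * d := by rw [hbc]; noncomm_ring
      _ = _ := by rw [hac, hbd]
  have h2 : c * d * (a * b) = c * a * (d * b) + c * e' * b := by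
    calc c * d * (a * b) = c * (d * a) * b := by noncomm_ring
      _ = _ := by rw [hda]; noncomm_ring
  rw [h1, h2]; abel

/-- The commutation relations of the matrix units. -/
theorem opE_comm (i j k l : Fin n) :
    opE F n n₁ n₂ i j * opE F n n₁ n₂ k l - opE F n n₁ n₂ k l * opE F n n₁ n₂ i j =
      (if j = k then opE F n n₁ n₂ i l else 0) - (if l = i then opE F n n₁ n₂ k j else 0) := by
  have hx := commutator_aux (uX_comm (F := F) (n₁ := n₁) (n₂ := n₂) i k) (vX_comm j l)
    (vX_uX j k) (vX_uX l i)
  have hy := commutator_aux (uY_comm (F := F) (n₁ := n₁) (n₂ := n₂) j l) (vY_comm i k)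
    (vY_uY i l) (vY_uY k j)
  have c1 : (uX i * vX j * (uY l * vY k) : Module.End F (Osc F n n₁ n₂)) =
      uY l * vY k * (uX i * vX j) :=
    Commute.mul_left (Commute.mul_right (uX_uY i l) (uX_vY i k))
      (Commute.mul_right (vX_uY j l) (vX_vY j k))
  have c2 : (uX k * vX l * (uY j * vY i) : Module.End F (Osc F n n₁ n₂)) =
      uY j * vY i * (uX k * vX l) :=
    Commute.mul_left (Commute.mul_right (uX_uY k j) (uX_vY k i))
      (Commute.mul_right (vX_uY l j) (vX_vY l i))
  simp only [opE_eq]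
  rw [show ∀ a b c d : Module.End F (Osc F n n₁ n₂), (a - b) * (c - d) - (c - d) * (a - b) =
    (a * c - c * a) + (b * d - d * b) - (a * d - d * a) + (c * b - b * c) by
      intros; noncomm_ring, c1, c2, hx, hy]
  by_cases h1 : j = k <;> by_cases h2 : l = i
  · subst h1; subst h2; simp; abel
  · subst h1; simp [h2, Ne.symm h2]; abel
  · subst h2; simp [h1, Ne.symm h1]; abel
  · simp [h1, h2, Ne.symm h1, Ne.symm h2]

theorem opE_laplace (h12 : n₁ ≤ n₂) (i j : Fin n) :
    laplace F n n₁ n₂ * opE F n n₁ n₂ i j = opE F n n₁ n₂ i j * laplace F n n₁ n₂ := by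
  have key : ∀ k : Fin n, ((vX k * vY k) * (uX i * vX j - uY j * vY i) :
      Module.End F (Osc F n n₁ n₂)) - (uX i * vX j - uY j * vY i) * (vX k * vY k) =
      (if k = i then vX j * vY i else 0) - (if k = j then vX j * vY i else 0) := by
    intro k
    have a1 : ((vX k * vY k) * (uX i * vX j) : Module.End F (Osc F n n₁ n₂)) =
        (uX i * vX j) * (vX k * vY k) + (if k = i then 1 else 0) * (vX j * vY k) := by
      calc ((vX k * vY k) * (uX i * vX j) : Module.End F (Osc F n n₁ n₂))
          = vX k * (vY k * uX i) * vX j := by noncomm_ring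
        _ = (vX k * uX i) * (vY k * vX j) := by rw [← uX_vY]; noncomm_ring
        _ = uX i * (vX k * vX j) * vY k + (if k = i then 1 else 0) * (vX j * vY k) := by
          rw [vX_uX, ← vX_vY]; noncomm_ring
        _ = _ := by rw [vX_comm k j]; noncomm_ring
    have a2 : ((vX k * vY k) * (uY j * vY i) : Module.End F (Osc F n n₁ n₂)) =
        (uY j * vY i) * (vX k * vY k) + vX k * (if k = j then 1 else 0) * vY i := by
      calc ((vX k * vY k) * (uY j * vY i) : Module.End F (Osc F n n₁ n₂))
          = vX k * (vY k * uY j) * vY i := by noncomm_ring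
        _ = (vX k * uY j) * (vY k * vY i) + vX k * (if k = j then 1 else 0) * vY i := by
          rw [vY_uY]; noncomm_ring
        _ = uY j * (vX k * vY i) * vY k + vX k * (if k = j then 1 else 0) * vY i := by
          rw [vY_comm k i, vX_uY]; noncomm_ring
        _ = _ := by rw [vX_vY k i]; noncomm_ring
    rw [mul_sub, sub_mul, a1, a2]
    by_cases h1 : k = i <;> by_cases h2 : k = j
    · subst h1; subst h2; simp
    · subst h1; simp [h2]
    · subst h2; simp [h1]
    · simp [h1, h2]
  rw [← sub_eq_zero, laplace_eq h12, opE_eq, Finset.sum_mul, Finset.mul_sum,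
    ← Finset.sum_sub_distrib, Finset.sum_congr rfl fun k _ => key k, Finset.sum_sub_distrib]
  simp

end Commutators

section Grading

variable {F : Type*} [Field F] {n n₁ n₂ : ℕ}

theorem mulVar_mem {s : Fin n ⊕ Fin n} {a b : ℤ} {f : Osc F n n₁ n₂}
    (hf : f ∈ gradedPiece F n n₁ n₂ a b) {a' b' : ℤ}
    (h : degVar n n₁ n₂ s + (a, b) = (a', b')) :
    mulVar F n n₁ n₂ s f ∈ gradedPiece F n n₁ n₂ a' b' := by
  have := (isWeightedHomogeneous_X F (degVar n n₁ n₂) s).mul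
    (show IsWeightedHomogeneous (degVar n n₁ n₂) _ (a, b) from hf)
  rw [h] at this
  exact this

theorem dVar_mem {s : Fin n ⊕ Fin n} {a b : ℤ} {f : Osc F n n₁ n₂}
    (hf : f ∈ gradedPiece F n n₁ n₂ a b) {a' b' : ℤ}
    (h : (a', b') + degVar n n₁ n₂ s = (a, b)) :
    dVar F n n₁ n₂ s f ∈ gradedPiece F n n₁ n₂ a' b' :=
  IsWeightedHomogeneous.pderiv
    (show IsWeightedHomogeneous (degVar n n₁ n₂) _ (a, b) from hf) h

theorem uX_mem (i : Fin n) {a b : ℤ} {f : Osc F n n₁ n₂}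
    (hf : f ∈ gradedPiece F n n₁ n₂ a b) : uX i f ∈ gradedPiece F n n₁ n₂ (a + 1) b := by
  unfold uX
  split_ifs with hi
  · exact dVar_mem hf (by simp [degVar, hi])
  · exact mulVar_mem hf (by simp [degVar, hi, add_comm])

theorem vX_mem (i : Fin n) {a b : ℤ} {f : Osc F n n₁ n₂}
    (hf : f ∈ gradedPiece F n n₁ n₂ a b) : vX i f ∈ gradedPiece F n n₁ n₂ (a - 1) b := by
  unfold vX
  split_ifs with hi
  · exact Submodule.neg_mem _ (mulVar_mem hf (by simp [degVar, hi]; ring))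
  · exact dVar_mem hf (by simp [degVar, hi])

theorem uY_mem (i : Fin n) {a b : ℤ} {f : Osc F n n₁ n₂}
    (hf : f ∈ gradedPiece F n n₁ n₂ a b) : uY i f ∈ gradedPiece F n n₁ n₂ a (b + 1) := by
  unfold uY
  split_ifs with hi
  · exact mulVar_mem hf (by simp [degVar, hi, add_comm])
  · exact dVar_mem hf (by simp [degVar, hi])

theorem vY_mem (i : Fin n) {a b : ℤ} {f : Osc F n n₁ n₂}
    (hf : f ∈ gradedPiece F n n₁ n₂ a b) : vY i f ∈ gradedPiece F n n₁ n₂ a (b - 1) := by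
  unfold vY
  split_ifs with hi
  · exact dVar_mem hf (by simp [degVar, hi])
  · exact Submodule.neg_mem _ (mulVar_mem hf (by simp [degVar, hi]; ring))

theorem opE_mem (i j : Fin n) {a b : ℤ} {f : Osc F n n₁ n₂}
    (hf : f ∈ gradedPiece F n n₁ n₂ a b) :
    opE F n n₁ n₂ i j f ∈ gradedPiece F n n₁ n₂ a b := by
  rw [opE_eq]
  have h1 := uX_mem i (vX_mem j hf)
  have h2 := uY_mem j (vY_mem i hf)
  rw [sub_add_cancel] at h1 h2
  exact Submodule.sub_mem _ h1 h2

end Grading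

section Representation

variable (F : Type*) [Field F] (n n₁ n₂ : ℕ)

/-- The Lie algebra `sl(n,𝔽)`. -/
abbrev SLn : LieSubalgebra F (Matrix (Fin n) (Fin n) F) :=
  LieAlgebra.SpecialLinear.sl (Fin n) F

/-- The linear extension of `E_{i,j} ↦ E_{i,j}|_ℬ` to all matrices. -/
def glAction : Matrix (Fin n) (Fin n) F →ₗ[F] Module.End F (Osc F n n₁ n₂) where
  toFun A := ∑ i, ∑ j, A i j • opE F n n₁ n₂ i j
  map_add' A B := by simp [add_smul, Finset.sum_add_distrib]
  map_smul' c A := by simp [mul_smul, Finset.smul_sum]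

theorem glAction_apply (A : Matrix (Fin n) (Fin n) F) :
    glAction F n n₁ n₂ A = ∑ i, ∑ j, A i j • opE F n n₁ n₂ i j := rfl

theorem glAction_single (i j : Fin n) (c : F) :
    glAction F n n₁ n₂ (Matrix.single i j c) = c • opE F n n₁ n₂ i j := by
  rw [glAction_apply, Finset.sum_eq_single i, Finset.sum_eq_single j]
  · simp
  · intro b _ hb; simp [hb.symm]
  · simp
  · intro b _ hb; simp [hb.symm]
  · simp

theorem glAction_lie (A B : Matrix (Fin n) (Fin n) F) :
    glAction F n n₁ n₂ (A * B - B * A) =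
      glAction F n n₁ n₂ A * glAction F n n₁ n₂ B -
        glAction F n n₁ n₂ B * glAction F n n₁ n₂ A := by
  induction A using Matrix.induction_on' with
  | h_zero => simp
  | h_add p q hp hq =>
    rw [show (p + q) * B - B * (p + q) = (p * B - B * p) + (q * B - B * q) by noncomm_ring,
      map_add, hp, hq, map_add]
    noncomm_ring
  | h_std_basis i j a =>
    induction B using Matrix.induction_on' with
    | h_zero => simp
    | h_add p q hp hq =>
      rw [show Matrix.single i j a * (p + q) - (p + q) * Matrix.single i j a =
        (Matrix.single i j a * p - p * Matrix.single i j a) +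
          (Matrix.single i j a * q - q * Matrix.single i j a) by noncomm_ring,
        map_add, hp, hq, map_add]
      noncomm_ring
    | h_std_basis k l b =>
      have h := opE_comm (F := F) (n₁ := n₁) (n₂ := n₂) i j k l
      have e1 : Matrix.single i j a * Matrix.single k l b =
          if j = k then Matrix.single i l (a * b) else 0 := by
        by_cases hjk : j = k
        · subst hjk; simp
        · simp [hjk]
      have e2 : Matrix.single k l b * Matrix.single i j a =
          if l = i then Matrix.single k j (a * b) else 0 := by
        by_cases hli : l = i
        · subst hli; simp [mul_comm]
        · simp [hli]
      rw [map_sub, e1, e2, glAction_single, glAction_single, smul_mul_smul_comm,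
        smul_mul_smul_comm, mul_comm b a, ← smul_sub, h, smul_sub]
      by_cases h1 : j = k <;> by_cases h2 : l = i <;> simp [h1, h2, glAction_single]

/-- The non-canonical oscillator representation of `sl(n,𝔽)` on `ℬ`. -/
def oscRep : SLn F n →ₗ⁅F⁆ Module.End F (Osc F n n₁ n₂) where
  toLinearMap := glAction F n n₁ n₂ ∘ₗ (SLn F n).toSubmodule.subtype
  map_lie' {A B} := glAction_lie F n n₁ n₂ A.1 B.1

instance : LieRingModule (SLn F n) (Osc F n n₁ n₂) :=
  LieRingModule.compLieHom _ (oscRep F n n₁ n₂)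

instance : LieModule F (SLn F n) (Osc F n n₁ n₂) :=
  LieModule.compLieHom _ (oscRep F n n₁ n₂)

theorem lie_def (A : SLn F n) (f : Osc F n n₁ n₂) :
    ⁅A, f⁆ = ∑ i, ∑ j, A.1 i j • opE F n n₁ n₂ i j f := by
  change glAction F n n₁ n₂ A.1 f = _
  simp [glAction_apply, LinearMap.sum_apply]

/-- The `sl(n,𝔽)`-module `ℋ_⟨ℓ₁,ℓ₂⟩ = {f ∈ ℬ_⟨ℓ₁,ℓ₂⟩ | 𝒟 f = 0}`. -/
def harmonic {n₁ n₂ : ℕ} (h12 : n₁ ≤ n₂) (ℓ₁ ℓ₂ : ℤ) :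
    LieSubmodule F (SLn F n) (Osc F n n₁ n₂) where
  toSubmodule := gradedPiece F n n₁ n₂ ℓ₁ ℓ₂ ⊓ LinearMap.ker (laplace F n n₁ n₂)
  lie_mem {A f} hf := by
    rw [lie_def]
    refine Submodule.sum_mem _ fun i _ => Submodule.sum_mem _ fun j _ =>
      Submodule.smul_mem _ _ ⟨opE_mem i j hf.1, ?_⟩
    have h := congrArg (fun T => T f) (opE_laplace (F := F) h12 i j)
    have h0 : laplace F n n₁ n₂ f = 0 := hf.2
    simp only [Module.End.mul_apply, h0, map_zero] at h
    exact h

/-- The Cartan subalgebra `𝔥` of `sl(n,𝔽)`: the diagonal matrices of trace zero. -/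
def cartan : LieSubalgebra F (SLn F n) where
  carrier := {A | A.1.IsDiag}
  zero_mem' := Matrix.isDiag_zero
  add_mem' h h' := Matrix.IsDiag.add h h'
  smul_mem' c _ h := Matrix.IsDiag.smul c h
  lie_mem' {A B} h h' := by
    have e := (Matrix.isDiag_iff_diagonal_diag A.1).mp h
    have e' := (Matrix.isDiag_iff_diagonal_diag B.1).mp h'
    change (A.1 * B.1 - B.1 * A.1).IsDiag
    rw [← e, ← e', Matrix.diagonal_mul_diagonal, Matrix.diagonal_mul_diagonal]
    exact (Matrix.isDiag_diagonal _).sub (Matrix.isDiag_diagonal _)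

/-- The fundamental weight `λ_k`, i.e. the restriction to `𝔥` of `A ↦ A₁₁ + ⋯ + A_{kk}`.
For `1 ≤ k ≤ n - 1` these are the fundamental weights; `λ_0 = λ_n = 0`. -/
def fundWeight (k : ℕ) : Module.Dual F (cartan F n) where
  toFun A := ∑ i : Fin n, if i.val < k then A.1.1 i i else 0
  map_add' A B := by
    rw [← Finset.sum_add_distrib]
    refine Finset.sum_congr rfl fun i _ => ?_
    split_ifs <;> simp
  map_smul' c A := by
    rw [RingHom.id_apply, smul_eq_mul, Finset.mul_sum]
    refine Finset.sum_congr rfl fun i _ => ?_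
    split_ifs <;> simp

section General

variable (M : Type*) [AddCommGroup M] [Module F M] [LieRingModule (SLn F n) M]
  [LieModule F (SLn F n) M]

/-- The weight space of weight `χ ∈ 𝔥*`. -/
def wtSpace (χ : Module.Dual F (cartan F n)) : Submodule F M :=
  (LieModule.weightSpace (R := F) (L := cartan F n) M (χ : cartan F n → F)).toSubmodule

/-- `M` is a weight module: the direct sum of its weight spaces. -/
def IsWeightModule : Prop :=
  iSupIndep (wtSpace F n M) ∧ ⨆ χ, wtSpace F n M χ = ⊤

/-- `M` is completely pointed: an infinite-dimensional weight module all of whose (nonzero) weight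
spaces are one-dimensional. -/
def IsCompletelyPointed : Prop :=
  ¬ Module.Finite F M ∧ IsWeightModule F n M ∧
    ∀ χ, wtSpace F n M χ ≠ ⊥ → Module.finrank F (wtSpace F n M χ) = 1

variable {F n M}

/-- `v` is a highest-weight vector of weight `χ`: a nonzero vector of weight `χ` killed by all
`E_{i,j}` with `i < j`. -/
def IsHighestWeightVector (v : M) (χ : Module.Dual F (cartan F n)) : Prop :=
  v ≠ 0 ∧ v ∈ wtSpace F n M χ ∧
    ∀ (i j : Fin n) (h : i < j), ⁅LieAlgebra.SpecialLinear.single i j h.ne (1 : F), v⁆ = 0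

end General

end Representation

section List

variable (F : Type*) [Field F] (n n₁ n₂ : ℕ)

/-- The variable `x_k` for `1 ≤ k ≤ n` (and `0` for other `k`, which never occurs below). -/
def xv (k : ℕ) : Osc F n n₁ n₂ :=
  if h : 1 ≤ k ∧ k ≤ n then var F n n₁ n₂ (.inl ⟨k - 1, by omega⟩) else 0

/-- The variable `y_k` for `1 ≤ k ≤ n` (and `0` for other `k`, which never occurs below). -/
def yv (k : ℕ) : Osc F n n₁ n₂ :=
  if h : 1 ≤ k ∧ k ≤ n then var F n n₁ n₂ (.inr ⟨k - 1, by omega⟩) else 0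

/-- `ζ₁ = x_{n₁-1} y_{n₁} - x_{n₁} y_{n₁-1}`. -/
def zeta₁ : Osc F n n₁ n₂ :=
  xv F n n₁ n₂ (n₁ - 1) * yv F n n₁ n₂ n₁ - xv F n n₁ n₂ n₁ * yv F n n₁ n₂ (n₁ - 1)

/-- `ζ₂ = x_{n₁+1} y_{n₁+2} - x_{n₁+2} y_{n₁+1}`. -/
def zeta₂ : Osc F n n₁ n₂ :=
  xv F n n₁ n₂ (n₁ + 1) * yv F n n₁ n₂ (n₁ + 2) - xv F n n₁ n₂ (n₁ + 2) * yv F n n₁ n₂ (n₁ + 1)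

/-- The polynomial `η^{m₁+m₂}(x₁^{m₂} y₂^{-m₁})` for `n = 2`, where `η = y₁ ∂_{x₁} + x₂ y₂`, written
out by the binomial theorem. -/
def etaVector (m₁ m₂ : ℕ) : Osc F n n₁ n₂ :=
  ∑ j ∈ Finset.range (m₂ + 1),
    (((m₁ + m₂).choose j * m₂.descFactorial j : ℕ) : F) •
      (xv F n n₁ n₂ 1 ^ (m₂ - j) * yv F n n₁ n₂ 1 ^ j *
        xv F n n₁ n₂ 2 ^ (m₁ + m₂ - j) * yv F n n₁ n₂ 2 ^ (m₂ - j))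

/-- The list of completely pointed modules `ℋ_⟨ℓ₁,ℓ₂⟩`, each with its highest-weight vector `v` and
highest weight `χ`. -/
def Listed (ℓ₁ ℓ₂ : ℤ) (v : Osc F n n₁ n₂) (χ : Module.Dual F (cartan F n)) : Prop :=
  (n₁ + 1 < n₂ ∧ n₂ = n ∧
    ((∃ m : ℕ, ℓ₁ = m ∧ ℓ₂ = 0 ∧ v = xv F n n₁ n₂ (n₁ + 1) ^ m ∧
        χ = -((m : F) + 1) • fundWeight F n n₁ + (m : F) • fundWeight F n (n₁ + 1)) ∨
     (∃ m : ℕ, ℓ₁ = -m ∧ ℓ₂ = 0 ∧ v = xv F n n₁ n₂ n₁ ^ m ∧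
        χ = (m : F) • fundWeight F n (n₁ - 1) - ((m : F) + 1) • fundWeight F n n₁))) ∨
  (n₁ + 1 = n₂ ∧ n₂ = n ∧
    ((∃ m : ℕ, ℓ₁ = -m ∧ ℓ₂ = 0 ∧ v = xv F n n₁ n₂ (n - 1) ^ m ∧
        χ = (m : F) • fundWeight F n (n - 2) - ((m : F) + 1) • fundWeight F n (n - 1)) ∨
     (∃ m : ℕ, ℓ₁ = m ∧ ℓ₂ = 0 ∧ v = xv F n n₁ n₂ n ^ m ∧
        χ = -((m : F) + 1) • fundWeight F n (n - 1)) ∨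
     (n = 2 ∧ ∃ m₁ m₂ : ℕ, m₂ ≤ m₁ ∧ ℓ₁ = -m₁ ∧ ℓ₂ = m₂ ∧
        v = xv F n n₁ n₂ 1 ^ m₁ * yv F n n₁ n₂ 2 ^ m₂ ∧
        χ = ((m₂ : F) - m₁ - 1) • fundWeight F n 1) ∨
     (n = 2 ∧ ∃ m₁ m₂ : ℕ, 1 ≤ m₁ ∧ 1 ≤ m₂ ∧ ℓ₁ = m₁ ∧ ℓ₂ = m₂ ∧
        v = etaVector F n n₁ n₂ m₁ m₂ ∧
        χ = -((m₁ : F) + m₂ + 1) • fundWeight F n 1))) ∨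
  (n₁ = 1 ∧ n₂ = 1 ∧
    ((∃ m : ℕ, ℓ₁ = -m ∧ ℓ₂ = 0 ∧ v = xv F n n₁ n₂ 1 ^ m ∧
        χ = -((m : F) + 2) • fundWeight F n 1) ∨
     (n = 3 ∧ ∃ m : ℕ, ℓ₁ = m + 1 ∧ ℓ₂ = -m - 1 ∧ v = zeta₂ F n n₁ n₂ ^ (m + 1) ∧
        χ = -((m : F) + 3) • fundWeight F n 1) ∨
     (n = 2 ∧ ∃ m₁ m₂ : ℕ, ℓ₁ = -m₁ ∧ ℓ₂ = -m₂ ∧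
        v = xv F n n₁ n₂ 1 ^ m₁ * yv F n n₁ n₂ 2 ^ m₂ ∧
        χ = -((m₁ : F) + m₂ + 2) • fundWeight F n 1))) ∨
  (n₁ = n - 1 ∧ n₂ = n - 1 ∧
    ((∃ m : ℕ, ℓ₁ = 0 ∧ ℓ₂ = -m ∧ v = yv F n n₁ n₂ n ^ m ∧
        χ = -((m : F) + 2) • fundWeight F n (n - 1)) ∨
     (n = 3 ∧ ∃ m : ℕ, ℓ₁ = -m - 1 ∧ ℓ₂ = m + 1 ∧ v = zeta₁ F n n₁ n₂ ^ (m + 1) ∧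
        χ = -((m : F) + 3) • fundWeight F n 2)))

end List

end OscRep

end

/-!
The weights of `ℬ_⟨ℓ₁,ℓ₂⟩` correspond to the multidegrees for the grading `wtVar`, because the
total weight is fixed by `ℓ₁` and `ℓ₂` (`weightOf_inj`). So `ℋ_⟨ℓ₁,ℓ₂⟩` is irreducible and
completely pointed if it has infinitely many harmonic vectors of pairwise different multidegrees
that span it and of which each can be reached from each other one
(`isIrreducible_and_isCompletelyPointed`). It is not completely pointed if two linearly
independent harmonic vectors have the same multidegree.

*The case `n₁ < n₂`.* For some `m` the operator `𝒟` contains the summand `∂_{x_m} ∂_{y_m}`, and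
every monomial not divisible by `x_m y_m` is the remainder modulo `x_m y_m` of a harmonic vector
of the same multidegree (`exists_harmonic_of_monomial`). Two such monomials of the same degree and
multidegree exist if `n₂ < n`, or if `n₂ = n ≥ 3` and `ℓ₂ > 0`. If `n₂ = n`, the space is zero for
`ℓ₂ < 0`, and for `ℓ₂ = 0` it consists of all polynomials of degree `ℓ₁` in `x` alone; its
monomials are connected by the `E_{i,j}` (`mem_of_xExp_mem`). There remains `n = n₂ = 2`, `ℓ₂ >
0`. Here a harmonic polynomial is determined by its residue modulo `y₁`, so that the `stringVec`
form a basis on which `E_{1,2}` and `E_{2,1}` move one step down and up. A coefficient of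
`E_{1,2}` vanishes precisely for `0 ≤ -ℓ₁ < ℓ₂`.

*The case `n₁ = n₂`.* For each index `p` the variables `x_p`, `y_p` are named `u_p`, `v_p`, in one
of the two orders, so that `𝒟` is the derivation with `v_p ↦ -u_p ↦ 0`. Thus products of harmonic
polynomials are harmonic; the basic ones are the `u_p` and the determinants `u_p v_q - u_q v_p`.
For `n₁ < n`, products of these give two vectors of the same weight in all degrees that are not
listed and in which `ℋ` is not zero, while for `n₁ = n` the space `ℋ` is finite-dimensional.
Moreover `ℋ` is zero if `ℓ₁ + ℓ₂ > 0`, by the theory of `sl(2)` (`eq_zero_of_lap_eq_zero`), or if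
every monomial of the degree contains some `v_p` (`eq_zero_of_vVar_dvd`). In the listed cases all
indices but one, the solo index `p₀`, are on the same side of `n₁`. Then the `E_{q,p₀}` (or
`E_{p₀,q}`) multiply by the commuting determinants `η_q = u_{p₀} v_q - u_q v_{p₀}`, up to sign,
and the listed vector `v` is killed by the opposite operators and by the `E_{q,r}`. Hence `v`
generates the space of the `v · Q(η)` with polynomials `Q`; the opposite operators act on `Q` by
partial derivatives followed by a positive operator (`IsScalarVector.soloAct_raise_soloMap`),
which gives irreducibility. That this space is all of `ℋ` is checked modulo `v_{p₀}`, or modulo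
two variables in the cases with `n = 3` (`IsSolo.exists_soloMap_eq_of_u`,
`IsSolo.exists_soloMap_eq_of_pairDet`).
-/

noncomputable section

namespace OscRep

/-! ### Modules with a multiplicity-free family of weight vectors -/

section WeightFamilies

variable {F : Type*} [Field F] {n : ℕ}

instance : IsLieAbelian (cartan F n) where
  trivial A B := by
    have e := (Matrix.isDiag_iff_diagonal_diag A.1.1).mp A.2
    have e' := (Matrix.isDiag_iff_diagonal_diag B.1.1).mp B.2
    apply Subtype.ext
    apply Subtype.ext
    change A.1.1 * B.1.1 - B.1.1 * A.1.1 = 0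
    rw [← e, ← e', Matrix.diagonal_mul_diagonal, Matrix.diagonal_mul_diagonal, sub_eq_zero]
    exact congrArg _ (funext fun i => mul_comm _ _)

variable {M : Type*} [AddCommGroup M] [Module F M] [LieRingModule (SLn F n) M]
  [LieModule F (SLn F n) M]

theorem mem_wtSpace {χ : Module.Dual F (cartan F n)} {v : M} :
    v ∈ wtSpace F n M χ ↔ ∀ A : cartan F n, ⁅A.1, v⁆ = χ A • v :=
  LieModule.mem_weightSpace (χ : cartan F n → F) v

theorem iSupIndep_wtSpace : iSupIndep (wtSpace F n M) := by
  have h := LieSubmodule.iSupIndep_toSubmodule.mpr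
    (LieModule.iSupIndep_genWeightSpace F (cartan F n) M)
  refine (h.comp (f := fun χ : Module.Dual F (cartan F n) => (χ : cartan F n → F))
    DFunLike.coe_injective).mono fun χ => ?_
  exact LieModule.weightSpace_le_genWeightSpace M _

variable {ι : Type*} {b : ι → M} {χ : ι → Module.Dual F (cartan F n)}

theorem linearIndependent_of_weights (hχ : Function.Injective χ)
    (hb : ∀ i, b i ∈ wtSpace F n M (χ i)) (h0 : ∀ i, b i ≠ 0) : LinearIndependent F b :=
  (iSupIndep_wtSpace.comp hχ).linearIndependent _ hb h0

theorem wtSpace_eq_span (hχ : Function.Injective χ)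
    (hb : ∀ i, b i ∈ wtSpace F n M (χ i)) (hs : Submodule.span F (Set.range b) = ⊤) (i : ι) :
    wtSpace F n M (χ i) = Submodule.span F {b i} := by
  refine le_antisymm (fun v hv => ?_) ((Submodule.span_singleton_le_iff_mem _ _).mpr (hb i))
  have hv' : v ∈ Submodule.span F (Set.range b) := hs ▸ Submodule.mem_top
  have hsplit : Set.range b = {b i} ∪ b '' {j | j ≠ i} := by
    ext x; constructor
    · rintro ⟨j, rfl⟩
      by_cases h : j = i
      · left; simp [h]
      · right; exact ⟨j, h, rfl⟩
    · rintro (h | ⟨j, _, rfl⟩)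
      · exact ⟨i, h.symm⟩
      · exact ⟨j, rfl⟩
  rw [hsplit, Submodule.span_union, Submodule.mem_sup] at hv'
  obtain ⟨y, hy, z, hz, rfl⟩ := hv'
  have hyi : y ∈ wtSpace F n M (χ i) :=
    (Submodule.span_singleton_le_iff_mem _ _).mpr (hb i) hy
  have hzi : z ∈ wtSpace F n M (χ i) := by simpa using Submodule.sub_mem _ hv hyi
  have hz' : z ∈ ⨆ ψ, ⨆ (_ : ψ ≠ χ i), wtSpace F n M ψ := by
    refine (Submodule.span_le.mpr ?_) hz
    rintro _ ⟨j, hj, rfl⟩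
    exact Submodule.mem_iSup_of_mem (χ j)
      (Submodule.mem_iSup_of_mem (fun h => hj (hχ h)) (hb j))
  have := Submodule.disjoint_def.mp (iSupIndep_wtSpace (F := F) (n := n) (M := M) (χ i)) z hzi hz'
  rw [this, add_zero]; exact hy

theorem exists_weight_eq (hb : ∀ i, b i ∈ wtSpace F n M (χ i))
    (hs : Submodule.span F (Set.range b) = ⊤) {ψ : Module.Dual F (cartan F n)}
    (hψ : wtSpace F n M ψ ≠ ⊥) : ∃ i, χ i = ψ := by
  by_contra! h
  apply hψ
  have hle : (⊤ : Submodule F M) ≤ ⨆ φ, ⨆ (_ : φ ≠ ψ), wtSpace F n M φ := by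
    rw [← hs, Submodule.span_le]
    rintro _ ⟨j, rfl⟩
    exact Submodule.mem_iSup_of_mem (χ j) (Submodule.mem_iSup_of_mem (h j) (hb j))
  have hd := iSupIndep_wtSpace (F := F) (n := n) (M := M) ψ
  exact disjoint_top.mp (hd.mono_right hle)

theorem isCompletelyPointed_of_family [Infinite ι] (hχ : Function.Injective χ)
    (hb : ∀ i, b i ∈ wtSpace F n M (χ i)) (h0 : ∀ i, b i ≠ 0)
    (hs : Submodule.span F (Set.range b) = ⊤) : IsCompletelyPointed F n M := by
  refine ⟨fun hfin => ?_, ⟨iSupIndep_wtSpace, ?_⟩, fun ψ hψ => ?_⟩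
  · have := (linearIndependent_of_weights hχ hb h0).finite
    exact not_finite ι
  · rw [eq_top_iff, ← hs, Submodule.span_le]
    rintro _ ⟨j, rfl⟩
    exact Submodule.mem_iSup_of_mem (χ j) (hb j)
  · obtain ⟨i, rfl⟩ := exists_weight_eq hb hs hψ
    rw [wtSpace_eq_span hχ hb hs]
    exact finrank_span_singleton (h0 i)

/-- A nonzero submodule contains one of the weight vectors: in a nonzero element with the fewest
terms, two terms could be separated by an element of the Cartan subalgebra. -/
theorem exists_mem_of_ne_bot (hχ : Function.Injective χ)
    (hb : ∀ i, b i ∈ wtSpace F n M (χ i))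
    (hs : Submodule.span F (Set.range b) = ⊤) (N : LieSubmodule F (SLn F n) M) (hN : N ≠ ⊥) :
    ∃ i, b i ∈ N := by
  classical
  by_contra! hno
  have key : ∀ k : ℕ, ∀ c : ι →₀ F, c.support.card ≤ k →
      Finsupp.linearCombination F b c ∈ N → c = 0 := by
    intro k
    induction k with
    | zero =>
      intro c hc _
      simpa using hc
    | succ k ih =>
      intro c hc hmem
      by_contra hc0
      obtain ⟨i, hi⟩ := Finsupp.support_nonempty_iff.mpr hc0
      -- all the terms but one are removed by `h - χ_i(h)` for suitable `h`
      have hall : ∀ A : cartan F n, ∀ j, c j * (χ j A - χ i A) = 0 := by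
        intro A
        let c' : ι →₀ F := Finsupp.onFinset c.support (fun j => c j * (χ j A - χ i A))
          fun j hj => Finsupp.mem_support_iff.mpr (left_ne_zero_of_mul hj)
        have hc' : ∀ j, c' j = c j * (χ j A - χ i A) := fun j => rfl
        have hsub : c'.support ⊆ c.support.erase i := by
          intro j hj
          rw [Finsupp.mem_support_iff, hc'] at hj
          rw [Finset.mem_erase, Finsupp.mem_support_iff]
          refine ⟨?_, left_ne_zero_of_mul hj⟩
          rintro rfl
          simp at hj
        have hcard : c'.support.card ≤ k := by
          have := Finset.card_le_card hsub
          rw [Finset.card_erase_of_mem hi] at this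
          omega
        have hsubc : c'.support ⊆ c.support := hsub.trans (Finset.erase_subset _ _)
        have hm : Finsupp.linearCombination F b c' ∈ N := by
          have e : Finsupp.linearCombination F b c' =
              ⁅A.1, Finsupp.linearCombination F b c⁆ -
                χ i A • Finsupp.linearCombination F b c := by
            rw [Finsupp.linearCombination_apply, Finsupp.linearCombination_apply,
              Finsupp.sum_of_support_subset _ hsubc _ (by simp), Finsupp.sum, lie_sum,
              Finset.smul_sum, ← Finset.sum_sub_distrib]
            refine Finset.sum_congr rfl fun j _ => ?_
            rw [hc', lie_smul, mem_wtSpace.mp (hb j) A, smul_smul, smul_smul, ← sub_smul]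
            congr 1; ring
          rw [e]
          exact N.toSubmodule.sub_mem (N.lie_mem hmem) (N.toSubmodule.smul_mem _ hmem)
        have h0 := ih c' hcard hm
        intro j
        rw [← hc', h0]; rfl
      have hsupp : c.support = {i} := by
        refine Finset.Subset.antisymm (fun j hj => ?_) (by simpa using hi)
        rw [Finset.mem_singleton]
        apply hχ
        ext A
        have := (mul_eq_zero.mp (hall A j)).resolve_left (Finsupp.mem_support_iff.mp hj)
        exact sub_eq_zero.mp this
      rw [Finsupp.linearCombination_apply, Finsupp.sum, hsupp, Finset.sum_singleton] at hmem
      exact hno i ((N.toSubmodule.smul_mem_iff (Finsupp.mem_support_iff.mp hi)).mp hmem)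
  apply hN
  rw [LieSubmodule.eq_bot_iff]
  intro x hx
  have hx' : x ∈ Submodule.span F (Set.range b) := hs ▸ Submodule.mem_top
  obtain ⟨c, rfl⟩ := Finsupp.mem_span_range_iff_exists_finsupp.mp hx'
  have hc := key c.support.card c le_rfl hx
  simp [hc]

/-- A module spanned by weight vectors of different weights is irreducible if each of these vectors
generates all others. -/
theorem isIrreducible_of_family [Nonempty ι] (hχ : Function.Injective χ)
    (hb : ∀ i, b i ∈ wtSpace F n M (χ i)) (h0 : ∀ i, b i ≠ 0)
    (hs : Submodule.span F (Set.range b) = ⊤)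
    (hconn : ∀ (N : LieSubmodule F (SLn F n) M) (i j : ι), b i ∈ N → b j ∈ N) :
    LieModule.IsIrreducible F (SLn F n) M := by
  have : Nontrivial M := ⟨⟨b (Classical.arbitrary ι), 0, h0 _⟩⟩
  refine LieModule.IsIrreducible.mk fun N hN => ?_
  obtain ⟨i, hi⟩ := exists_mem_of_ne_bot hχ hb hs N hN
  rw [← LieSubmodule.toSubmodule_eq_top, eq_top_iff, ← hs, Submodule.span_le]
  rintro _ ⟨j, rfl⟩
  exact hconn N i j hi

/-- In a completely pointed module, vectors of the same weight are proportional. -/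
theorem IsCompletelyPointed.exists_smul_eq (h : IsCompletelyPointed F n M)
    {ψ : Module.Dual F (cartan F n)} {x y : M} (hx : x ∈ wtSpace F n M ψ)
    (hy : y ∈ wtSpace F n M ψ) (hx0 : x ≠ 0) : ∃ c : F, c • x = y := by
  have hne : wtSpace F n M ψ ≠ ⊥ := (Submodule.ne_bot_iff _).mpr ⟨x, hx, hx0⟩
  have := h.2.2 ψ hne
  obtain ⟨c, hc⟩ := (finrank_eq_one_iff_of_nonzero' (⟨x, hx⟩ : wtSpace F n M ψ)
    (fun h => hx0 (congrArg Subtype.val h))).mp this ⟨y, hy⟩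
  exact ⟨c, congrArg Subtype.val hc⟩

end WeightFamilies

/-! ### The operators on polynomials and the weight grading -/

/-- The polynomial ring underlying `Osc`; the parameters `n₁`, `n₂` are dropped. -/
abbrev Poly (F : Type*) [Field F] (n : ℕ) : Type _ := MvPolynomial (Fin n ⊕ Fin n) F

section PolynomialOperators

variable {F : Type*} [Field F] {n : ℕ} (n₁ n₂ : ℕ)

/-- The variated Laplace operator, as a map of polynomials. -/
def lap : Poly F n →ₗ[F] Poly F n := laplace F n n₁ n₂

/-- The operator `E_{i,j}`, as a map of polynomials. -/
def act (i j : Fin n) : Poly F n →ₗ[F] Poly F n := opE F n n₁ n₂ i j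

/-- The sign with which the exponent of `x_i` (for `k = n₁`) or `y_i` (for `k = n₂`) enters the
eigenvalue of `E_{i,i}`. -/
def sgn (k : ℕ) (i : Fin n) : ℤ := if i.val < k then -1 else 1

/-- The `ℤⁿ`-degree of the variables for which `E_{i,i}` acts on a homogeneous polynomial by its
`i`-th degree, up to the constant `wtShift`. -/
def wtVar : Fin n ⊕ Fin n → Fin n → ℤ
  | .inl i => Pi.single i (sgn n₁ i)
  | .inr i => Pi.single i (sgn n₂ i)

/-- The eigenvalue of `E_{i,i}` on the constant polynomials. -/
def wtShift (i : Fin n) : ℤ := (if i.val < n₁ then -1 else 0) + (if i.val < n₂ then 0 else 1)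

variable {n₁ n₂}

theorem lap_apply (f : Poly F n) : lap n₁ n₂ f = ∑ i : Fin n,
    if i.val < n₁ then -(X (.inl i) * pderiv (.inr i) f)
    else if i.val < n₂ then pderiv (.inl i) (pderiv (.inr i) f)
    else -(X (.inr i) * pderiv (.inl i) f) := by
  have h : ∀ g : Osc F n n₁ n₂, laplace F n n₁ n₂ g = ∑ i : Fin n,
      (if i.val < n₁ then -(mx F n n₁ n₂ i * dy F n n₁ n₂ i)
        else if i.val < n₂ then dx F n n₁ n₂ i * dy F n n₁ n₂ i
        else -(my F n n₁ n₂ i * dx F n n₁ n₂ i)) g := by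
    intro g; unfold laplace; rw [LinearMap.sum_apply]
  refine (h f).trans (Finset.sum_congr rfl fun i _ => ?_)
  split_ifs <;> rfl

theorem act_apply (i j : Fin n) (f : Poly F n) : act n₁ n₂ i j f =
    (if i.val < n₁ then
      if j.val < n₁ then -(X (.inl j) * pderiv (.inl i) f) - (if i = j then f else 0)
      else pderiv (.inl i) (pderiv (.inl j) f)
    else
      if j.val < n₁ then -(X (.inl i) * (X (.inl j) * f)) else X (.inl i) * pderiv (.inl j) f) -
    (if j.val < n₂ then
      if i.val < n₂ then X (.inr j) * pderiv (.inr i) f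
      else -(X (.inr j) * (X (.inr i) * f))
    else
      if i.val < n₂ then pderiv (.inr j) (pderiv (.inr i) f)
      else -(X (.inr i) * pderiv (.inr j) f) - (if i = j then f else 0)) := by
  have h : ∀ g : Osc F n n₁ n₂, opE F n n₁ n₂ i j g =
      opX F n n₁ n₂ i j g - opY F n n₁ n₂ j i g := fun g => rfl
  refine (h f).trans (congrArg₂ _ ?_ ?_)
  · unfold opX; split_ifs <;> rfl
  · unfold opY
    by_cases h : i = j
    · subst h; split_ifs <;> rfl
    · have h' : ¬ j = i := fun e => h e.symm
      split_ifs <;> rfl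

theorem weight_wtVar (μ : Fin n ⊕ Fin n →₀ ℕ) (i : Fin n) :
    Finsupp.weight (wtVar n₁ n₂) μ i = sgn n₁ i * μ (.inl i) + sgn n₂ i * μ (.inr i) := by
  rw [Finsupp.weight_apply, Finsupp.sum_fintype _ _ (by simp), Fintype.sum_sum_type,
    Pi.add_apply, Finset.sum_apply, Finset.sum_apply]
  simp only [Pi.smul_apply, wtVar, Pi.single_apply, smul_ite, smul_zero]
  simp [mul_comm]

theorem weight_degVar (μ : Fin n ⊕ Fin n →₀ ℕ) :
    Finsupp.weight (degVar n n₁ n₂) μ =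
      (∑ i, sgn n₁ i * μ (.inl i), -∑ i, sgn n₂ i * μ (.inr i)) := by
  rw [Finsupp.weight_apply, Finsupp.sum_fintype _ _ (by simp), Fintype.sum_sum_type]
  ext
  · rw [Prod.fst_add, Prod.fst_sum, Prod.fst_sum]
    have : ∀ i : Fin n, (μ (.inr i) • degVar n n₁ n₂ (.inr i)).1 = 0 := by
      intro i; simp only [degVar]; split_ifs <;> simp
    simp only [this, Finset.sum_const_zero, add_zero]
    refine Finset.sum_congr rfl fun i _ => ?_
    simp only [degVar, sgn]; split_ifs <;> simp
  · rw [Prod.snd_add, Prod.snd_sum, Prod.snd_sum]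
    have : ∀ i : Fin n, (μ (.inl i) • degVar n n₁ n₂ (.inl i)).2 = 0 := by
      intro i; simp only [degVar]; split_ifs <;> simp
    simp only [this, Finset.sum_const_zero, zero_add, ← Finset.sum_neg_distrib]
    refine Finset.sum_congr rfl fun i _ => ?_
    simp only [degVar, sgn]; split_ifs <;> simp

/-- The total weight is a function of the degree. -/
theorem sum_weight_wtVar (μ : Fin n ⊕ Fin n →₀ ℕ) :
    ∑ i, Finsupp.weight (wtVar n₁ n₂) μ i =
      (Finsupp.weight (degVar n n₁ n₂) μ).1 - (Finsupp.weight (degVar n n₁ n₂) μ).2 := by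
  simp only [weight_wtVar, weight_degVar, Finset.sum_add_distrib]
  ring

theorem act_self_monomial (i : Fin n) (μ : Fin n ⊕ Fin n →₀ ℕ) (c : F) :
    act n₁ n₂ i i (monomial μ c) =
      ((Finsupp.weight (wtVar n₁ n₂) μ i + wtShift n₁ n₂ i : ℤ) : F) • monomial μ c := by
  rw [act_apply, weight_wtVar]
  simp only [X_mul_pderiv_monomial, if_true, sgn, wtShift, ← Nat.cast_smul_eq_nsmul F]
  split_ifs <;> push_cast <;> module

theorem act_self {i : Fin n} {f : Poly F n} {w : Fin n → ℤ}
    (hf : IsWeightedHomogeneous (wtVar n₁ n₂) f w) :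
    act n₁ n₂ i i f = ((w i + wtShift n₁ n₂ i : ℤ) : F) • f := by
  conv_lhs => rw [f.as_sum, map_sum]
  conv_rhs => rw [f.as_sum, Finset.smul_sum]
  refine Finset.sum_congr rfl fun μ hμ => ?_
  rw [act_self_monomial, hf (mem_support_iff.mp hμ)]

/-- `f` is harmonic, homogeneous of degree `ℓ` and a weight vector (of weight `w` shifted by
`wtShift`). -/
structure IsHarmonicVector (n₁ n₂ : ℕ) (ℓ : ℤ × ℤ) (w : Fin n → ℤ) (f : Poly F n) : Prop where
  deg : IsWeightedHomogeneous (degVar n n₁ n₂) f ℓ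
  wt : IsWeightedHomogeneous (wtVar n₁ n₂) f w
  lap_eq : lap n₁ n₂ f = 0

theorem IsHarmonicVector.sum_wt {ℓ : ℤ × ℤ} {w : Fin n → ℤ} {f : Poly F n}
    (h : IsHarmonicVector n₁ n₂ ℓ w f) (h0 : f ≠ 0) : ∑ i, w i = ℓ.1 - ℓ.2 := by
  obtain ⟨μ, hμ⟩ := MvPolynomial.ne_zero_iff.mp h0
  rw [← h.deg hμ, ← h.wt hμ, sum_weight_wtVar]

theorem lap_act (h12 : n₁ ≤ n₂) (i j : Fin n) {f : Poly F n} (hf : lap n₁ n₂ f = 0) :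
    lap n₁ n₂ (act n₁ n₂ i j f) = 0 := by
  have h : lap n₁ n₂ (act n₁ n₂ i j f) = act n₁ n₂ i j (lap n₁ n₂ f) :=
    congrArg (fun T => T f) (opE_laplace (F := F) h12 i j)
  rw [h, hf, map_zero]

end PolynomialOperators

section Weights

variable {F : Type*} [Field F] {n n₁ n₂ : ℕ}

variable (F n₁ n₂) in
/-- The weight of the vectors of `wtVar`-degree `w`. -/
def weightOf (w : Fin n → ℤ) : Module.Dual F (cartan F n) where
  toFun A := ∑ i, ((w i + wtShift n₁ n₂ i : ℤ) : F) * A.1.1 i i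
  map_add' A B := by
    rw [← Finset.sum_add_distrib]
    exact Finset.sum_congr rfl fun i _ => mul_add _ _ _
  map_smul' c A := by
    rw [RingHom.id_apply, smul_eq_mul, Finset.mul_sum]
    exact Finset.sum_congr rfl fun i _ => mul_left_comm _ _ _

theorem weightOf_apply (w : Fin n → ℤ) (A : cartan F n) :
    weightOf F n₁ n₂ w A = ∑ i, ((w i + wtShift n₁ n₂ i : ℤ) : F) * A.1.1 i i := rfl

theorem lie_single (i j : Fin n) (h : i ≠ j) (f : Poly F n) :
    ⁅LieAlgebra.SpecialLinear.single i j h (1 : F), (show Osc F n n₁ n₂ from f)⁆ =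
      act n₁ n₂ i j f := by
  change glAction F n n₁ n₂ (Matrix.single i j 1) f = _
  rw [glAction_single, one_smul]; rfl

theorem lie_cartan {w : Fin n → ℤ} {f : Poly F n}
    (hf : IsWeightedHomogeneous (wtVar n₁ n₂) f w) (A : cartan F n) :
    ⁅A.1, (show Osc F n n₁ n₂ from f)⁆ = weightOf F n₁ n₂ w A • (show Osc F n n₁ n₂ from f) := by
  rw [lie_def, weightOf_apply, Finset.sum_smul]
  refine Finset.sum_congr rfl fun i _ => ?_
  rw [Finset.sum_eq_single i]
  · have := act_self (n₁ := n₁) (n₂ := n₂) (i := i) hf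
    change A.1.1 i i • act n₁ n₂ i i f = _
    rw [this, smul_smul, mul_comm]; rfl
  · intro j _ hj
    rw [show A.1.1 i j = 0 from A.2 hj.symm, zero_smul]
  · simp

/-- On vectors with the same sum of degrees, `wtVar`-degrees are determined by the weight. -/
theorem weightOf_inj [CharZero F] {w w' : Fin n → ℤ} (hsum : ∑ i, w i = ∑ i, w' i)
    (h : weightOf F n₁ n₂ w = weightOf F n₁ n₂ w') : w = w' := by
  have hconst : ∀ i j, w i - w' i = w j - w' j := by
    intro i j
    by_cases hij : i = j
    · rw [hij]
    let A : cartan F n := ⟨LieAlgebra.SpecialLinear.singleSubSingle i j 1, by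
      change Matrix.IsDiag (Matrix.single i i (1 : F) - Matrix.single j j 1)
      have e : ∀ k : Fin n, Matrix.single k k (1 : F) = Matrix.diagonal (Pi.single k 1) := by
        intro k; ext a b
        by_cases hab : a = b <;> simp [Matrix.single_apply, Pi.single_apply, hab, eq_comm]
        intro h1 h2; exact absurd (h1.symm.trans h2) (by tauto)
      rw [e, e]
      exact (Matrix.isDiag_diagonal _).sub (Matrix.isDiag_diagonal _)⟩
    have hA : ∀ u : Fin n → ℤ, weightOf F n₁ n₂ u A =
        ((u i + wtShift n₁ n₂ i : ℤ) : F) - ((u j + wtShift n₁ n₂ j : ℤ) : F) := by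
      intro u
      rw [weightOf_apply]
      have : ∀ k, A.1.1 k k = (if k = i then 1 else 0) - (if k = j then 1 else 0) := by
        intro k
        change (Matrix.single i i (1 : F) - Matrix.single j j 1 : Matrix (Fin n) (Fin n) F) k k = _
        simp [Matrix.single_apply, eq_comm]
      simp only [this, mul_sub, Finset.sum_sub_distrib]
      simp
    have h1 := congrArg (fun φ => φ A) h
    simp only [hA] at h1
    have h2 : (w i + wtShift n₁ n₂ i) - (w j + wtShift n₁ n₂ j) =
        (w' i + wtShift n₁ n₂ i) - (w' j + wtShift n₁ n₂ j) := by exact_mod_cast h1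
    linarith
  ext i
  have hs : ∑ j : Fin n, (w j - w' j) = 0 := by rw [Finset.sum_sub_distrib, hsum, sub_self]
  rw [Finset.sum_congr rfl fun j _ => hconst j i, Finset.sum_const, Finset.card_univ,
    Fintype.card_fin, nsmul_eq_mul] at hs
  have hn : (n : ℤ) ≠ 0 := by have := i.2; omega
  exact sub_eq_zero.mp ((mul_eq_zero.mp hs).resolve_left hn)

variable {h12 : n₁ ≤ n₂} {ℓ₁ ℓ₂ : ℤ}

theorem IsHarmonicVector.mem {w : Fin n → ℤ} {f : Poly F n}
    (hf : IsHarmonicVector n₁ n₂ (ℓ₁, ℓ₂) w f) :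
    (show Osc F n n₁ n₂ from f) ∈ harmonic F n h12 ℓ₁ ℓ₂ := ⟨hf.deg, hf.lap_eq⟩

theorem IsHarmonicVector.mem_wtSpace {w : Fin n → ℤ} {f : Poly F n}
    (hf : IsHarmonicVector n₁ n₂ (ℓ₁, ℓ₂) w f) :
    (⟨f, hf.mem⟩ : harmonic F n h12 ℓ₁ ℓ₂) ∈
      wtSpace F n (harmonic F n h12 ℓ₁ ℓ₂) (weightOf F n₁ n₂ w) := by
  rw [OscRep.mem_wtSpace]
  intro A
  apply Subtype.ext
  exact lie_cartan hf.wt A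

/-- Harmonic vectors of the same weight prevent `ℋ` from being completely pointed. -/
theorem IsHarmonicVector.not_isCompletelyPointed {w : Fin n → ℤ} {f g : Poly F n}
    (hf : IsHarmonicVector n₁ n₂ (ℓ₁, ℓ₂) w f) (hg : IsHarmonicVector n₁ n₂ (ℓ₁, ℓ₂) w g)
    (h0 : f ≠ 0) (h : ∀ c : F, c • f ≠ g) :
    ¬ IsCompletelyPointed F n (harmonic F n h12 ℓ₁ ℓ₂) := by
  intro hcp
  obtain ⟨c, hc⟩ := hcp.exists_smul_eq (hf.mem_wtSpace (h12 := h12)) hg.mem_wtSpace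
    (fun e => h0 (congrArg Subtype.val e))
  exact h c (congrArg Subtype.val hc)

/-- The criterion by which the listed modules are recognized: harmonic vectors of pairwise different
weights that span `ℋ` and of which each can be reached from each other one. -/
theorem isIrreducible_and_isCompletelyPointed [CharZero F] {ι : Type*} [Infinite ι]
    (b : ι → Poly F n) (w : ι → Fin n → ℤ) (hw : Function.Injective w)
    (hb : ∀ i, IsHarmonicVector n₁ n₂ (ℓ₁, ℓ₂) (w i) (b i)) (h0 : ∀ i, b i ≠ 0)
    (hs : ∀ f : Poly F n, IsWeightedHomogeneous (degVar n n₁ n₂) f (ℓ₁, ℓ₂) → lap n₁ n₂ f = 0 →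
      f ∈ Submodule.span F (Set.range b))
    (hconn : ∀ S : Submodule F (Poly F n),
      (∀ i j, i ≠ j → ∀ f ∈ S, act n₁ n₂ i j f ∈ S) → ∀ i j, b i ∈ S → b j ∈ S) :
    LieModule.IsIrreducible F (SLn F n) (harmonic F n h12 ℓ₁ ℓ₂) ∧
      IsCompletelyPointed F n (harmonic F n h12 ℓ₁ ℓ₂) := by
  let bM : ι → harmonic F n h12 ℓ₁ ℓ₂ := fun i => ⟨b i, (hb i).mem⟩
  have hχ : Function.Injective fun i => weightOf F n₁ n₂ (w i) := by
    intro i j hij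
    refine hw (weightOf_inj (F := F) (n₁ := n₁) (n₂ := n₂) ?_ hij)
    rw [(hb i).sum_wt (h0 i), (hb j).sum_wt (h0 j)]
  have hbM : ∀ i, bM i ∈ wtSpace F n (harmonic F n h12 ℓ₁ ℓ₂) (weightOf F n₁ n₂ (w i)) :=
    fun i => (hb i).mem_wtSpace
  have h0M : ∀ i, bM i ≠ 0 := fun i e => h0 i (congrArg Subtype.val e)
  have hsM : Submodule.span F (Set.range bM) = ⊤ := by
    rw [eq_top_iff]
    rintro ⟨f, hf⟩ -
    obtain ⟨c, hc⟩ := Finsupp.mem_span_range_iff_exists_finsupp.mp (hs f hf.1 hf.2)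
    refine Finsupp.mem_span_range_iff_exists_finsupp.mpr ⟨c, Subtype.ext ?_⟩
    refine Eq.trans ?_ hc
    change (harmonic F n h12 ℓ₁ ℓ₂).toSubmodule.subtype (c.sum fun i a => a • bM i) = _
    rw [map_finsuppSum]; rfl
  refine ⟨isIrreducible_of_family hχ hbM h0M hsM fun N i j hi => ?_,
    isCompletelyPointed_of_family hχ hbM h0M hsM⟩
  let S : Submodule F (Poly F n) :=
    N.toSubmodule.map (harmonic F n h12 ℓ₁ ℓ₂).toSubmodule.subtype
  have hS : ∀ a c, a ≠ c → ∀ f ∈ S, act n₁ n₂ a c f ∈ S := by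
    rintro a c hac _ ⟨g, hg, rfl⟩
    refine ⟨(⁅LieAlgebra.SpecialLinear.single a c hac (1 : F), (g : harmonic F n h12 ℓ₁ ℓ₂)⁆ :
      harmonic F n h12 ℓ₁ ℓ₂), N.lie_mem hg, ?_⟩
    exact lie_single a c hac g.1
  obtain ⟨g, hg, hgj⟩ := hconn S hS i j ⟨bM i, hi, rfl⟩
  rwa [show g = bM j from Subtype.ext hgj] at hg

/-- `ℋ = 0` is not irreducible. -/
theorem not_isIrreducible_of_eq_zero
    (h : ∀ f : Poly F n, IsWeightedHomogeneous (degVar n n₁ n₂) f (ℓ₁, ℓ₂) → lap n₁ n₂ f = 0 →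
      f = 0) :
    ¬ LieModule.IsIrreducible F (SLn F n) (harmonic F n h12 ℓ₁ ℓ₂) := by
  intro hirr
  have := LieModule.nontrivial_of_isIrreducible F (SLn F n) (harmonic F n h12 ℓ₁ ℓ₂)
  obtain ⟨x, hx⟩ := exists_ne (0 : harmonic F n h12 ℓ₁ ℓ₂)
  exact hx (Subtype.ext (h x.1 x.2.1 x.2.2))

theorem IsHarmonicVector.isHighestWeightVector {w : Fin n → ℤ} {f : Poly F n}
    (hf : IsHarmonicVector n₁ n₂ (ℓ₁, ℓ₂) w f) (h0 : f ≠ 0)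
    (hE : ∀ i j : Fin n, i < j → act n₁ n₂ i j f = 0) :
    IsHighestWeightVector (⟨f, hf.mem⟩ : harmonic F n h12 ℓ₁ ℓ₂) (weightOf F n₁ n₂ w) :=
  ⟨fun e => h0 (congrArg Subtype.val e), hf.mem_wtSpace, fun i j h =>
    Subtype.ext ((lie_single i j h.ne f).trans (hE i j h))⟩

end Weights

/-! ### The modules of polynomials in `x` alone -/

section XMonomials

variable {F : Type*} [Field F] {n n₁ n₂ : ℕ}

/-- The exponent of the monomial `x^α`. -/
def xExp (α : Fin n → ℕ) : Fin n ⊕ Fin n →₀ ℕ := Finsupp.equivFunOnFinite.symm (Sum.elim α 0)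

@[simp] theorem xExp_inl (α : Fin n → ℕ) (i : Fin n) : xExp α (.inl i) = α i := rfl
@[simp] theorem xExp_inr (α : Fin n → ℕ) (i : Fin n) : xExp α (.inr i) = 0 := rfl

theorem pderiv_inr_xExp (α : Fin n → ℕ) (i : Fin n) (c : F) :
    pderiv (.inr i) (monomial (xExp α) c) = 0 := by
  rw [pderiv_monomial]; simp

theorem sgn_ne_zero (k : ℕ) (i : Fin n) : sgn k i ≠ 0 := by
  unfold sgn; split_ifs <;> decide

theorem lap_xExp (h2 : n₂ = n) (α : Fin n → ℕ) (c : F) :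
    lap n₁ n₂ (monomial (xExp α) c) = 0 := by
  rw [lap_apply]
  refine Finset.sum_eq_zero fun i _ => ?_
  have hi : i.val < n₂ := h2 ▸ i.2
  simp only [pderiv_inr_xExp, hi, if_true, mul_zero, neg_zero, map_zero, ite_self]

theorem isHarmonicVector_xExp (h2 : n₂ = n) {α : Fin n → ℕ} {ℓ : ℤ}
    (hα : ∑ i, sgn n₁ i * (α i : ℤ) = ℓ) (c : F) :
    IsHarmonicVector n₁ n₂ (ℓ, 0) (fun i => sgn n₁ i * (α i : ℤ)) (monomial (xExp α) c) where
  deg := isWeightedHomogeneous_monomial _ _ _ (by rw [weight_degVar]; simp [hα])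
  wt := isWeightedHomogeneous_monomial _ _ _ (by ext i; rw [weight_wtVar]; simp)
  lap_eq := lap_xExp h2 α c

/-- `E_{i,j}` moves `x^α` to a nonzero multiple of `x^α'` whenever the weights of the two differ by
`ε_i - ε_j`. -/
theorem act_xExp [CharZero F] (h2 : n₂ = n) {i j : Fin n} (hij : i ≠ j) {α α' : Fin n → ℕ}
    (hi : sgn n₁ i * (α' i : ℤ) = sgn n₁ i * α i + 1)
    (hj : sgn n₁ j * (α' j : ℤ) = sgn n₁ j * α j - 1)
    (hk : ∀ k, k ≠ i → k ≠ j → α' k = α k) :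
    ∃ c : F, c ≠ 0 ∧ act n₁ n₂ i j (monomial (xExp α) (1 : F)) = c • monomial (xExp α') 1 := by
  have hi2 : i.val < n₂ := h2 ▸ i.2
  have hj2 : j.val < n₂ := h2 ▸ j.2
  have hX : ∀ (s : Fin n ⊕ Fin n) (μ : Fin n ⊕ Fin n →₀ ℕ) (c : F),
      X s * monomial μ c = monomial (Finsupp.single s 1 + μ) c := by
    intro s μ c; rw [X, monomial_mul, one_mul]
  simp only [act_apply, hi2, hj2, if_true, pderiv_inr_xExp, mul_zero, sub_zero, if_neg hij]
  unfold sgn at hi hj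
  have hsm : ∀ c : F, monomial (xExp α') c = c • monomial (xExp α') (1 : F) := by
    intro c; rw [smul_monomial, smul_eq_mul, mul_one]
  have hext : ∀ μ : Fin n ⊕ Fin n →₀ ℕ, μ (.inl i) = α' i → μ (.inl j) = α' j →
      (∀ k, k ≠ i → k ≠ j → μ (.inl k) = α k) → (∀ k, μ (.inr k) = 0) → μ = xExp α' := by
    intro μ a1 a2 a3 a4
    ext (k | k)
    · by_cases e1 : k = i
      · rw [e1, a1]; rfl
      · by_cases e2 : k = j
        · rw [e2, a2]; rfl
        · rw [a3 k e1 e2, xExp_inl, hk k e1 e2]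
    · rw [a4]; rfl
  by_cases ci : i.val < n₁ <;> by_cases cj : j.val < n₁ <;>
    simp only [ci, cj, if_true, if_false] at hi hj ⊢
  · refine ⟨-(α i : F), neg_ne_zero.mpr (Nat.cast_ne_zero.mpr (by omega)), ?_⟩
    rw [pderiv_monomial, hX, neg_smul, ← hsm, xExp_inl, one_mul]
    congr 3
    apply hext
    · simp [hij.symm]; omega
    · simp [hij]; omega
    · intro k e1 e2; simp [e1, e2]
    · simp
  · refine ⟨(α i : F) * α j, mul_ne_zero (Nat.cast_ne_zero.mpr (by omega))
      (Nat.cast_ne_zero.mpr (by omega)), ?_⟩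
    rw [pderiv_monomial, pderiv_monomial, ← hsm, one_mul]
    congr 1
    · congr 1
      apply hext
      · simp [hij]; omega
      · simp [hij.symm]; omega
      · intro k e1 e2; simp [e1, e2]
      · simp
    · simp [hij, mul_comm]
  · refine ⟨-1, by simp, ?_⟩
    rw [hX, hX, neg_smul, one_smul]
    congr 3
    apply hext
    · simp [hij]; omega
    · simp [hij.symm]; omega
    · intro k e1 e2; simp [e1, e2]
    · simp
  · refine ⟨(α j : F), Nat.cast_ne_zero.mpr (by omega), ?_⟩
    rw [pderiv_monomial, hX, ← hsm, xExp_inl, one_mul]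
    congr 2
    apply hext
    · simp [hij]; omega
    · simp [hij.symm]; omega
    · intro k e1 e2; simp [e1, e2]
    · simp

/-- Any `x^α` can be moved to any `x^α'` of the same degree: as long as they differ, some `E_{i,j}`
brings the weights closer together. -/
theorem mem_of_xExp_mem [CharZero F] (h2 : n₂ = n) {S : Submodule F (Poly F n)}
    (hS : ∀ i j, i ≠ j → ∀ f ∈ S, act n₁ n₂ i j f ∈ S) (α' : Fin n → ℕ) :
    ∀ (N : ℕ) (α : Fin n → ℕ), ∑ i, (sgn n₁ i * (α' i : ℤ) - sgn n₁ i * α i).natAbs ≤ N →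
      ∑ i, sgn n₁ i * (α i : ℤ) = ∑ i, sgn n₁ i * (α' i : ℤ) →
      monomial (xExp α) (1 : F) ∈ S → monomial (xExp α') (1 : F) ∈ S := by
  intro N
  induction N with
  | zero =>
    intro α hN _ hα
    have : α = α' := by
      ext i
      have h := (Finset.sum_eq_zero_iff.mp (Nat.le_zero.mp hN)) i (Finset.mem_univ i)
      have h' : sgn n₁ i * ((α' i : ℤ) - α i) = 0 := by
        rw [mul_sub]; exact Int.natAbs_eq_zero.mp h
      have := (mul_eq_zero.mp h').resolve_left (sgn_ne_zero _ _)
      omega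
    rwa [this] at hα
  | succ N ih =>
    intro α hN hsum hα
    by_cases heq : ∀ i, sgn n₁ i * (α' i : ℤ) - sgn n₁ i * α i = 0
    · exact ih α (by simp [heq]) hsum hα
    push Not at heq
    obtain ⟨i₀, hi₀⟩ := heq
    have hs : ∑ i, (sgn n₁ i * (α' i : ℤ) - sgn n₁ i * α i) = 0 := by
      rw [Finset.sum_sub_distrib, hsum, sub_self]
    obtain ⟨i, -, hi⟩ := Finset.exists_pos_of_sum_zero_of_exists_nonzero _ hs
      ⟨i₀, Finset.mem_univ _, hi₀⟩
    obtain ⟨j, -, hj⟩ := Finset.exists_pos_of_sum_zero_of_exists_nonzero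
      (fun i => -(sgn n₁ i * (α' i : ℤ) - sgn n₁ i * α i)) (s := Finset.univ)
      (by rw [Finset.sum_neg_distrib, hs, neg_zero]) ⟨i₀, Finset.mem_univ _, neg_ne_zero.mpr hi₀⟩
    have hij : i ≠ j := by rintro rfl; linarith
    -- one step from `α` towards `α'`
    let β : Fin n → ℕ := fun k =>
      if k = i then (α i + sgn n₁ i).toNat else if k = j then (α j - sgn n₁ j).toNat else α k
    have hβi : sgn n₁ i * (β i : ℤ) = sgn n₁ i * α i + 1 := by
      have : (β i : ℤ) = ((α i + sgn n₁ i).toNat : ℤ) := by simp [β]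
      rw [this]
      unfold sgn at hi ⊢
      split_ifs at hi ⊢ <;> omega
    have hβj : sgn n₁ j * (β j : ℤ) = sgn n₁ j * α j - 1 := by
      have : (β j : ℤ) = ((α j - sgn n₁ j).toNat : ℤ) := by simp [β, hij.symm]
      rw [this]
      unfold sgn at hj ⊢
      split_ifs at hj ⊢ <;> omega
    have hβk : ∀ k, k ≠ i → k ≠ j → β k = α k := fun k h1 h2 => by simp [β, h1, h2]
    obtain ⟨c, hc, hact⟩ := act_xExp (F := F) (n₁ := n₁) h2 hij hβi hβj hβk
    have hβ : ∀ k, sgn n₁ k * (β k : ℤ) =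
        sgn n₁ k * α k + (if k = i then 1 else 0) - (if k = j then 1 else 0) := by
      intro k
      by_cases e1 : k = i
      · subst e1; simp [hβi, hij]
      · by_cases e2 : k = j
        · subst e2; simp [hβj, e1]
        · simp [hβk k e1 e2, e1, e2]
    refine ih β ?_ ?_ ?_
    · have : ∑ k, (sgn n₁ k * (α' k : ℤ) - sgn n₁ k * β k).natAbs <
          ∑ k, (sgn n₁ k * (α' k : ℤ) - sgn n₁ k * α k).natAbs := by
        refine Finset.sum_lt_sum (fun k _ => ?_) ⟨i, Finset.mem_univ _, ?_⟩
        · rw [hβ]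
          by_cases e1 : k = i
          · subst e1; rw [if_pos rfl, if_neg hij]; omega
          · by_cases e2 : k = j
            · subst e2; rw [if_pos rfl, if_neg e1]; omega
            · rw [if_neg e1, if_neg e2]; omega
        · rw [hβi]; omega
      omega
    · rw [← hsum]
      simp only [hβ, Finset.sum_add_distrib, Finset.sum_sub_distrib]
      simp
    · have := hS i j hij _ hα
      rw [hact] at this
      exact (S.smul_mem_iff hc).mp this

variable {h12 : n₁ ≤ n₂}

/-- For `n₂ = n` and `ℓ₂ = 0` all polynomials in `ℬ_⟨ℓ₁,0⟩` are free of `y`, hence harmonic. -/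
theorem xModule_isIrreducible_and_isCompletelyPointed [CharZero F] (h1 : 1 ≤ n₁) (h1n : n₁ < n)
    (h2 : n₂ = n) (ℓ : ℤ) :
    LieModule.IsIrreducible F (SLn F n) (harmonic F n h12 ℓ 0) ∧
      IsCompletelyPointed F n (harmonic F n h12 ℓ 0) := by
  let ι := {α : Fin n → ℕ // ∑ i, sgn n₁ i * (α i : ℤ) = ℓ}
  have hw : Function.Injective fun (α : ι) (i : Fin n) => sgn n₁ i * ((α.1 i : ℕ) : ℤ) := by
    intro α β h
    apply Subtype.ext
    ext i
    exact_mod_cast mul_left_cancel₀ (sgn_ne_zero n₁ i) (congrFun h i)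
  let p : Fin n := ⟨0, by omega⟩
  let q : Fin n := ⟨n₁, h1n⟩
  have hpq : p ≠ q := by intro h; have := congrArg Fin.val h; simp [p, q] at this; omega
  -- the exponents of `x_p ^ (k + (-ℓ)⁺) x_q ^ (k + ℓ⁺)`
  have : Infinite ι := by
    refine Infinite.of_injective (fun k : ℕ => (⟨fun i =>
      if i = p then k + (-ℓ).toNat else if i = q then k + ℓ.toNat else 0, ?_⟩ : ι)) ?_
    · rw [Finset.sum_eq_add p q hpq]
      · have e1 : sgn n₁ p = -1 := if_pos (by simp only [p]; omega)
        have e2 : sgn n₁ q = 1 := if_neg (by simp only [q]; omega)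
        simp only [if_true, if_neg hpq.symm, e1, e2]
        omega
      · rintro c - ⟨hc1, hc2⟩
        simp [hc1, hc2]
      · simp
      · simp
    · intro a b hab
      have := congrFun (congrArg Subtype.val hab) p
      simpa using this
  refine isIrreducible_and_isCompletelyPointed
    (fun α : ι => monomial (xExp α.1) (1 : F)) _ hw
    (fun α => isHarmonicVector_xExp h2 α.2 1) (fun α => by simp) ?_ ?_
  · intro f hf _
    rw [f.as_sum]
    refine Submodule.sum_mem _ fun μ hμ => ?_
    have hdeg := hf (mem_support_iff.mp hμ)
    rw [weight_degVar, Prod.mk.injEq] at hdeg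
    have h2' : ∀ i : Fin n, μ (.inr i) = 0 := by
      have hs : ∑ i : Fin n, (μ (.inr i) : ℤ) = 0 := by
        rw [← hdeg.2, ← Finset.sum_neg_distrib]
        refine Finset.sum_congr rfl fun i _ => ?_
        rw [show sgn n₂ i = -1 from if_pos (h2 ▸ i.2)]; ring
      intro i
      have := (Finset.sum_eq_zero_iff_of_nonneg (fun i _ => by positivity)).mp hs i
        (Finset.mem_univ i)
      exact_mod_cast this
    have e : μ = xExp fun i => μ (.inl i) := by
      ext (i | i)
      · rfl
      · simp [h2']
    rw [← mul_one (coeff μ f), ← smul_eq_mul, ← smul_monomial]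
    refine Submodule.smul_mem _ _ (Submodule.subset_span ⟨⟨fun i => μ (.inl i), hdeg.1⟩, ?_⟩)
    change monomial (xExp fun i => μ (.inl i)) (1 : F) = monomial μ 1
    rw [← e]
  · intro S hS α β hα
    exact mem_of_xExp_mem h2 hS β.1 _ α.1 le_rfl (by rw [α.2, β.2]) hα

end XMonomials

/-! ### Harmonic vectors with prescribed leading monomial for `n₁ < n₂` -/

section LeadingMonomials

variable {F : Type*} [Field F] {n n₁ n₂ : ℕ}

variable (n₁ n₂) in
/-- The summand of the operator `lap` with index `i`. -/
def lapTerm (i : Fin n) (f : Poly F n) : Poly F n :=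
  if i.val < n₁ then -(X (.inl i) * pderiv (.inr i) f)
  else if i.val < n₂ then pderiv (.inl i) (pderiv (.inr i) f)
  else -(X (.inr i) * pderiv (.inl i) f)

/-- A summand of `lap` lowers the `ω`-degree by `δ` for every grading `ω` in which the variables
`x_i` and `y_i` are related as in `hω`. -/
theorem isWeightedHomogeneous_lapTerm {M : Type*} [AddCommGroup M] {ω : Fin n ⊕ Fin n → M}
    {δ a : M} {i : Fin n}
    (hω : ω (.inr i) = (if i.val < n₁ then ω (.inl i) + δ
      else if i.val < n₂ then δ - ω (.inl i) else ω (.inl i) - δ))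
    {f : Poly F n} (hf : IsWeightedHomogeneous ω f a) :
    IsWeightedHomogeneous ω (lapTerm n₁ n₂ i f) (a - δ) := by
  have hd : ∀ (s : Fin n ⊕ Fin n) (g : Poly F n) (c : M), IsWeightedHomogeneous ω g c →
      IsWeightedHomogeneous ω (pderiv s g) (c - ω s) :=
    fun s g c hg => IsWeightedHomogeneous.pderiv hg (sub_add_cancel c (ω s))
  unfold lapTerm
  by_cases c1 : i.val < n₁
  · rw [if_pos c1] at hω ⊢
    have h := ((isWeightedHomogeneous_X F ω (.inl i)).mul (hd (.inr i) f a hf)).neg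
    rwa [show ω (.inl i) + (a - ω (.inr i)) = a - δ by rw [hω]; abel] at h
  · rw [if_neg c1] at hω ⊢
    by_cases c2 : i.val < n₂
    · rw [if_pos c2] at hω ⊢
      have h := hd (.inl i) _ _ (hd (.inr i) f a hf)
      rwa [show a - ω (.inr i) - ω (.inl i) = a - δ by rw [hω]; abel] at h
    · rw [if_neg c2] at hω ⊢
      have h := ((isWeightedHomogeneous_X F ω (.inr i)).mul (hd (.inl i) f a hf)).neg
      rwa [show ω (.inr i) + (a - ω (.inl i)) = a - δ by rw [hω]; abel] at h

variable (n₁ n₂) in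
/-- The degree and the `wtVar`-degree combined. -/
def bigradVar (s : Fin n ⊕ Fin n) : (ℤ × ℤ) × (Fin n → ℤ) := (degVar n n₁ n₂ s, wtVar n₁ n₂ s)

theorem weight_bigradVar (μ : Fin n ⊕ Fin n →₀ ℕ) : Finsupp.weight (bigradVar n₁ n₂) μ =
    (Finsupp.weight (degVar n n₁ n₂) μ, Finsupp.weight (wtVar n₁ n₂) μ) := by
  simp only [Finsupp.weight_apply, Finsupp.sum, bigradVar, Prod.smul_mk]
  ext
  all_goals simp [Prod.fst_sum, Prod.snd_sum]

theorem isWeightedHomogeneous_lap (h12 : n₁ ≤ n₂) {f : Poly F n} {a : (ℤ × ℤ) × (Fin n → ℤ)}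
    (hf : IsWeightedHomogeneous (bigradVar n₁ n₂) f a) :
    IsWeightedHomogeneous (bigradVar n₁ n₂) (lap n₁ n₂ f) (a - ((1, 1), 0)) := by
  rw [lap_apply]
  refine IsWeightedHomogeneous.sum _ _ _ fun i _ => ?_
  refine isWeightedHomogeneous_lapTerm ?_ hf
  unfold bigradVar degVar wtVar sgn
  have : i.val < n₁ → i.val < n₂ := fun h => by omega
  by_cases c1 : i.val < n₁
  · simp [c1, this c1]
  · by_cases c2 : i.val < n₂ <;> simp [c1, c2, Pi.single_neg]

/-- The degree that counts, for each index other than `m`, one variable by which the summand of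
`lap` with this index differentiates: all these summands lower it by one. -/
def removedVar (n₁ : ℕ) (m : Fin n) : Fin n ⊕ Fin n → ℤ
  | .inl i => if i = m ∨ i.val < n₁ then 0 else 1
  | .inr i => if i = m ∨ ¬ i.val < n₁ then 0 else 1

theorem removedVar_nonneg (m : Fin n) (s : Fin n ⊕ Fin n) : 0 ≤ removedVar n₁ m s := by
  cases s <;> simp only [removedVar] <;> split_ifs <;> decide

theorem weight_removedVar_nonneg (m : Fin n) (μ : Fin n ⊕ Fin n →₀ ℕ) :
    0 ≤ Finsupp.weight (removedVar n₁ m) μ := by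
  rw [Finsupp.weight_apply]
  exact Finset.sum_nonneg fun s _ => nsmul_nonneg (removedVar_nonneg m s) _

theorem lap_eq_lapTerm_add (m : Fin n) (f : Poly F n) :
    lap n₁ n₂ f = lapTerm n₁ n₂ m f + ∑ i ∈ Finset.univ.erase m, lapTerm n₁ n₂ i f := by
  rw [lap_apply]
  exact (Finset.add_sum_erase _ _ (Finset.mem_univ m)).symm

theorem isWeightedHomogeneous_sum_lapTerm (m : Fin n) {f : Poly F n} {k : ℤ}
    (hf : IsWeightedHomogeneous (removedVar n₁ m) f k) :
    IsWeightedHomogeneous (removedVar n₁ m)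
      (∑ i ∈ Finset.univ.erase m, lapTerm n₁ n₂ i f) (k - 1) := by
  refine IsWeightedHomogeneous.sum _ _ _ fun i hi => isWeightedHomogeneous_lapTerm ?_ hf
  have him := Finset.ne_of_mem_erase hi
  by_cases c1 : i.val < n₁ <;> simp [removedVar, him, c1]

/-- The operator `lap` maps the multiples of `x_m y_m` with `n₁ < m ≤ n₂` onto all polynomials: the
summand `∂_{x_m} ∂_{y_m}` does, and the others lower the degree `removedVar`, over which the
induction runs. -/
theorem exists_lap_eq [CharZero F] (h12 : n₁ ≤ n₂) {m : Fin n} (hm1 : ¬ m.val < n₁)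
    (hm2 : m.val < n₂) (k : ℕ) :
    ∀ (a : (ℤ × ℤ) × (Fin n → ℤ)) (g : Poly F n),
      IsWeightedHomogeneous (removedVar n₁ m) g ((k : ℤ) - 1) →
      IsWeightedHomogeneous (bigradVar n₁ n₂) g (a - ((1, 1), 0)) →
      ∃ h : Poly F n, IsWeightedHomogeneous (bigradVar n₁ n₂) (X (.inl m) * X (.inr m) * h) a ∧
        lap n₁ n₂ (X (.inl m) * X (.inr m) * h) = g := by
  induction k with
  | zero =>
    intro a g hg _
    -- a polynomial of negative degree vanishes
    refine ⟨0, by rw [mul_zero]; exact isWeightedHomogeneous_zero _ _ _, ?_⟩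
    rw [mul_zero, map_zero]
    by_contra hne
    obtain ⟨μ, hμ⟩ := MvPolynomial.ne_zero_iff.mp (Ne.symm hne)
    have := weight_removedVar_nonneg (n₁ := n₁) m μ
    rw [hg hμ] at this
    norm_num at this
  | succ k ih =>
    intro a
    have hmono : ∀ (ν : Fin n ⊕ Fin n →₀ ℕ) (c : F),
        Finsupp.weight (removedVar n₁ m) ν = k →
        Finsupp.weight (bigradVar n₁ n₂) ν = a - ((1, 1), 0) →
        ∃ h : Poly F n, IsWeightedHomogeneous (bigradVar n₁ n₂) (X (.inl m) * X (.inr m) * h) a ∧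
          lap n₁ n₂ (X (.inl m) * X (.inr m) * h) = monomial ν c := by
      intro ν c hk hb
      let d : F := ((ν (.inl m) + 1 : ℕ) : F) * ((ν (.inr m) + 1 : ℕ) : F)
      have hd : d ≠ 0 := mul_ne_zero (Nat.cast_ne_zero.mpr (by omega))
        (Nat.cast_ne_zero.mpr (by omega))
      -- `x_m y_m h₀` is the preimage of the monomial under the summand with index `m`
      let h₀ : Poly F n := monomial ν (c / d)
      have e : X (.inl m) * X (.inr m) * h₀ =
          monomial (Finsupp.single (.inl m) 1 + Finsupp.single (.inr m) 1 + ν) (c / d) := by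
        simp only [h₀, X, monomial_mul, one_mul]
      have hterm : lapTerm n₁ n₂ m (X (.inl m) * X (.inr m) * h₀) = monomial ν c := by
        rw [lapTerm, if_neg hm1, if_pos hm2, e, pderiv_monomial, pderiv_monomial]
        congr 1
        · congr 1
          ext s
          simp only [Finsupp.coe_tsub, Finsupp.coe_add, Pi.sub_apply, Pi.add_apply]
          omega
        · simp only [Finsupp.coe_tsub, Finsupp.coe_add, Pi.sub_apply, Pi.add_apply,
            Finsupp.single_apply]
          simp only [reduceCtorEq, if_true, if_false]
          have e1 : c = c / d * d := (div_mul_cancel₀ c hd).symm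
          rw [show (0 + 1 + ν (.inr m)) = ν (.inr m) + 1 by ring,
            show (1 + 0 + ν (.inl m) - 0) = ν (.inl m) + 1 by omega, mul_assoc,
            mul_comm ((ν (.inr m) + 1 : ℕ) : F)]
          exact e1.symm
      have hwt : IsWeightedHomogeneous (bigradVar n₁ n₂) (X (.inl m) * X (.inr m) * h₀) a := by
        rw [e]
        refine isWeightedHomogeneous_monomial _ _ _ ?_
        rw [map_add, map_add, hb, Finsupp.weight_single, Finsupp.weight_single]
        have : bigradVar n₁ n₂ (.inl m) + bigradVar n₁ n₂ (.inr m) = ((1, 1), 0) := by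
          simp [bigradVar, degVar, wtVar, sgn, hm1, hm2, Pi.single_neg]
        rw [one_smul, one_smul, this]; abel
      have hrem : IsWeightedHomogeneous (removedVar n₁ m) (X (.inl m) * X (.inr m) * h₀) k := by
        rw [e]
        refine isWeightedHomogeneous_monomial _ _ _ ?_
        rw [map_add, map_add, hk, Finsupp.weight_single, Finsupp.weight_single]
        simp [removedVar]
      have hsum := isWeightedHomogeneous_sum_lapTerm (n₂ := n₂) m hrem
      have hlap := lap_eq_lapTerm_add (n₁ := n₁) (n₂ := n₂) m (X (.inl m) * X (.inr m) * h₀)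
      rw [hterm] at hlap
      -- the image under the other summands is of smaller degree
      obtain ⟨h₁, hh1, hh2⟩ := ih a _ hsum (by
        rw [show ∑ i ∈ Finset.univ.erase m, lapTerm n₁ n₂ i (X (.inl m) * X (.inr m) * h₀) =
          lap n₁ n₂ (X (.inl m) * X (.inr m) * h₀) - monomial ν c by rw [hlap]; ring]
        exact (isWeightedHomogeneous_lap h12 hwt).sub (isWeightedHomogeneous_monomial _ _ _ hb))
      refine ⟨h₀ - h₁, ?_, ?_⟩
      · rw [mul_sub]; exact hwt.sub hh1
      · rw [mul_sub, map_sub, hlap, hh2]; ring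
    intro g hk hb
    have hμ : ∀ μ : g.support, ∃ h : Poly F n,
        IsWeightedHomogeneous (bigradVar n₁ n₂) (X (.inl m) * X (.inr m) * h) a ∧
          lap n₁ n₂ (X (.inl m) * X (.inr m) * h) = monomial μ.1 (coeff μ.1 g) := by
      intro μ
      have hμ := mem_support_iff.mp μ.2
      exact hmono _ _ (by rw [hk hμ]; push_cast; ring) (hb hμ)
    choose h hh1 hh2 using hμ
    refine ⟨∑ μ, h μ, ?_, ?_⟩
    · rw [Finset.mul_sum]
      exact IsWeightedHomogeneous.sum _ _ _ fun μ _ => hh1 μ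
    · rw [Finset.mul_sum, map_sum, Finset.sum_congr rfl fun μ _ => hh2 μ]
      conv_rhs => rw [g.as_sum]
      exact Finset.sum_coe_sort g.support fun μ => monomial μ (coeff μ g)

/-- A monomial not divisible by `x_m y_m` is the remainder modulo `x_m y_m` of a harmonic vector. -/
theorem exists_harmonic_of_monomial [CharZero F] (h12 : n₁ ≤ n₂) {m : Fin n}
    (hm1 : ¬ m.val < n₁) (hm2 : m.val < n₂) {μ : Fin n ⊕ Fin n →₀ ℕ}
    (hμ : μ (.inl m) = 0 ∨ μ (.inr m) = 0) :
    ∃ f : Poly F n, IsHarmonicVector n₁ n₂ (Finsupp.weight (degVar n n₁ n₂) μ)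
      (Finsupp.weight (wtVar n₁ n₂) μ) f ∧
      ∀ ν : Fin n ⊕ Fin n →₀ ℕ, ν (.inl m) = 0 ∨ ν (.inr m) = 0 →
        coeff ν f = if μ = ν then 1 else 0 := by
  let g : Poly F n := monomial μ 1
  have hg : IsWeightedHomogeneous (bigradVar n₁ n₂) g (Finsupp.weight (bigradVar n₁ n₂) μ) :=
    isWeightedHomogeneous_monomial _ _ _ rfl
  have hterm : lapTerm n₁ n₂ m g = 0 := by
    rw [lapTerm, if_neg hm1, if_pos hm2, pderiv_monomial, pderiv_monomial]
    rcases hμ with h | h <;> simp [h]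
  have hlap := lap_eq_lapTerm_add (n₁ := n₁) (n₂ := n₂) m g
  rw [hterm, zero_add] at hlap
  obtain ⟨k, hk⟩ := Int.eq_ofNat_of_zero_le (weight_removedVar_nonneg (n₁ := n₁) m μ)
  obtain ⟨h, hh1, hh2⟩ := exists_lap_eq h12 hm1 hm2 k (Finsupp.weight (bigradVar n₁ n₂) μ)
    (lap n₁ n₂ g)
    (by rw [hlap]; exact isWeightedHomogeneous_sum_lapTerm m
          (isWeightedHomogeneous_monomial _ _ _ (by simpa using hk)))
    (isWeightedHomogeneous_lap h12 hg)
  have hf := hg.sub hh1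
  refine ⟨g - X (.inl m) * X (.inr m) * h, ⟨?_, ?_, ?_⟩, ?_⟩
  · intro ν hν
    have := hf hν
    rw [weight_bigradVar, weight_bigradVar] at this
    exact congrArg Prod.fst this
  · intro ν hν
    have := hf hν
    rw [weight_bigradVar, weight_bigradVar] at this
    exact congrArg Prod.snd this
  · rw [map_sub, hh2, sub_self]
  · intro ν hν
    rw [coeff_sub, coeff_monomial]
    have : coeff ν (X (.inl m) * X (.inr m) * h) = 0 := by
      rcases hν with hν | hν
      · rw [mul_assoc, coeff_X_mul', if_neg (by simpa using hν)]
      · rw [mul_comm (X (Sum.inl m)) (X (Sum.inr m)), mul_assoc, coeff_X_mul',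
          if_neg (by simpa using hν)]
    rw [this, sub_zero]

variable {h12 : n₁ ≤ n₂} {ℓ₁ ℓ₂ : ℤ}

/-- Two different monomials `κσ` and `κτ` that are not divisible by `x_m y_m` and have the same
degree and weight are the remainders of two independent harmonic vectors of the same weight. -/
theorem not_isCompletelyPointed_of_monomials [CharZero F] {m : Fin n}
    (hm1 : ¬ m.val < n₁) (hm2 : m.val < n₂) {κ σ τ : Fin n ⊕ Fin n →₀ ℕ}
    (hσ : (κ + σ) (.inl m) = 0 ∨ (κ + σ) (.inr m) = 0)
    (hτ : (κ + τ) (.inl m) = 0 ∨ (κ + τ) (.inr m) = 0)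
    (hdeg : Finsupp.weight (degVar n n₁ n₂) (κ + σ) = (ℓ₁, ℓ₂))
    (hdeg' : Finsupp.weight (degVar n n₁ n₂) σ = Finsupp.weight (degVar n n₁ n₂) τ)
    (hwt : Finsupp.weight (wtVar n₁ n₂) σ = Finsupp.weight (wtVar n₁ n₂) τ) (hne : σ ≠ τ) :
    ¬ IsCompletelyPointed F n (harmonic F n h12 ℓ₁ ℓ₂) := by
  obtain ⟨f, hf, hfc⟩ := exists_harmonic_of_monomial (F := F) h12 hm1 hm2 hσ
  obtain ⟨g, hg, hgc⟩ := exists_harmonic_of_monomial (F := F) h12 hm1 hm2 hτ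
  rw [map_add, ← hdeg', ← map_add, hdeg, map_add, ← hwt, ← map_add] at hg
  rw [hdeg] at hf
  have hne' : κ + σ ≠ κ + τ := fun h => hne (add_left_cancel h)
  refine hf.not_isCompletelyPointed hg ?_ ?_
  · intro h0
    have := hfc _ hσ
    rw [h0] at this; simp at this
  · intro c hc
    have h1 := hfc _ hτ
    have h2 := hgc _ hτ
    rw [← hc, coeff_smul, h1, if_neg hne'] at h2
    simp at h2

/-- The monomials `x₁ x_n` and `y₁ y_n` have the same degree and weight, and the common factor `κ`
adjusts the degree. -/
theorem not_isCompletelyPointed_of_lt_of_lt [CharZero F] (h1 : 1 ≤ n₁) (hlt : n₁ < n₂)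
    (hlt' : n₂ < n) : ¬ IsCompletelyPointed F n (harmonic F n h12 ℓ₁ ℓ₂) := by
  let p : Fin n := ⟨0, by omega⟩
  let m : Fin n := ⟨n₁, by omega⟩
  let q : Fin n := ⟨n - 1, by omega⟩
  have hp1 : p.val < n₁ := h1
  have hp2 : p.val < n₂ := by omega
  have hm1 : ¬ m.val < n₁ := lt_irrefl _
  have hm2 : m.val < n₂ := hlt
  have hq2 : ¬ q.val < n₂ := by simp only [q]; omega
  have hq1 : ¬ q.val < n₁ := by omega
  have hpm : p ≠ m := fun h => hm1 (h ▸ hp1)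
  have hqm : q ≠ m := fun h => hq2 (h ▸ hm2)
  refine not_isCompletelyPointed_of_monomials (m := m) hm1 hm2
    (κ := Finsupp.single (.inr p) ℓ₂.toNat + Finsupp.single (.inl p) (-ℓ₁).toNat +
      Finsupp.single (.inl q) ℓ₁.toNat + Finsupp.single (.inr q) (-ℓ₂).toNat)
    (σ := Finsupp.single (.inl p) 1 + Finsupp.single (.inl q) 1)
    (τ := Finsupp.single (.inr p) 1 + Finsupp.single (.inr q) 1) ?_ ?_ ?_ ?_ ?_ ?_
  · left; simp [hpm, hqm]
  · left; simp [hpm, hqm]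
  · simp only [map_add, Finsupp.weight_single, degVar, hp1, hp2, hq1, hq2, if_true, if_false]
    ext <;> simp <;> omega
  · simp [map_add, Finsupp.weight_single, degVar, hp1, hp2, hq1, hq2]
  · simp [map_add, Finsupp.weight_single, wtVar, sgn, hp1, hp2, hq1, hq2]
  · intro h
    have := DFunLike.congr_fun h (.inl p)
    simp at this

/-- For `q > n₁ + 1` the monomials `y₁` and `x₁ x_q y_q` have the same degree and weight. -/
theorem not_isCompletelyPointed_of_add_one_lt [CharZero F] (h1 : 1 ≤ n₁) (hlt : n₁ + 1 < n)
    (h2 : n₂ = n) (hℓ : 1 ≤ ℓ₂) : ¬ IsCompletelyPointed F n (harmonic F n h12 ℓ₁ ℓ₂) := by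
  let p : Fin n := ⟨0, by omega⟩
  let m : Fin n := ⟨n₁, by omega⟩
  let q : Fin n := ⟨n₁ + 1, by omega⟩
  have hp1 : p.val < n₁ := h1
  have hp2 : p.val < n₂ := by omega
  have hm1 : ¬ m.val < n₁ := lt_irrefl _
  have hm2 : m.val < n₂ := by simp only [m]; omega
  have hq2 : q.val < n₂ := by simp only [q]; omega
  have hq1 : ¬ q.val < n₁ := by simp only [q]; omega
  have hpm : p ≠ m := fun h => hm1 (h ▸ hp1)
  have hqm : q ≠ m := fun h => by have := congrArg Fin.val h; simp [q, m] at this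
  refine not_isCompletelyPointed_of_monomials (m := m) hm1 hm2
    (κ := Finsupp.single (.inr p) (ℓ₂ - 1).toNat + Finsupp.single (.inl p) (-ℓ₁).toNat +
      Finsupp.single (.inl q) ℓ₁.toNat)
    (σ := Finsupp.single (.inr p) 1)
    (τ := Finsupp.single (.inl p) 1 + Finsupp.single (.inl q) 1 + Finsupp.single (.inr q) 1)
    ?_ ?_ ?_ ?_ ?_ ?_
  · left; simp [hpm, hqm]
  · left; simp [hpm, hqm]
  · simp only [map_add, Finsupp.weight_single, degVar, hp1, hp2, hq1, if_true, if_false]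
    ext <;> simp <;> omega
  · simp [map_add, Finsupp.weight_single, degVar, hp1, hp2, hq1, hq2]
  · simp [map_add, Finsupp.weight_single, wtVar, sgn, hp1, hp2, hq1, hq2, add_assoc,
      ← Pi.single_add]
  · intro h
    have := DFunLike.congr_fun h (.inr p)
    have hqp : q ≠ p := fun h => hq1 (h ▸ hp1)
    simp [hqp] at this

/-- The monomials `x₂ y₁` and `x₁ y₂` have the same degree and weight.  Neither contains `y_n`, so
that they are not divisible by `x_n y_n`, whatever power of `x_n` the common factor contains. -/
theorem not_isCompletelyPointed_of_add_one_eq [CharZero F] (h1 : 2 ≤ n₁) (heq : n₁ + 1 = n)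
    (h2 : n₂ = n) (hℓ : 1 ≤ ℓ₂) : ¬ IsCompletelyPointed F n (harmonic F n h12 ℓ₁ ℓ₂) := by
  let p : Fin n := ⟨0, by omega⟩
  let m : Fin n := ⟨n₁, by omega⟩
  let q : Fin n := ⟨1, by omega⟩
  have hp1 : p.val < n₁ := by simp only [p]; omega
  have hp2 : p.val < n₂ := by omega
  have hm1 : ¬ m.val < n₁ := lt_irrefl _
  have hm2 : m.val < n₂ := by simp only [m]; omega
  have hq1 : q.val < n₁ := by simp only [q]; omega
  have hq2 : q.val < n₂ := by omega
  have hpm : p ≠ m := fun h => hm1 (h ▸ hp1)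
  have hqm : q ≠ m := fun h => hm1 (h ▸ hq1)
  refine not_isCompletelyPointed_of_monomials (m := m) hm1 hm2
    (κ := Finsupp.single (.inr p) (ℓ₂ - 1).toNat + Finsupp.single (.inl p) (-(ℓ₁ + 1)).toNat +
      Finsupp.single (.inl m) (ℓ₁ + 1).toNat)
    (σ := Finsupp.single (.inr p) 1 + Finsupp.single (.inl q) 1)
    (τ := Finsupp.single (.inl p) 1 + Finsupp.single (.inr q) 1) ?_ ?_ ?_ ?_ ?_ ?_
  · right; simp [hpm]
  · right; simp [hpm, hqm]
  · simp only [map_add, Finsupp.weight_single, degVar, hp1, hp2, hq1, hm1, if_true, if_false]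
    ext <;> simp <;> omega
  · simp [map_add, Finsupp.weight_single, degVar, hp1, hp2, hq1, hq2]
  · simp [map_add, Finsupp.weight_single, wtVar, sgn, hp1, hp2, hq1, hq2]
  · intro h
    have := DFunLike.congr_fun h (.inr p)
    have hqp : q ≠ p := fun h => by have := congrArg Fin.val h; simp [q, p] at this
    simp [hqp] at this

end LeadingMonomials

/-! ### The case `n₁ = n₂`: harmonic polynomials as the kernel of a derivation -/

section Pairs

variable {F : Type*} [Field F] {n : ℕ} (n₁ : ℕ)

/-- For `n₁ = n₂` the variables with index `p` form a pair `(u, v)` such that the operator `lap`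
is the derivation `v ↦ -u ↦ 0`; this is the label of `u`. -/
def uIdx (p : Fin n) : Fin n ⊕ Fin n := if p.val < n₁ then .inl p else .inr p

/-- The label of the partner `v` of `u`, see `uIdx`. -/
def vIdx (p : Fin n) : Fin n ⊕ Fin n := if p.val < n₁ then .inr p else .inl p

variable {n₁}

theorem eq_uIdx_or_eq_vIdx (s : Fin n ⊕ Fin n) : ∃ p, s = uIdx n₁ p ∨ s = vIdx n₁ p := by
  rcases s with p | p <;> refine ⟨p, ?_⟩ <;> unfold uIdx vIdx <;> split_ifs <;> simp

@[simp] theorem uIdx_inj {p q : Fin n} : uIdx n₁ p = uIdx n₁ q ↔ p = q := by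
  refine ⟨fun h => ?_, fun h => h ▸ rfl⟩
  unfold uIdx at h; split_ifs at h <;> simp_all

@[simp] theorem vIdx_inj {p q : Fin n} : vIdx n₁ p = vIdx n₁ q ↔ p = q := by
  refine ⟨fun h => ?_, fun h => h ▸ rfl⟩
  unfold vIdx at h; split_ifs at h <;> simp_all

@[simp] theorem uIdx_ne_vIdx {p q : Fin n} : uIdx n₁ p ≠ vIdx n₁ q := by
  intro h
  unfold uIdx vIdx at h
  split_ifs at h with h1 h2 h2
  · simp at h; exact h2 (h ▸ h1)
  · simp at h; exact h1 (h ▸ h2)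

@[simp] theorem vIdx_ne_uIdx {p q : Fin n} : vIdx n₁ p ≠ uIdx n₁ q := uIdx_ne_vIdx.symm

theorem degVar_vIdx (p : Fin n) :
    degVar n n₁ n₁ (vIdx n₁ p) = degVar n n₁ n₁ (uIdx n₁ p) + (1, 1) := by
  unfold uIdx vIdx; split_ifs with h <;> simp [degVar, h]

@[simp] theorem wtVar_uIdx (p : Fin n) : wtVar n₁ n₁ (uIdx n₁ p) = Pi.single p (sgn n₁ p) := by
  unfold uIdx; split_ifs <;> rfl

@[simp] theorem wtVar_vIdx (p : Fin n) : wtVar n₁ n₁ (vIdx n₁ p) = Pi.single p (sgn n₁ p) := by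
  unfold vIdx; split_ifs <;> rfl

theorem degVar_uIdx (p : Fin n) :
    degVar n n₁ n₁ (uIdx n₁ p) = if p.val < n₁ then (-1, 0) else (0, -1) := by
  unfold uIdx; split_ifs with h <;> simp [degVar, h]

variable (F n₁) in
/-- The variable `u_p`. -/
def uVar (p : Fin n) : Poly F n := X (uIdx n₁ p)

variable (F n₁) in
/-- The variable `v_p`. -/
def vVar (p : Fin n) : Poly F n := X (vIdx n₁ p)

theorem lap_eq_sum (f : Poly F n) :
    lap n₁ n₁ f = -∑ p, uVar F n₁ p * pderiv (vIdx n₁ p) f := by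
  rw [lap_apply, ← Finset.sum_neg_distrib]
  refine Finset.sum_congr rfl fun i _ => ?_
  unfold uVar uIdx vIdx
  split_ifs <;> rfl

theorem lap_mul (f g : Poly F n) :
    lap n₁ n₁ (f * g) = f * lap n₁ n₁ g + g * lap n₁ n₁ f := by
  simp only [lap_eq_sum, Derivation.leibniz, smul_eq_mul, mul_neg, Finset.mul_sum, mul_add,
    Finset.sum_add_distrib]
  rw [neg_add]
  congr 1 <;> congr 1 <;> exact Finset.sum_congr rfl fun p _ => by ring

@[simp] theorem lap_uVar (p : Fin n) : lap n₁ n₁ (uVar F n₁ p) = 0 := by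
  rw [lap_eq_sum]
  simp [uVar, pderiv_X]

@[simp] theorem lap_vVar (p : Fin n) : lap n₁ n₁ (vVar F n₁ p) = -uVar F n₁ p := by
  rw [lap_eq_sum]
  simp [vVar, pderiv_X, Pi.single_apply]

@[simp] theorem lap_one : lap n₁ n₁ (1 : Poly F n) = 0 := by
  rw [lap_eq_sum]; simp

theorem IsHarmonicVector.mul {ℓ ℓ' : ℤ × ℤ} {w w' : Fin n → ℤ} {f g : Poly F n}
    (hf : IsHarmonicVector n₁ n₁ ℓ w f) (hg : IsHarmonicVector n₁ n₁ ℓ' w' g) :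
    IsHarmonicVector n₁ n₁ (ℓ + ℓ') (w + w') (f * g) where
  deg := hf.deg.mul hg.deg
  wt := hf.wt.mul hg.wt
  lap_eq := by rw [lap_mul, hf.lap_eq, hg.lap_eq, mul_zero, mul_zero, add_zero]

theorem isHarmonicVector_one : IsHarmonicVector n₁ n₁ 0 0 (1 : Poly F n) where
  deg := isWeightedHomogeneous_one _ _
  wt := isWeightedHomogeneous_one _ _
  lap_eq := lap_one

theorem IsHarmonicVector.pow {ℓ : ℤ × ℤ} {w : Fin n → ℤ} {f : Poly F n}
    (hf : IsHarmonicVector n₁ n₁ ℓ w f) (k : ℕ) :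
    IsHarmonicVector n₁ n₁ (k • ℓ) (k • w) (f ^ k) := by
  induction k with
  | zero => simpa using isHarmonicVector_one
  | succ k ih => rw [pow_succ, succ_nsmul, succ_nsmul]; exact ih.mul hf

theorem isHarmonicVector_uVar (p : Fin n) :
    IsHarmonicVector n₁ n₁ (degVar n n₁ n₁ (uIdx n₁ p)) (Pi.single p (sgn n₁ p)) (uVar F n₁ p) where
  deg := isWeightedHomogeneous_X _ _ _
  wt := by
    have := isWeightedHomogeneous_X F (wtVar n₁ n₁) (uIdx n₁ p)
    rwa [wtVar_uIdx] at this
  lap_eq := lap_uVar p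

variable (F n₁) in
/-- The determinant `u_p v_q - u_q v_p`. -/
def pairDet (p q : Fin n) : Poly F n := uVar F n₁ p * vVar F n₁ q - uVar F n₁ q * vVar F n₁ p

theorem isHarmonicVector_pairDet (p q : Fin n) :
    IsHarmonicVector n₁ n₁ (degVar n n₁ n₁ (uIdx n₁ p) + degVar n n₁ n₁ (uIdx n₁ q) + (1, 1))
      (Pi.single p (sgn n₁ p) + Pi.single q (sgn n₁ q)) (pairDet F n₁ p q) where
  deg := by
    have h := (isWeightedHomogeneous_X F (degVar n n₁ n₁) (uIdx n₁ p)).mul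
      (isWeightedHomogeneous_X F (degVar n n₁ n₁) (vIdx n₁ q))
    have h' := (isWeightedHomogeneous_X F (degVar n n₁ n₁) (uIdx n₁ q)).mul
      (isWeightedHomogeneous_X F (degVar n n₁ n₁) (vIdx n₁ p))
    rw [degVar_vIdx, ← add_assoc] at h h'
    rw [add_comm (degVar n n₁ n₁ (uIdx n₁ q))] at h'
    exact h.sub h'
  wt := by
    have h := (isWeightedHomogeneous_X F (wtVar n₁ n₁) (uIdx n₁ p)).mul
      (isWeightedHomogeneous_X F (wtVar n₁ n₁) (vIdx n₁ q))
    have h' := (isWeightedHomogeneous_X F (wtVar n₁ n₁) (uIdx n₁ q)).mul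
      (isWeightedHomogeneous_X F (wtVar n₁ n₁) (vIdx n₁ p))
    rw [wtVar_uIdx, wtVar_vIdx] at h h'
    rw [add_comm] at h'
    exact h.sub h'
  lap_eq := by
    simp only [pairDet, map_sub, lap_mul, lap_uVar, lap_vVar]
    ring

end Pairs

/-! ### Vanishing in positive degree, by `sl(2)`-theory -/

section PositiveDegree

variable {F : Type*} [Field F] {n n₁ : ℕ}

theorem derivation_sum_apply {ι : Type*} (s : Finset ι)
    (D : ι → Derivation F (Poly F n) (Poly F n)) (f : Poly F n) :
    (∑ i ∈ s, D i) f = ∑ i ∈ s, D i f := by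
  rw [← Derivation.coeFnAddMonoidHom_apply, map_sum, Finset.sum_apply]
  rfl

variable (F n₁) in
/-- The operator `-∑ v_p ∂_{u_p}`, which together with `lap` spans a copy of `sl(2)`. -/
def colap : Poly F n →ₗ[F] Poly F n :=
  ((-∑ p : Fin n, vVar F n₁ p • pderiv (uIdx n₁ p) :
    Derivation F (Poly F n) (Poly F n)) : Poly F n →ₗ[F] Poly F n)

theorem colap_apply (f : Poly F n) :
    colap F n₁ f = -∑ p, vVar F n₁ p * pderiv (uIdx n₁ p) f := by
  change (-∑ p : Fin n, vVar F n₁ p • pderiv (uIdx n₁ p) :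
    Derivation F (Poly F n) (Poly F n)) f = _
  rw [Derivation.neg_apply, derivation_sum_apply]
  rfl

theorem isWeightedHomogeneous_colap {M : Type*} [AddCommGroup M] {ω : Fin n ⊕ Fin n → M} {δ a : M}
    (hω : ∀ p, ω (vIdx n₁ p) = ω (uIdx n₁ p) + δ) {f : Poly F n}
    (hf : IsWeightedHomogeneous ω f a) : IsWeightedHomogeneous ω (colap F n₁ f) (a + δ) := by
  rw [colap_apply]
  refine (IsWeightedHomogeneous.sum _ _ _ fun p _ => ?_).neg
  have h1 : IsWeightedHomogeneous ω (pderiv (uIdx n₁ p) f) (a - ω (uIdx n₁ p)) :=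
    IsWeightedHomogeneous.pderiv hf (sub_add_cancel _ _)
  have h2 := (isWeightedHomogeneous_X F ω (vIdx n₁ p)).mul h1
  rwa [show ω (vIdx n₁ p) + (a - ω (uIdx n₁ p)) = a + δ by rw [hω]; abel] at h2

/-- The operator `colap` is locally nilpotent, since it lowers the degree in the variables `u`. -/
theorem exists_colap_pow_eq_zero (f : Poly F n) : ∃ N : ℕ, (colap F n₁ ^ N) f = 0 := by
  classical
  let ω : Fin n ⊕ Fin n → ℤ := fun s => if ∃ p, s = uIdx n₁ p then 1 else 0
  have hω : ∀ p, ω (vIdx n₁ p) = ω (uIdx n₁ p) + (-1) := by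
    intro p
    have h1 : ω (uIdx n₁ p) = 1 := if_pos ⟨p, rfl⟩
    have h2 : ω (vIdx n₁ p) = 0 := if_neg (by rintro ⟨q, hq⟩; exact vIdx_ne_uIdx hq)
    rw [h1, h2]; rfl
  have hnn : ∀ μ : Fin n ⊕ Fin n →₀ ℕ, 0 ≤ Finsupp.weight ω μ := by
    intro μ
    rw [Finsupp.weight_apply]
    refine Finset.sum_nonneg fun s _ => nsmul_nonneg ?_ _
    simp only [ω]; split_ifs <;> decide
  have hpow : ∀ (N : ℕ) (g : Poly F n) (k : ℤ), IsWeightedHomogeneous ω g k →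
      IsWeightedHomogeneous ω ((colap F n₁ ^ N) g) (k - N) := by
    intro N
    induction N with
    | zero => intro g k hg; simpa using hg
    | succ N ih =>
      intro g k hg
      rw [pow_succ', Module.End.mul_apply]
      have := isWeightedHomogeneous_colap hω (ih g k hg)
      rwa [show k - N + -1 = k - ((N + 1 : ℕ) : ℤ) by push_cast; ring] at this
  induction f using MvPolynomial.induction_on' with
  | monomial μ c =>
    obtain ⟨k, hk⟩ := Int.eq_ofNat_of_zero_le (hnn μ)
    refine ⟨k + 1, ?_⟩
    have h := hpow (k + 1) (monomial μ c) k (isWeightedHomogeneous_monomial _ _ _ hk)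
    by_contra hne
    obtain ⟨ν, hν⟩ := MvPolynomial.ne_zero_iff.mp hne
    have h1 := hnn ν
    rw [h hν] at h1
    push_cast at h1
    omega
  | add f g hf hg =>
    obtain ⟨N, hN⟩ := hf
    obtain ⟨N', hN'⟩ := hg
    refine ⟨N + N', ?_⟩
    rw [map_add, pow_add, Module.End.mul_apply, Module.End.mul_apply, hN', map_zero, add_zero,
      ← Module.End.mul_apply, ← pow_add, add_comm, pow_add, Module.End.mul_apply, hN, map_zero]

/-- On polynomials of degree `ℓ`, the commutator of `lap` and `colap` is the scalar `-(ℓ₁ + ℓ₂)`.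
The commutator is a derivation, so that it can be computed on the variables. -/
theorem lap_colap {ℓ : ℤ × ℤ} {f : Poly F n}
    (hf : IsWeightedHomogeneous (degVar n n₁ n₁) f ℓ) :
    lap n₁ n₁ (colap F n₁ f) =
      colap F n₁ (lap n₁ n₁ f) - ((ℓ.1 + ℓ.2 : ℤ) : F) • f := by
  let D : Derivation F (Poly F n) (Poly F n) := -∑ p : Fin n, uVar F n₁ p • pderiv (vIdx n₁ p)
  let E : Derivation F (Poly F n) (Poly F n) := -∑ p : Fin n, vVar F n₁ p • pderiv (uIdx n₁ p)
  let H : Derivation F (Poly F n) (Poly F n) :=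
    ∑ p : Fin n, (uVar F n₁ p • pderiv (uIdx n₁ p) - vVar F n₁ p • pderiv (vIdx n₁ p))
  have hD : ∀ g, D g = lap n₁ n₁ g := by
    intro g
    rw [lap_eq_sum, Derivation.neg_apply, derivation_sum_apply]; rfl
  have hE : ∀ g, E g = colap F n₁ g := fun g => rfl
  have hHX : ∀ g, H g = ∑ p : Fin n,
      (uVar F n₁ p * pderiv (uIdx n₁ p) g - vVar F n₁ p * pderiv (vIdx n₁ p) g) := by
    intro g
    rw [derivation_sum_apply]; rfl
  have hEu : ∀ p, E (uVar F n₁ p) = -vVar F n₁ p := by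
    intro p; rw [hE, colap_apply]; simp [uVar, pderiv_X, Pi.single_apply]
  have hEv : ∀ p, E (vVar F n₁ p) = 0 := by
    intro p; rw [hE, colap_apply]; simp [vVar, pderiv_X]
  have hDu : ∀ p, D (uVar F n₁ p) = 0 := fun p => by rw [hD, lap_uVar]
  have hDv : ∀ p, D (vVar F n₁ p) = -uVar F n₁ p := fun p => by rw [hD, lap_vVar]
  have hHu : ∀ p, H (uVar F n₁ p) = uVar F n₁ p := by
    intro p; rw [hHX]; simp [uVar, pderiv_X, Pi.single_apply]
  have hHv : ∀ p, H (vVar F n₁ p) = -vVar F n₁ p := by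
    intro p; rw [hHX]; simp [vVar, pderiv_X, Pi.single_apply]
  have hbr : ⁅D, E⁆ = H := by
    refine MvPolynomial.derivation_ext fun s => ?_
    obtain ⟨p, rfl | rfl⟩ := eq_uIdx_or_eq_vIdx (n₁ := n₁) s
    · change ⁅D, E⁆ (uVar F n₁ p) = H (uVar F n₁ p)
      rw [Derivation.commutator_apply, hEu, hDu, map_neg, map_zero, hDv, hHu]; ring
    · change ⁅D, E⁆ (vVar F n₁ p) = H (vVar F n₁ p)
      rw [Derivation.commutator_apply, hEv, hDv, map_neg, map_zero, hEu, hHv]; ring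
  have hH : H f = -(((ℓ.1 + ℓ.2 : ℤ) : F) • f) := by
    conv_lhs => rw [f.as_sum, map_sum]
    conv_rhs => rw [f.as_sum, Finset.smul_sum, ← Finset.sum_neg_distrib]
    refine Finset.sum_congr rfl fun μ hμ => ?_
    have hdeg := hf (mem_support_iff.mp hμ)
    rw [weight_degVar] at hdeg
    have hsum : ℓ.1 + ℓ.2 = ∑ p : Fin n, ((μ (vIdx n₁ p) : ℤ) - μ (uIdx n₁ p)) := by
      rw [← hdeg, ← sub_eq_add_neg, ← Finset.sum_sub_distrib]
      refine Finset.sum_congr rfl fun p _ => ?_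
      unfold sgn uIdx vIdx; split_ifs <;> ring
    rw [hHX, hsum, Int.cast_sum, Finset.sum_smul, ← Finset.sum_neg_distrib]
    refine Finset.sum_congr rfl fun p _ => ?_
    unfold uVar vVar
    rw [X_mul_pderiv_monomial, X_mul_pderiv_monomial, ← Nat.cast_smul_eq_nsmul F,
      ← Nat.cast_smul_eq_nsmul F]
    push_cast
    module
  have h := congrArg (fun T : Derivation F (Poly F n) (Poly F n) => T f) hbr
  simp only [Derivation.commutator_apply, hD, hE, hH] at h
  rw [sub_eq_iff_eq_add] at h
  rw [h]; ring

/-- A lowest weight vector of a locally finite `sl(2)`-module has nonpositive weight. -/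
theorem eq_zero_of_lap_eq_zero [CharZero F] {ℓ : ℤ × ℤ} (hℓ : 0 < ℓ.1 + ℓ.2) {f : Poly F n}
    (hf : IsWeightedHomogeneous (degVar n n₁ n₁) f ℓ) (hlap : lap n₁ n₁ f = 0) : f = 0 := by
  have hdeg : ∀ k : ℕ, IsWeightedHomogeneous (degVar n n₁ n₁) ((colap F n₁ ^ k) f)
      (ℓ + k • (1, 1)) := by
    intro k
    induction k with
    | zero => simpa using hf
    | succ k ih =>
      rw [pow_succ', Module.End.mul_apply, succ_nsmul, ← add_assoc]
      exact isWeightedHomogeneous_colap degVar_vIdx ih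
  have hformula : ∀ k : ℕ, lap n₁ n₁ ((colap F n₁ ^ (k + 1)) f) =
      -((((k : ℤ) + 1) * (ℓ.1 + ℓ.2 + k) : ℤ) : F) • (colap F n₁ ^ k) f := by
    intro k
    induction k with
    | zero =>
      rw [zero_add, pow_one, lap_colap hf, hlap, map_zero, zero_sub, ← neg_smul]
      simp
    | succ k ih =>
      rw [pow_succ', Module.End.mul_apply, lap_colap (hdeg (k + 1)), ih, map_smul,
        ← Module.End.mul_apply, ← pow_succ', ← sub_smul]
      congr 1
      simp
      ring
  obtain ⟨N, hN⟩ := exists_colap_pow_eq_zero (n₁ := n₁) f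
  induction N with
  | zero => simpa using hN
  | succ k ih =>
    refine ih ?_
    have h := hformula k
    rw [hN, map_zero] at h
    refine (smul_eq_zero.mp h.symm).resolve_left (neg_ne_zero.mpr (Int.cast_ne_zero.mpr ?_))
    positivity

end PositiveDegree

/-! ### Divisibility and vanishing -/

section Vanishing

variable {F : Type*} [Field F] {n n₁ : ℕ}

theorem X_dvd_of_forall_support {t : Fin n ⊕ Fin n} {f : Poly F n}
    (h : ∀ μ ∈ f.support, μ t ≠ 0) : X t ∣ f := by
  rw [f.as_sum]
  exact Finset.dvd_sum fun μ hμ => X_dvd_monomial.mpr (Or.inr (h μ hμ))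

/-- A solution of `T f = X_s ∂_t f`, where `T` is linear over the polynomials in `X_t`, vanishes if
it is divisible by `X_t`: the equation makes it divisible by all powers of `X_t`. -/
theorem eq_zero_of_X_dvd [CharZero F] (T : Poly F n → Poly F n) {s t : Fin n ⊕ Fin n} (hst : s ≠ t)
    (hT : ∀ h, T (X t * h) = X t * T h) {f : Poly F n} (hf : T f = X s * pderiv t f)
    (hdvd : X t ∣ f) : f = 0 := by
  have hpow : ∀ (k : ℕ) (h : Poly F n), T (X t ^ k * h) = X t ^ k * T h := by
    intro k
    induction k with
    | zero => intro h; simp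
    | succ k ih => intro h; rw [pow_succ', mul_assoc, hT, ih]; ring
  have key : ∀ k : ℕ, X t ^ (k + 1) ∣ f := by
    intro k
    induction k with
    | zero => simpa using hdvd
    | succ k ih =>
      obtain ⟨g, hg⟩ := ih
      rw [hg, hpow, Derivation.leibniz, Derivation.leibniz_pow, pderiv_X_self] at hf
      simp only [smul_eq_mul, mul_one, Nat.add_sub_cancel, nsmul_eq_mul] at hf
      have hne : (X t ^ k : Poly F n) ≠ 0 := pow_ne_zero _ (X_ne_zero t)
      have h1 : X t * (T g - X s * pderiv t g) = X s * (((k + 1 : ℕ) : Poly F n) * g) := by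
        refine mul_left_cancel₀ hne ?_
        linear_combination hf
      have h2 : (X t : Poly F n) ∣ X s * (((k + 1 : ℕ) : Poly F n) * g) := ⟨_, h1.symm⟩
      have hp : Prime (X t : Poly F n) := X_prime
      have h3 : (X t : Poly F n) ∣ g := by
        rcases hp.dvd_or_dvd h2 with h | h
        · rw [X_dvd_X] at h
          exact absurd (by tauto) hst
        · rcases hp.dvd_or_dvd h with h | h
          · exfalso
            have hu : IsUnit (((k + 1 : ℕ) : Poly F n)) := by
              have : ((k + 1 : ℕ) : Poly F n) = C ((k + 1 : ℕ) : F) := by simp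
              rw [this]
              exact (IsUnit.mk0 _ (Nat.cast_ne_zero.mpr (Nat.succ_ne_zero k))).map C
            exact hp.not_isUnit (isUnit_of_dvd_unit h hu)
          · exact h
      rw [hg, pow_succ _ (k + 1)]
      exact mul_dvd_mul_left _ h3
  by_contra hne
  obtain ⟨N, hN⟩ := FiniteMultiplicity.of_not_isUnit
    (X_prime : Prime (X t : Poly F n)).not_isUnit hne
  exact hN (key N)

theorem eq_zero_of_vVar_dvd [CharZero F] (p : Fin n) {f : Poly F n} (hf : lap n₁ n₁ f = 0)
    (hdvd : vVar F n₁ p ∣ f) : f = 0 := by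
  refine eq_zero_of_X_dvd (fun g => lap n₁ n₁ g + X (uIdx n₁ p) * pderiv (vIdx n₁ p) g)
    (uIdx_ne_vIdx (p := p) (q := p)) (fun h => ?_) (by rw [hf, zero_add]) hdvd
  have h1 : lap n₁ n₁ (X (vIdx n₁ p) * h) =
      X (vIdx n₁ p) * lap n₁ n₁ h + h * lap n₁ n₁ (vVar F n₁ p) := lap_mul (vVar F n₁ p) h
  rw [h1, lap_vVar, Derivation.leibniz, pderiv_X_self]
  simp only [smul_eq_mul, uVar]
  ring

end Vanishing

/-! ### Multiplicities for `n₁ = n₂` -/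

section Multiplicities

variable {F : Type*} [Field F] {n n₁ : ℕ}

theorem uVar_ne_zero (p : Fin n) : uVar F n₁ p ≠ 0 := X_ne_zero _

/-- The point at which the four coordinates `u_p`, `v_q`, `u_r`, `v_s` are `1` and all others
`0`. -/
def testPoint (F : Type*) [Field F] (n₁ : ℕ) (p q r s : Fin n) (t : Fin n ⊕ Fin n) : F :=
  if t = uIdx n₁ p ∨ t = vIdx n₁ q ∨ t = uIdx n₁ r ∨ t = vIdx n₁ s then 1 else 0

theorem eval_testPoint_uVar (p q r s a : Fin n) :
    eval (testPoint F n₁ p q r s) (uVar F n₁ a) = if a = p ∨ a = r then 1 else 0 := by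
  simp [uVar, testPoint]

theorem eval_testPoint_vVar (p q r s a : Fin n) :
    eval (testPoint F n₁ p q r s) (vVar F n₁ a) = if a = q ∨ a = s then 1 else 0 := by
  simp [vVar, testPoint]

theorem pairDet_ne_zero {p q : Fin n} (h : p ≠ q) : pairDet F n₁ p q ≠ 0 := by
  intro h0
  have := congrArg (eval (testPoint F n₁ p q p q)) h0
  simp [pairDet, eval_testPoint_uVar, eval_testPoint_vVar, h, h.symm] at this

variable {h12 : n₁ ≤ n₁} {ℓ₁ ℓ₂ : ℤ}

/-- Harmonic vectors `f * g` and `f * h` of the same weight; the point `φ` shows that `h` is not a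
multiple of `g`. -/
theorem not_isCompletelyPointed_of_mul {ℓ ℓ' : ℤ × ℤ} {w w' : Fin n → ℤ} {f g h : Poly F n}
    (hf : IsHarmonicVector n₁ n₁ ℓ w f) (hg : IsHarmonicVector n₁ n₁ ℓ' w' g)
    (hh : IsHarmonicVector n₁ n₁ ℓ' w' h) (hℓ : ℓ + ℓ' = (ℓ₁, ℓ₂)) (hf0 : f ≠ 0) (hg0 : g ≠ 0)
    (φ : Fin n ⊕ Fin n → F) (hφg : eval φ g = 0) (hφh : eval φ h ≠ 0) :
    ¬ IsCompletelyPointed F n (harmonic F n h12 ℓ₁ ℓ₂) := by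
  have h1 := hf.mul hg
  have h2 := hf.mul hh
  rw [hℓ] at h1 h2
  refine h1.not_isCompletelyPointed h2 (mul_ne_zero hf0 hg0) fun c hc => ?_
  rw [← mul_smul_comm] at hc
  have h3 := congrArg (eval φ) (mul_left_cancel₀ hf0 hc)
  rw [smul_eval, hφg, mul_zero] at h3
  exact hφh h3.symm

/-- With two indices on either side of `n₁`, the products `η_ac η_bd` and `η_ad η_bc` of
determinants `η = pairDet` have the same weight, and a common factor adjusts the degree. -/
theorem not_isCompletelyPointed_of_two_two (h2 : 2 ≤ n₁) (hn : n₁ + 2 ≤ n) (hℓ : ℓ₁ + ℓ₂ ≤ 0) :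
    ¬ IsCompletelyPointed F n (harmonic F n h12 ℓ₁ ℓ₂) := by
  let a : Fin n := ⟨0, by omega⟩
  let b : Fin n := ⟨1, by omega⟩
  let c : Fin n := ⟨n₁, by omega⟩
  let d : Fin n := ⟨n₁ + 1, by omega⟩
  have ha : a.val < n₁ := by simp only [a]; omega
  have hb : b.val < n₁ := by simp only [b]; omega
  have hc : ¬ c.val < n₁ := by simp only [c]; omega
  have hd : ¬ d.val < n₁ := by simp only [d]; omega
  have hab : a ≠ b := by intro h; have := congrArg Fin.val h; simp [a, b] at this
  have hcd : c ≠ d := by intro h; have := congrArg Fin.val h; simp [c, d] at this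
  have hac : a ≠ c := fun h => hc (h ▸ ha)
  have had : a ≠ d := fun h => hd (h ▸ ha)
  have hbc : b ≠ c := fun h => hc (h ▸ hb)
  have hbd : b ≠ d := fun h => hd (h ▸ hb)
  have hh := (isHarmonicVector_pairDet (F := F) (n₁ := n₁) a d).mul
    (isHarmonicVector_pairDet (F := F) (n₁ := n₁) b c)
  rw [show ∀ x y z t : Fin n → ℤ, x + y + (z + t) = (x + t) + (z + y) by intros; abel,
    show ∀ x y z t e : ℤ × ℤ, x + y + e + (z + t + e) = (x + t + e) + (z + y + e) by
      intros; abel] at hh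
  refine not_isCompletelyPointed_of_mul
    ((((isHarmonicVector_pairDet (F := F) (n₁ := n₁) c d).pow ℓ₁.toNat).mul
      ((isHarmonicVector_pairDet (F := F) (n₁ := n₁) a b).pow ℓ₂.toNat)).mul
      (((isHarmonicVector_uVar (F := F) (n₁ := n₁) a).pow ((-ℓ₁).toNat - ℓ₂.toNat)).mul
        ((isHarmonicVector_uVar (F := F) (n₁ := n₁) c).pow ((-ℓ₂).toNat - ℓ₁.toNat))))
    ((isHarmonicVector_pairDet (F := F) (n₁ := n₁) a c).mul
      (isHarmonicVector_pairDet (F := F) (n₁ := n₁) b d)) hh ?_ ?_ ?_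
    (testPoint F n₁ a d c b) ?_ ?_
  · simp only [degVar_uIdx, ha, hb, hc, hd, if_true, if_false]
    ext <;> simp <;> omega
  · exact mul_ne_zero (mul_ne_zero (pow_ne_zero _ (pairDet_ne_zero hcd))
      (pow_ne_zero _ (pairDet_ne_zero hab)))
      (mul_ne_zero (pow_ne_zero _ (uVar_ne_zero _)) (pow_ne_zero _ (uVar_ne_zero _)))
  · exact mul_ne_zero (pairDet_ne_zero hac) (pairDet_ne_zero hbd)
  · simp [pairDet, eval_testPoint_uVar, eval_testPoint_vVar, *, Ne.symm]
  · simp [pairDet, eval_testPoint_uVar, eval_testPoint_vVar, *, Ne.symm]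

/-- The indices other than `p₀` lie on the other side of `n₁` than `p₀`. -/
def IsSolo (n₁ : ℕ) (p₀ : Fin n) : Prop := ∀ q, q ≠ p₀ → (q.val < n₁ ↔ ¬ p₀.val < n₁)

/-- Interchanges the two degrees if the solo index `p₀` lies above `n₁`. -/
def soloDeg (n₁ : ℕ) (p₀ : Fin n) (ℓ : ℤ × ℤ) : ℤ × ℤ := if p₀.val < n₁ then ℓ else ℓ.swap

theorem soloDeg_soloDeg (p₀ : Fin n) (ℓ : ℤ × ℤ) : soloDeg n₁ p₀ (soloDeg n₁ p₀ ℓ) = ℓ := by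
  unfold soloDeg; split_ifs <;> simp

theorem soloDeg_add (p₀ : Fin n) (ℓ ℓ' : ℤ × ℤ) :
    soloDeg n₁ p₀ (ℓ + ℓ') = soloDeg n₁ p₀ ℓ + soloDeg n₁ p₀ ℓ' := by
  unfold soloDeg; split_ifs <;> simp

theorem degVar_uIdx_self (p₀ : Fin n) : degVar n n₁ n₁ (uIdx n₁ p₀) = soloDeg n₁ p₀ (-1, 0) := by
  rw [degVar_uIdx, soloDeg]; split_ifs <;> rfl

theorem IsSolo.degVar_uIdx {p₀ q : Fin n} (h : IsSolo n₁ p₀) (hq : q ≠ p₀) :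
    degVar n n₁ n₁ (uIdx n₁ q) = soloDeg n₁ p₀ (0, -1) := by
  have := h q hq
  rw [OscRep.degVar_uIdx, soloDeg]
  by_cases c : p₀.val < n₁
  · rw [if_neg (by tauto), if_pos c]
  · rw [if_pos (by tauto), if_neg c]; rfl

theorem soloDeg_one_one (p₀ : Fin n) : soloDeg n₁ p₀ (1, 1) = (1, 1) := by
  unfold soloDeg; split_ifs <;> rfl

/-- The degree of a monomial in terms of the exponents of the variables `u`, `v`. -/
theorem IsSolo.soloDeg_weight {p₀ : Fin n} (h : IsSolo n₁ p₀) (μ : Fin n ⊕ Fin n →₀ ℕ) :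
    soloDeg n₁ p₀ (Finsupp.weight (degVar n n₁ n₁) μ) =
      (∑ q ∈ Finset.univ.erase p₀, (μ (vIdx n₁ q) : ℤ) - μ (uIdx n₁ p₀),
        (μ (vIdx n₁ p₀) : ℤ) - ∑ q ∈ Finset.univ.erase p₀, (μ (uIdx n₁ q) : ℤ)) := by
  rw [weight_degVar, ← Finset.add_sum_erase _ _ (Finset.mem_univ p₀),
    ← Finset.add_sum_erase _ (fun i => sgn n₁ i * (μ (.inr i) : ℤ)) (Finset.mem_univ p₀)]
  have e1 : ∑ q ∈ Finset.univ.erase p₀, sgn n₁ q * (μ (.inl q) : ℤ) =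
      if p₀.val < n₁ then ∑ q ∈ Finset.univ.erase p₀, (μ (vIdx n₁ q) : ℤ)
      else -∑ q ∈ Finset.univ.erase p₀, (μ (uIdx n₁ q) : ℤ) := by
    split_ifs with c
    · refine Finset.sum_congr rfl fun q hq => ?_
      have := h q (Finset.ne_of_mem_erase hq)
      have hq' : ¬ q.val < n₁ := by tauto
      simp [sgn, vIdx, hq']
    · rw [← Finset.sum_neg_distrib]
      refine Finset.sum_congr rfl fun q hq => ?_
      have := h q (Finset.ne_of_mem_erase hq)
      have hq' : q.val < n₁ := by tauto
      simp [sgn, uIdx, hq']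
  have e2 : ∑ q ∈ Finset.univ.erase p₀, sgn n₁ q * (μ (.inr q) : ℤ) =
      if p₀.val < n₁ then ∑ q ∈ Finset.univ.erase p₀, (μ (uIdx n₁ q) : ℤ)
      else -∑ q ∈ Finset.univ.erase p₀, (μ (vIdx n₁ q) : ℤ) := by
    split_ifs with c
    · refine Finset.sum_congr rfl fun q hq => ?_
      have := h q (Finset.ne_of_mem_erase hq)
      have hq' : ¬ q.val < n₁ := by tauto
      simp [sgn, uIdx, hq']
    · rw [← Finset.sum_neg_distrib]
      refine Finset.sum_congr rfl fun q hq => ?_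
      have := h q (Finset.ne_of_mem_erase hq)
      have hq' : q.val < n₁ := by tauto
      simp [sgn, vIdx, hq']
  rw [e1, e2]
  unfold soloDeg uIdx vIdx sgn
  by_cases c : p₀.val < n₁
  · simp only [if_pos c]
    ext <;> simp <;> ring
  · simp only [if_neg c]
    ext <;> simp <;> ring

/-- If the second solo degree is positive, every polynomial is divisible by `v_{p₀}`, so none is
harmonic. -/
theorem IsSolo.eq_zero_of_pos [CharZero F] {p₀ : Fin n} (h : IsSolo n₁ p₀) {ℓ : ℤ × ℤ}
    (hℓ : 0 < (soloDeg n₁ p₀ ℓ).2) {f : Poly F n}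
    (hf : IsWeightedHomogeneous (degVar n n₁ n₁) f ℓ) (hlap : lap n₁ n₁ f = 0) : f = 0 := by
  refine eq_zero_of_vVar_dvd p₀ hlap (X_dvd_of_forall_support fun μ hμ h0 => ?_)
  have h1 := h.soloDeg_weight μ
  rw [hf (mem_support_iff.mp hμ)] at h1
  have h2 := congrArg Prod.snd h1
  simp only [h0] at h2
  have : (0 : ℤ) ≤ ∑ q ∈ Finset.univ.erase p₀, (μ (uIdx n₁ q) : ℤ) :=
    Finset.sum_nonneg fun _ _ => by positivity
  push_cast at h2
  omega

/-- The products of `u_s` with `pairDet p₀ r` and of `u_r` with `pairDet p₀ s` have the same weight,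
and a common factor adjusts the degree. -/
theorem IsSolo.not_isCompletelyPointed_of_three {p₀ r s : Fin n} (h : IsSolo n₁ p₀)
    (hr : r ≠ p₀) (hs : s ≠ p₀) (hrs : r ≠ s) {k₁ k₂ : ℤ} (hk : soloDeg n₁ p₀ (k₁, k₂) = (ℓ₁, ℓ₂))
    (hk2 : k₂ ≤ -1) (hk12 : k₁ + k₂ ≤ -1) :
    ¬ IsCompletelyPointed F n (harmonic F n h12 ℓ₁ ℓ₂) := by
  have hh := (isHarmonicVector_uVar (F := F) (n₁ := n₁) r).mul
    (isHarmonicVector_pairDet (F := F) (n₁ := n₁) p₀ s)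
  rw [show ∀ x y z : Fin n → ℤ, x + (y + z) = z + (y + x) by intros; abel,
    show ∀ x y z e : ℤ × ℤ, x + (y + z + e) = z + (y + x + e) by intros; abel] at hh
  refine not_isCompletelyPointed_of_mul
    ((((isHarmonicVector_pairDet (F := F) (n₁ := n₁) r s).pow k₁.toNat).mul
      ((isHarmonicVector_uVar (F := F) (n₁ := n₁) p₀).pow (-k₁).toNat)).mul
      ((isHarmonicVector_uVar (F := F) (n₁ := n₁) r).pow (-k₂ - 1 - k₁.toNat).toNat))
    ((isHarmonicVector_uVar (F := F) (n₁ := n₁) s).mul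
      (isHarmonicVector_pairDet (F := F) (n₁ := n₁) p₀ r)) hh ?_ ?_ ?_
    (testPoint F n₁ p₀ s r s) ?_ ?_
  · simp only [h.degVar_uIdx hr, h.degVar_uIdx hs, degVar_uIdx_self, ← hk]
    unfold soloDeg
    split_ifs <;> ext <;> simp <;> omega
  · exact mul_ne_zero (mul_ne_zero (pow_ne_zero _ (pairDet_ne_zero hrs))
      (pow_ne_zero _ (uVar_ne_zero _))) (pow_ne_zero _ (uVar_ne_zero _))
  · exact mul_ne_zero (uVar_ne_zero _) (pairDet_ne_zero hr.symm)
  · simp [eval_testPoint_uVar, hs, hrs.symm]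
  · simp [pairDet, eval_testPoint_uVar, eval_testPoint_vVar, hs, hrs.symm]

/-- The products of `pairDet r s` with `pairDet p₀ t` and of `pairDet r t` with `pairDet p₀ s` have
the same weight, and a power of `pairDet r s` adjusts the degree. -/
theorem IsSolo.not_isCompletelyPointed_of_four {p₀ r s t : Fin n} (h : IsSolo n₁ p₀)
    (hr : r ≠ p₀) (hs : s ≠ p₀) (ht : t ≠ p₀) (hrs : r ≠ s) (hrt : r ≠ t) (hst : s ≠ t) {k : ℤ}
    (hk : soloDeg n₁ p₀ (k, -k) = (ℓ₁, ℓ₂)) (hk1 : 1 ≤ k) :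
    ¬ IsCompletelyPointed F n (harmonic F n h12 ℓ₁ ℓ₂) := by
  have hh := (isHarmonicVector_pairDet (F := F) (n₁ := n₁) r t).mul
    (isHarmonicVector_pairDet (F := F) (n₁ := n₁) p₀ s)
  rw [show ∀ x y z t : Fin n → ℤ, x + y + (z + t) = (x + t) + (z + y) by intros; abel,
    show ∀ x y z t e : ℤ × ℤ, x + y + e + (z + t + e) = (x + t + e) + (z + y + e) by
      intros; abel] at hh
  refine not_isCompletelyPointed_of_mul
    ((isHarmonicVector_pairDet (F := F) (n₁ := n₁) r s).pow (k - 1).toNat)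
    ((isHarmonicVector_pairDet (F := F) (n₁ := n₁) r s).mul
      (isHarmonicVector_pairDet (F := F) (n₁ := n₁) p₀ t)) hh ?_ ?_ ?_
    (testPoint F n₁ r t s p₀) ?_ ?_
  · simp only [h.degVar_uIdx hr, h.degVar_uIdx hs, h.degVar_uIdx ht, degVar_uIdx_self, ← hk]
    unfold soloDeg
    split_ifs <;> ext <;> simp <;> omega
  · exact pow_ne_zero _ (pairDet_ne_zero hrs)
  · exact mul_ne_zero (pairDet_ne_zero hrs) (pairDet_ne_zero ht.symm)
  · simp [pairDet, eval_testPoint_uVar, eval_testPoint_vVar, *, Ne.symm]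
  · simp [pairDet, eval_testPoint_uVar, eval_testPoint_vVar, *, Ne.symm]

/-- For `n₁ = n₂ = n` the graded pieces are finite-dimensional. -/
theorem not_isCompletelyPointed_of_eq (hn : n₁ = n) :
    ¬ IsCompletelyPointed F n (harmonic F n h12 ℓ₁ ℓ₂) := by
  intro h
  apply h.1
  have hle : ∀ x : harmonic F n h12 ℓ₁ ℓ₂,
      (show Poly F n from x.1) ∈ restrictTotalDegree (Fin n ⊕ Fin n) F (ℓ₂ - ℓ₁).toNat := by
    intro x
    rw [mem_restrictTotalDegree]
    refine Finset.sup_le fun μ hμ => ?_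
    have hdeg := x.2.1 (mem_support_iff.mp hμ)
    rw [weight_degVar, Prod.mk.injEq] at hdeg
    have hs : ∀ i : Fin n, sgn n₁ i = -1 := fun i => if_pos (hn ▸ i.2)
    simp only [hs, neg_mul, one_mul, Finset.sum_neg_distrib, neg_neg] at hdeg
    rw [Finsupp.sum_fintype _ _ (by simp), Fintype.sum_sum_type]
    zify
    have := hdeg.1
    have := hdeg.2
    omega
  let T : harmonic F n h12 ℓ₁ ℓ₂ →ₗ[F] restrictTotalDegree (Fin n ⊕ Fin n) F (ℓ₂ - ℓ₁).toNat :=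
    { toFun := fun x => ⟨x.1, hle x⟩
      map_add' := fun x y => rfl
      map_smul' := fun c x => rfl }
  refine Module.Finite.of_injective T fun x y hxy => Subtype.ext ?_
  exact (congrArg Subtype.val hxy : (T x).1 = (T y).1)

end Multiplicities

/-! ### Modules generated by a scalar vector for a solo index -/

section SoloAction

variable {F : Type*} [Field F] {n n₁ : ℕ}

variable (F n₁) in
/-- The operators `E_{i,j}`, or `-E_{j,i}` if the solo index `p₀` lies above `n₁`.  They satisfy the
relations of matrix units in both cases, and are given by the same formulas in the variables
`u`, `v`. -/
def soloAct (p₀ i j : Fin n) : Poly F n →ₗ[F] Poly F n :=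
  if p₀.val < n₁ then act n₁ n₁ i j else -act n₁ n₁ j i

theorem act_comm_apply {n₂ : ℕ} (i j k l : Fin n) (f : Poly F n) :
    act n₁ n₂ i j (act n₁ n₂ k l f) = act n₁ n₂ k l (act n₁ n₂ i j f) +
      ((if j = k then act n₁ n₂ i l f else 0) - (if l = i then act n₁ n₂ k j f else 0)) := by
  have h := congrArg (fun T : Module.End F (Osc F n n₁ n₂) => T f)
    (opE_comm (F := F) (n₁ := n₁) (n₂ := n₂) i j k l)
  have h' : act n₁ n₂ i j (act n₁ n₂ k l f) - act n₁ n₂ k l (act n₁ n₂ i j f) =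
      (if j = k then act n₁ n₂ i l f else 0) - (if l = i then act n₁ n₂ k j f else 0) := by
    refine Eq.trans h ?_
    by_cases h1 : j = k <;> by_cases h2 : l = i <;> simp only [h1, h2, if_true, if_false] <;> rfl
  rw [← h']; ring

theorem soloAct_comm (p₀ i j k l : Fin n) (f : Poly F n) :
    soloAct F n₁ p₀ i j (soloAct F n₁ p₀ k l f) = soloAct F n₁ p₀ k l (soloAct F n₁ p₀ i j f) +
      ((if j = k then soloAct F n₁ p₀ i l f else 0) -
        (if l = i then soloAct F n₁ p₀ k j f else 0)) := by
  unfold soloAct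
  by_cases c : p₀.val < n₁
  · simp only [if_pos c]
    exact act_comm_apply i j k l f
  · simp only [if_neg c, LinearMap.neg_apply, map_neg, neg_neg]
    rw [act_comm_apply j i l k, if_congr (eq_comm (a := i)) rfl rfl,
      if_congr (eq_comm (a := k)) rfl rfl]
    split_ifs <;> ring

theorem pderiv_comm {s t : Fin n ⊕ Fin n} (f : Poly F n) :
    pderiv s (pderiv t f) = pderiv t (pderiv s f) :=
  congrArg (fun T : Module.End F (Osc F n 0 0) => T f) (dVar_comm (n₁ := 0) (n₂ := 0) s t)

variable {p₀ : Fin n}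

theorem IsSolo.soloAct_lower (h : IsSolo n₁ p₀) {q : Fin n} (hq : q ≠ p₀) (f : Poly F n) :
    soloAct F n₁ p₀ q p₀ f = -(pairDet F n₁ p₀ q * f) := by
  have := h q hq
  unfold soloAct pairDet uVar vVar uIdx vIdx
  by_cases c : p₀.val < n₁
  · have hq' : ¬ q.val < n₁ := by tauto
    simp only [act_apply, c, hq', if_true, if_false]; ring
  · have hq' : q.val < n₁ := by tauto
    simp only [LinearMap.neg_apply, act_apply, c, hq', if_true, if_false]; ring

theorem IsSolo.soloAct_raise (h : IsSolo n₁ p₀) {q : Fin n} (hq : q ≠ p₀) (f : Poly F n) :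
    soloAct F n₁ p₀ p₀ q f = pderiv (uIdx n₁ p₀) (pderiv (vIdx n₁ q) f) -
      pderiv (uIdx n₁ q) (pderiv (vIdx n₁ p₀) f) := by
  have := h q hq
  unfold soloAct uIdx vIdx
  by_cases c : p₀.val < n₁
  · have hq' : ¬ q.val < n₁ := by tauto
    simp only [act_apply, c, hq', if_true, if_false]
  · have hq' : q.val < n₁ := by tauto
    simp only [LinearMap.neg_apply, act_apply, c, hq', if_true, if_false]; ring

theorem IsSolo.soloAct_rest (h : IsSolo n₁ p₀) {r s : Fin n} (hr : r ≠ p₀) (hs : s ≠ p₀)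
    (hrs : r ≠ s) (f : Poly F n) :
    soloAct F n₁ p₀ r s f = uVar F n₁ r * pderiv (uIdx n₁ s) f +
      vVar F n₁ r * pderiv (vIdx n₁ s) f := by
  have h1 := h r hr
  have h2 := h s hs
  unfold soloAct uVar vVar uIdx vIdx
  by_cases c : p₀.val < n₁
  · have hr' : ¬ r.val < n₁ := by tauto
    have hs' : ¬ s.val < n₁ := by tauto
    simp only [act_apply, c, hr', hs', if_true, if_false, hrs]; ring
  · have hr' : r.val < n₁ := by tauto
    have hs' : s.val < n₁ := by tauto
    simp only [LinearMap.neg_apply, act_apply, c, hr', hs', if_true, if_false, hrs.symm]; ring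

theorem wtShift_self (i : Fin n) : wtShift n₁ n₁ i = sgn n₁ i := by
  unfold wtShift sgn; split_ifs <;> rfl

theorem sgn_mul_self (k : ℕ) (i : Fin n) : sgn k i * sgn k i = 1 := by
  unfold sgn; split_ifs <;> rfl

theorem soloAct_self {d : Fin n → ℤ} {f : Poly F n} (i : Fin n)
    (hf : IsWeightedHomogeneous (wtVar n₁ n₁) f fun i => sgn n₁ i * d i) :
    soloAct F n₁ p₀ i i f = ((-(sgn n₁ p₀ * sgn n₁ i) * (d i + 1) : ℤ) : F) • f := by
  unfold soloAct
  split_ifs with c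
  · rw [act_self hf, wtShift_self, show sgn n₁ p₀ = -1 from if_pos c]
    congr 2; ring
  · rw [LinearMap.neg_apply, act_self hf, wtShift_self, show sgn n₁ p₀ = 1 from if_neg c,
      ← neg_smul]
    congr 1; push_cast; ring

theorem IsSolo.sgn_mul (h : IsSolo n₁ p₀) {q : Fin n} (hq : q ≠ p₀) :
    sgn n₁ p₀ * sgn n₁ q = -1 := by
  have := h q hq
  unfold sgn; split_ifs <;> first | rfl | tauto

variable (n₁ p₀) in
/-- The linear map `Q ↦ v · Q(η)` with `η_q = u_{p₀} v_q - u_q v_{p₀}`. -/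
def soloMap (v : Poly F n) : MvPolynomial {q : Fin n // q ≠ p₀} F →ₗ[F] Poly F n :=
  LinearMap.mulLeft F v ∘ₗ (aeval fun q : {q : Fin n // q ≠ p₀} => pairDet F n₁ p₀ q.1).toLinearMap

theorem soloMap_apply (v : Poly F n) (Q : MvPolynomial {q : Fin n // q ≠ p₀} F) :
    soloMap n₁ p₀ v Q = v * aeval (fun q : {q : Fin n // q ≠ p₀} => pairDet F n₁ p₀ q.1) Q := rfl

theorem IsSolo.soloMap_mul_X (h : IsSolo n₁ p₀) (v : Poly F n)
    (Q : MvPolynomial {q : Fin n // q ≠ p₀} F) (t : {q : Fin n // q ≠ p₀}) :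
    soloMap n₁ p₀ v (Q * X t) = -soloAct F n₁ p₀ t.1 p₀ (soloMap n₁ p₀ v Q) := by
  rw [h.soloAct_lower t.2, soloMap_apply, soloMap_apply, map_mul, aeval_X]; ring

/-- The Euler operator. -/
def euler {I : Type*} [Fintype I] (Q : MvPolynomial I F) : MvPolynomial I F :=
  ∑ r, X r * pderiv r Q

theorem euler_monomial {I : Type*} [Fintype I] (γ : I →₀ ℕ) (c : F) :
    euler (monomial γ c) = ((∑ r, γ r : ℕ) : F) • monomial γ c := by
  unfold euler
  simp only [X_mul_pderiv_monomial, Nat.cast_sum, Finset.sum_smul, Nat.cast_smul_eq_nsmul]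

theorem euler_mul_X {I : Type*} [Fintype I] (Q : MvPolynomial I F) (t : I) :
    euler (Q * X t) = euler Q * X t + Q * X t := by
  classical
  unfold euler
  simp only [Derivation.leibniz, pderiv_X, smul_eq_mul, mul_add, Finset.sum_add_distrib,
    Pi.single_apply, mul_ite, mul_one, mul_zero, Finset.sum_ite_eq,
    Finset.mem_univ, if_true, Finset.sum_mul]
  rw [add_comm]
  congr 1
  · exact Finset.sum_congr rfl fun r _ => by ring
  · ring

/-- A vector that spans a one-dimensional module of the stabilizer of the solo index and is killed
by the raising operators; `e` is the common degree of `v` at the other indices. -/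
structure IsScalarVector (n₁ : ℕ) (p₀ : Fin n) (d : Fin n → ℤ) (e : ℤ) (v : Poly F n) : Prop where
  wt : IsWeightedHomogeneous (wtVar n₁ n₁) v fun i => sgn n₁ i * d i
  deg_rest : ∀ q, q ≠ p₀ → d q = e
  raise : ∀ q, q ≠ p₀ → soloAct F n₁ p₀ p₀ q v = 0
  rest : ∀ r s, r ≠ p₀ → s ≠ p₀ → r ≠ s → soloAct F n₁ p₀ r s v = 0

variable {d : Fin n → ℤ} {e : ℤ} {v : Poly F n}

/-- On the vectors `v · Q(η)`, the operators with indices other than `p₀` act on `Q` like the matrix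
units `X_r ∂_s`, up to a scalar for `r = s`. -/
theorem IsScalarVector.soloAct_rest_soloMap (h : IsSolo n₁ p₀) (hv : IsScalarVector n₁ p₀ d e v)
    (r s : {q : Fin n // q ≠ p₀}) (Q : MvPolynomial {q : Fin n // q ≠ p₀} F) :
    soloAct F n₁ p₀ r.1 s.1 (soloMap n₁ p₀ v Q) =
      soloMap n₁ p₀ v (X r * pderiv s Q + if r = s then C ((e + 1 : ℤ) : F) * Q else 0) := by
  classical
  induction Q using MvPolynomial.induction_on with
  | C a =>
    rw [pderiv_C, mul_zero, zero_add, ← mul_one (C a), ← MvPolynomial.smul_eq_C_mul, map_smul,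
      map_smul]
    have e1 : soloMap n₁ p₀ v 1 = v := by rw [soloMap_apply, map_one, mul_one]
    rw [e1]
    by_cases hrs : r = s
    · subst hrs
      rw [if_pos rfl, soloAct_self _ hv.wt, h.sgn_mul r.2, hv.deg_rest _ r.2,
        ← MvPolynomial.smul_eq_C_mul, map_smul, map_smul, e1, smul_comm]
      simp
    · rw [if_neg hrs, hv.rest _ _ r.2 s.2 (fun e => hrs (Subtype.ext e)), map_zero, smul_zero]
  | add p q hp hq =>
    rw [map_add, map_add, hp, hq, ← map_add]
    congr 1
    split_ifs <;> rw [map_add] <;> ring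
  | mul_X p t hp =>
    rw [h.soloMap_mul_X, map_neg, soloAct_comm, hp,
      if_neg (show ¬ p₀ = r.1 from fun e => r.2 e.symm), sub_zero]
    rw [neg_add, ← h.soloMap_mul_X]
    by_cases hst : s = t
    · subst hst
      rw [if_pos rfl, ← h.soloMap_mul_X, ← map_add]
      congr 1
      rw [Derivation.leibniz, pderiv_X_self]
      simp only [smul_eq_mul]
      split_ifs <;> ring
    · rw [if_neg (fun e => hst (Subtype.ext e)), neg_zero, add_zero]
      congr 1
      rw [Derivation.leibniz, pderiv_X, Pi.single_apply, if_neg (Ne.symm hst)]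
      simp only [smul_eq_mul]
      split_ifs <;> ring

theorem IsScalarVector.soloAct_self_soloMap (h : IsSolo n₁ p₀) (hv : IsScalarVector n₁ p₀ d e v)
    (Q : MvPolynomial {q : Fin n // q ≠ p₀} F) :
    soloAct F n₁ p₀ p₀ p₀ (soloMap n₁ p₀ v Q) =
      soloMap n₁ p₀ v (C ((-(d p₀ + 1) : ℤ) : F) * Q - euler Q) := by
  induction Q using MvPolynomial.induction_on with
  | C a =>
    have e0 : euler (C a : MvPolynomial {q : Fin n // q ≠ p₀} F) = 0 := by simp [euler]
    rw [e0, sub_zero, ← mul_one (C a), ← MvPolynomial.smul_eq_C_mul, map_smul, map_smul]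
    have e1 : soloMap n₁ p₀ v 1 = v := by rw [soloMap_apply, map_one, mul_one]
    rw [e1, soloAct_self _ hv.wt, sgn_mul_self, ← MvPolynomial.smul_eq_C_mul, map_smul, map_smul,
      e1, smul_comm]
    simp
  | add p q hp hq =>
    rw [map_add, map_add, hp, hq, ← map_add]
    congr 1
    unfold euler
    simp only [map_add, mul_add, Finset.sum_add_distrib]; ring
  | mul_X p t hp =>
    rw [h.soloMap_mul_X, map_neg, soloAct_comm, hp,
      if_neg (show ¬ p₀ = t.1 from fun e => t.2 e.symm), if_pos rfl, zero_sub, neg_add,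
      ← h.soloMap_mul_X, neg_neg]
    rw [show soloAct F n₁ p₀ t.1 p₀ (soloMap n₁ p₀ v p) = -soloMap n₁ p₀ v (p * X t) by
      rw [h.soloMap_mul_X, neg_neg], ← sub_eq_add_neg, ← map_sub]
    congr 1
    rw [euler_mul_X]; ring

/-- The raising operators act on the vectors `v · Q(η)` by `Q ↦ (e + d p₀ + 2 + E) ∂_s Q`, where `E`
is the Euler operator. -/
theorem IsScalarVector.soloAct_raise_soloMap (h : IsSolo n₁ p₀) (hv : IsScalarVector n₁ p₀ d e v)
    (s : {q : Fin n // q ≠ p₀}) (Q : MvPolynomial {q : Fin n // q ≠ p₀} F) :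
    soloAct F n₁ p₀ p₀ s.1 (soloMap n₁ p₀ v Q) =
      soloMap n₁ p₀ v (C ((e + d p₀ + 2 : ℤ) : F) * pderiv s Q + euler (pderiv s Q)) := by
  classical
  induction Q using MvPolynomial.induction_on with
  | C a =>
    have e0 : euler (0 : MvPolynomial {q : Fin n // q ≠ p₀} F) = 0 := by simp [euler]
    rw [pderiv_C, e0, mul_zero, add_zero, map_zero, ← mul_one (C a),
      ← MvPolynomial.smul_eq_C_mul, map_smul, map_smul]
    have e1 : soloMap n₁ p₀ v 1 = v := by rw [soloMap_apply, map_one, mul_one]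
    rw [e1, hv.raise _ s.2, smul_zero]
  | add p q hp hq =>
    rw [map_add, map_add, hp, hq, ← map_add]
    congr 1
    unfold euler
    simp only [map_add, mul_add, Finset.sum_add_distrib]; ring
  | mul_X p t hp =>
    rw [h.soloMap_mul_X, map_neg, soloAct_comm, hp, if_pos rfl, hv.soloAct_rest_soloMap h,
      neg_add, ← h.soloMap_mul_X]
    by_cases hst : s = t
    · subst hst
      rw [if_pos rfl, if_pos rfl, hv.soloAct_self_soloMap h, neg_sub, ← map_sub, ← map_add]
      congr 1
      rw [Derivation.leibniz, pderiv_X_self, smul_eq_mul, smul_eq_mul, mul_one,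
        mul_comm (X s) (pderiv s p)]
      have := euler_mul_X (pderiv s p) s
      have hadd : euler (p + pderiv s p * X s) = euler p + euler (pderiv s p * X s) := by
        unfold euler; simp only [map_add, mul_add, Finset.sum_add_distrib]
      rw [hadd, this]
      push_cast
      simp only [map_add, map_neg, map_one, map_ofNat]
      ring
    · rw [if_neg (fun e => hst (Subtype.ext e)), if_neg (Ne.symm hst), zero_sub, neg_neg, add_zero,
        ← map_add]
      congr 1
      rw [Derivation.leibniz, pderiv_X, Pi.single_apply, if_neg (Ne.symm hst), smul_eq_mul,
        smul_eq_mul, mul_zero, zero_add, mul_comm (X t) (pderiv s p), euler_mul_X]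
      ring

end SoloAction

/-! ### Irreducibility of the modules generated by a scalar vector -/

section SoloModule

variable {F : Type*} [Field F] {n n₁ : ℕ} {p₀ : Fin n} {d : Fin n → ℤ} {e : ℤ} {v : Poly F n}

theorem soloMap_one : soloMap n₁ p₀ v 1 = v := by rw [soloMap_apply, map_one, mul_one]

theorem soloMap_monomial (γ : {q : Fin n // q ≠ p₀} →₀ ℕ) (c : F) :
    soloMap n₁ p₀ v (monomial γ c) = v * (C c * ∏ q, pairDet F n₁ p₀ q.1 ^ γ q) := by
  rw [soloMap_apply, aeval_monomial, Finsupp.prod_fintype _ _ (by simp), algebraMap_eq]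

theorem IsHarmonicVector.prod {ι : Type*} (s : Finset ι) {ℓ : ι → ℤ × ℤ} {w : ι → Fin n → ℤ}
    {f : ι → Poly F n} (hf : ∀ i ∈ s, IsHarmonicVector n₁ n₁ (ℓ i) (w i) (f i)) :
    IsHarmonicVector n₁ n₁ (∑ i ∈ s, ℓ i) (∑ i ∈ s, w i) (∏ i ∈ s, f i) := by
  classical
  induction s using Finset.induction_on with
  | empty => simpa using isHarmonicVector_one
  | insert a s ha ih =>
    rw [Finset.sum_insert ha, Finset.sum_insert ha, Finset.prod_insert ha]
    exact (hf a (Finset.mem_insert_self _ _)).mul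
      (ih fun i hi => hf i (Finset.mem_insert_of_mem hi))

variable (n₁ p₀) in
/-- The `wtVar`-degree of `∏ η_q ^ γ_q`. -/
def soloWt (γ : {q : Fin n // q ≠ p₀} →₀ ℕ) : Fin n → ℤ :=
  ∑ q, γ q • (Pi.single p₀ (sgn n₁ p₀) + Pi.single q.1 (sgn n₁ q.1))

theorem soloWt_apply (γ : {q : Fin n // q ≠ p₀} →₀ ℕ) (q : {q : Fin n // q ≠ p₀}) :
    soloWt n₁ p₀ γ q.1 = γ q * sgn n₁ q.1 := by
  unfold soloWt
  rw [Finset.sum_apply, Finset.sum_eq_single q]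
  · simp [q.2]
  · intro r _ hr
    have : q.1 ≠ r.1 := fun e => hr (Subtype.ext e.symm)
    simp [q.2, this]
  · simp

theorem soloWt_injective : Function.Injective (soloWt (n := n) n₁ p₀) := by
  intro γ γ' h
  ext q
  have h1 := congrFun h q.1
  rw [soloWt_apply, soloWt_apply] at h1
  exact_mod_cast mul_right_cancel₀ (sgn_ne_zero _ _) h1

theorem IsSolo.isHarmonicVector_pairDet (h : IsSolo n₁ p₀) {q : Fin n} (hq : q ≠ p₀) :
    IsHarmonicVector n₁ n₁ 0 (Pi.single p₀ (sgn n₁ p₀) + Pi.single q (sgn n₁ q))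
      (pairDet F n₁ p₀ q) := by
  have := OscRep.isHarmonicVector_pairDet (F := F) (n₁ := n₁) p₀ q
  rwa [h.degVar_uIdx hq, degVar_uIdx_self, ← soloDeg_add, ← soloDeg_one_one (n₁ := n₁) p₀,
    ← soloDeg_add, show ((-1, 0) + (0, -1) + (1, 1) : ℤ × ℤ) = 0 by rfl,
    show soloDeg n₁ p₀ 0 = 0 by unfold soloDeg; split_ifs <;> rfl] at this

theorem IsSolo.isHarmonicVector_soloMap (h : IsSolo n₁ p₀) {ℓ : ℤ × ℤ} {w : Fin n → ℤ}
    (hv : IsHarmonicVector n₁ n₁ ℓ w v) (γ : {q : Fin n // q ≠ p₀} →₀ ℕ) :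
    IsHarmonicVector n₁ n₁ ℓ (w + soloWt n₁ p₀ γ) (soloMap n₁ p₀ v (monomial γ 1)) := by
  rw [soloMap_monomial, C_1, one_mul]
  have h1 := IsHarmonicVector.prod (F := F) Finset.univ fun (q : {q : Fin n // q ≠ p₀}) _ =>
    (h.isHarmonicVector_pairDet (F := F) q.2).pow (γ q)
  have h2 := hv.mul h1
  simp only [smul_zero, Finset.sum_const_zero, add_zero] at h2
  exact h2

theorem soloMap_isWeightedHomogeneous (h : IsSolo n₁ p₀) {ℓ : ℤ × ℤ} {w : Fin n → ℤ}
    (hv : IsHarmonicVector n₁ n₁ ℓ w v) (Q : MvPolynomial {q : Fin n // q ≠ p₀} F) :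
    IsWeightedHomogeneous (degVar n n₁ n₁) (soloMap n₁ p₀ v Q) ℓ ∧
      lap n₁ n₁ (soloMap n₁ p₀ v Q) = 0 := by
  have hm : ∀ γ c, soloMap n₁ p₀ v (monomial γ c) = c • soloMap n₁ p₀ v (monomial γ 1) := by
    intro γ c; rw [← map_smul, smul_monomial, smul_eq_mul, mul_one]
  induction Q using MvPolynomial.induction_on' with
  | monomial γ c =>
    have := h.isHarmonicVector_soloMap hv γ
    rw [hm]
    exact ⟨Submodule.smul_mem (weightedHomogeneousSubmodule F _ _) c this.deg,
      by rw [map_smul, this.lap_eq, smul_zero]⟩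
  | add p q hp hq =>
    rw [map_add, map_add, hp.2, hq.2, add_zero]
    exact ⟨hp.1.add hq.1, rfl⟩

theorem soloMap_monomial_ne_zero (hv : v ≠ 0) (γ : {q : Fin n // q ≠ p₀} →₀ ℕ) :
    soloMap n₁ p₀ v (monomial γ 1) ≠ 0 := by
  rw [soloMap_monomial, C_1, one_mul]
  exact mul_ne_zero hv (Finset.prod_ne_zero_iff.mpr fun q _ =>
    pow_ne_zero _ (pairDet_ne_zero q.2.symm))

theorem soloAct_mem {S : Submodule F (Poly F n)}
    (hS : ∀ i j, i ≠ j → ∀ f ∈ S, act n₁ n₁ i j f ∈ S) {i j : Fin n} (hij : i ≠ j) {f : Poly F n}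
    (hf : f ∈ S) : soloAct F n₁ p₀ i j f ∈ S := by
  unfold soloAct
  split_ifs
  · exact hS i j hij f hf
  · exact S.neg_mem (hS j i hij.symm f hf)

theorem IsSolo.soloMap_mem (h : IsSolo n₁ p₀) {S : Submodule F (Poly F n)}
    (hS : ∀ i j, i ≠ j → ∀ f ∈ S, act n₁ n₁ i j f ∈ S) (hv : v ∈ S)
    (Q : MvPolynomial {q : Fin n // q ≠ p₀} F) : soloMap n₁ p₀ v Q ∈ S := by
  induction Q using MvPolynomial.induction_on with
  | C a =>
    rw [← mul_one (C a), ← MvPolynomial.smul_eq_C_mul, map_smul, soloMap_one]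
    exact S.smul_mem _ hv
  | add p q hp hq => rw [map_add]; exact S.add_mem hp hq
  | mul_X p t hp =>
    rw [h.soloMap_mul_X]
    exact S.neg_mem (soloAct_mem hS t.2 hp)

/-- The raising operators lead from `v · η^γ` down to `v`, because their coefficients
`e + d p₀ + 2 + N` do not vanish. -/
theorem IsScalarVector.mem_of_soloMap_mem [CharZero F] (h : IsSolo n₁ p₀)
    (hv : IsScalarVector n₁ p₀ d e v) (hpos : 0 < e + d p₀ + 2) {S : Submodule F (Poly F n)}
    (hS : ∀ i j, i ≠ j → ∀ f ∈ S, act n₁ n₁ i j f ∈ S) (N : ℕ) :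
    ∀ γ : {q : Fin n // q ≠ p₀} →₀ ℕ, ∑ q, γ q = N →
      soloMap n₁ p₀ v (monomial γ 1) ∈ S → v ∈ S := by
  induction N with
  | zero =>
    intro γ hγ hm
    have : γ = 0 := by
      ext q
      exact Finset.sum_eq_zero_iff.mp hγ q (Finset.mem_univ _)
    rwa [this, monomial_zero', C_1, soloMap_one] at hm
  | succ N ih =>
    intro γ hγ hm
    obtain ⟨s, hs⟩ : ∃ s, γ s ≠ 0 := by
      by_contra! h0
      simp [h0] at hγ
    have hle : Finsupp.single s 1 ≤ γ := Finsupp.single_le_iff.mpr (Nat.one_le_iff_ne_zero.mpr hs)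
    have hsum : ∑ q, (γ - Finsupp.single s 1 : {q : Fin n // q ≠ p₀} →₀ ℕ) q = N := by
      have h1 : ∑ q, γ q = ∑ q, (γ - Finsupp.single s 1 : {q : Fin n // q ≠ p₀} →₀ ℕ) q + 1 := by
        conv_lhs => rw [← tsub_add_cancel_of_le hle]
        simp only [Finsupp.add_apply, Finset.sum_add_distrib]
        congr 1
        classical
        simp [Finsupp.single_apply]
      omega
    refine ih (γ - Finsupp.single s 1) hsum ?_
    have h2 := soloAct_mem (p₀ := p₀) hS s.2.symm hm
    rw [hv.soloAct_raise_soloMap h, pderiv_monomial, euler_monomial, hsum, one_mul,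
      ← MvPolynomial.smul_eq_C_mul, ← add_smul, map_smul,
      show (monomial (γ - Finsupp.single s 1) ((γ s : ℕ) : F) :
        MvPolynomial {q : Fin n // q ≠ p₀} F) = (γ s : F) • monomial (γ - Finsupp.single s 1) 1 by
          rw [smul_monomial, smul_eq_mul, mul_one], map_smul] at h2
    have hne : ((e + d p₀ + 2 : ℤ) : F) + (N : F) ≠ 0 := by
      have : ((e + d p₀ + 2 + N : ℤ) : F) ≠ 0 := Int.cast_ne_zero.mpr (by omega)
      exact_mod_cast this
    rwa [S.smul_mem_iff hne, S.smul_mem_iff (Nat.cast_ne_zero.mpr hs)] at h2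

variable {h12 : n₁ ≤ n₁} {ℓ₁ ℓ₂ : ℤ}

/-- A module that is generated by a scalar vector as a module over the polynomials in the `η_q` is
irreducible, because the raising operators act on it by differential operators with nonvanishing
coefficients. -/
theorem IsScalarVector.isIrreducible_and_isCompletelyPointed [CharZero F]
    [Nonempty {q : Fin n // q ≠ p₀}] (h : IsSolo n₁ p₀) (hv : IsScalarVector n₁ p₀ d e v)
    (hpos : 0 < e + d p₀ + 2)
    (hh : IsHarmonicVector n₁ n₁ (ℓ₁, ℓ₂) (fun i => sgn n₁ i * d i) v) (h0 : v ≠ 0)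
    (hs : ∀ f : Poly F n, IsWeightedHomogeneous (degVar n n₁ n₁) f (ℓ₁, ℓ₂) → lap n₁ n₁ f = 0 →
      ∃ Q, soloMap n₁ p₀ v Q = f) :
    LieModule.IsIrreducible F (SLn F n) (harmonic F n h12 ℓ₁ ℓ₂) ∧
      IsCompletelyPointed F n (harmonic F n h12 ℓ₁ ℓ₂) := by
  have : Infinite ({q : Fin n // q ≠ p₀} →₀ ℕ) := Finsupp.infinite_of_right
  refine OscRep.isIrreducible_and_isCompletelyPointed
    (fun γ : {q : Fin n // q ≠ p₀} →₀ ℕ => soloMap n₁ p₀ v (monomial γ 1)) _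
    (fun γ γ' hγ => soloWt_injective (n₁ := n₁) (add_left_cancel hγ))
    (fun γ => h.isHarmonicVector_soloMap hh γ)
    (fun γ => soloMap_monomial_ne_zero h0 γ) (fun f hf hlap => ?_) (fun S hS γ γ' hγ => ?_)
  · obtain ⟨Q, rfl⟩ := hs f hf hlap
    rw [Q.as_sum, map_sum]
    refine Submodule.sum_mem _ fun γ _ => ?_
    rw [show monomial γ (coeff γ Q) = coeff γ Q • monomial γ 1 by
      rw [smul_monomial, smul_eq_mul, mul_one], map_smul]
    exact Submodule.smul_mem _ _ (Submodule.subset_span ⟨γ, rfl⟩)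
  · exact h.soloMap_mem hS (hv.mem_of_soloMap_mem h hpos hS _ γ rfl hγ) _

end SoloModule

/-! ### Powers of the variables `u` as scalar vectors -/

section SoloFamilies

variable {F : Type*} [Field F] {n n₁ : ℕ} {p₀ : Fin n}

variable (n₁) in
theorem monomial_eq_prod_pairs (μ : Fin n ⊕ Fin n →₀ ℕ) (c : F) :
    monomial μ c = C c *
      ∏ p, (uVar F n₁ p ^ μ (uIdx n₁ p) * vVar F n₁ p ^ μ (vIdx n₁ p)) := by
  rw [monomial_eq, Finsupp.prod_fintype _ _ (by simp), Fintype.prod_sum_type,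
    ← Finset.prod_mul_distrib]
  congr 1
  refine Finset.prod_congr rfl fun p _ => ?_
  unfold uVar vVar uIdx vIdx; split_ifs
  · rfl
  · rw [mul_comm]

theorem monomial_eq_solo (p₀ : Fin n) (μ : Fin n ⊕ Fin n →₀ ℕ) (c : F) :
    monomial μ c = C c * (uVar F n₁ p₀ ^ μ (uIdx n₁ p₀) * vVar F n₁ p₀ ^ μ (vIdx n₁ p₀)) *
      ((∏ q : {q : Fin n // q ≠ p₀}, uVar F n₁ q.1 ^ μ (uIdx n₁ q.1)) *
        ∏ q : {q : Fin n // q ≠ p₀}, vVar F n₁ q.1 ^ μ (vIdx n₁ q.1)) := by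
  rw [monomial_eq_prod_pairs n₁, ← Finset.mul_prod_erase _ _ (Finset.mem_univ p₀),
    Finset.prod_subtype (Finset.univ.erase p₀) (p := fun q => q ≠ p₀) (by simp),
    Finset.prod_mul_distrib]
  ring

theorem sum_erase_eq_subtype {A : Type*} [AddCommMonoid A] (φ : Fin n → A) :
    ∑ q ∈ Finset.univ.erase p₀, φ q = ∑ q : {q : Fin n // q ≠ p₀}, φ q.1 :=
  Finset.sum_subtype (Finset.univ.erase p₀) (p := fun q => q ≠ p₀) (by simp) φ

/-- Modulo `v_{p₀}` the vectors `u_{p₀} ^ m · W · Q(η)` yield all monomials of their degree, and no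
nonzero harmonic polynomial is divisible by `v_{p₀}`.  The hypothesis `hW` on the monomials of
degree `m₂` in the other `u_q` holds if `m₂ = 0` or if there is only one such `q`. -/
theorem IsSolo.exists_soloMap_eq_of_u [CharZero F] (h : IsSolo n₁ p₀) {m m₂ : ℕ} {W : Poly F n}
    {w : Fin n → ℤ}
    (hW : ∀ α : {q : Fin n // q ≠ p₀} → ℕ, ∑ q, α q = m₂ → ∏ q, uVar F n₁ q.1 ^ α q = W)
    (hv : IsHarmonicVector n₁ n₁ (soloDeg n₁ p₀ (-m, -m₂)) w (uVar F n₁ p₀ ^ m * W))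
    {f : Poly F n} (hf : IsWeightedHomogeneous (degVar n n₁ n₁) f (soloDeg n₁ p₀ (-m, -m₂)))
    (hlap : lap n₁ n₁ f = 0) : ∃ Q, soloMap n₁ p₀ (uVar F n₁ p₀ ^ m * W) Q = f := by
  classical
  let γ : (Fin n ⊕ Fin n →₀ ℕ) → {q : Fin n // q ≠ p₀} →₀ ℕ := fun μ =>
    Finsupp.equivFunOnFinite.symm fun q => μ (vIdx n₁ q.1)
  let Q : MvPolynomial {q : Fin n // q ≠ p₀} F :=
    ∑ μ ∈ f.support, if μ (vIdx n₁ p₀) = 0 then monomial (γ μ) (coeff μ f) else 0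
  have key : Ideal.Quotient.mk (Ideal.span {vVar F n₁ p₀}) (soloMap n₁ p₀ (uVar F n₁ p₀ ^ m * W) Q)
      = Ideal.Quotient.mk (Ideal.span {vVar F n₁ p₀}) f := by
    have hv0 : Ideal.Quotient.mk (Ideal.span {vVar F n₁ p₀}) (vVar F n₁ p₀) = 0 :=
      Ideal.Quotient.eq_zero_iff_mem.mpr (Ideal.mem_span_singleton_self _)
    conv_rhs => rw [f.as_sum, map_sum]
    rw [map_sum, map_sum]
    refine Finset.sum_congr rfl fun μ hμ => ?_
    have hdeg := h.soloDeg_weight μ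
    rw [hf (mem_support_iff.mp hμ), soloDeg_soloDeg, Prod.mk.injEq, sum_erase_eq_subtype,
      sum_erase_eq_subtype] at hdeg
    split_ifs with h0
    · have hu : μ (uIdx n₁ p₀) = m + ∑ q, γ μ q := by
        have h1 := hdeg.1
        have : ∑ q : {q : Fin n // q ≠ p₀}, (μ (vIdx n₁ q.1) : ℤ) = ((∑ q, γ μ q : ℕ) : ℤ) := by
          push_cast; rfl
        omega
      have hu2 : ∑ q : {q : Fin n // q ≠ p₀}, μ (uIdx n₁ q.1) = m₂ := by
        have h1 := hdeg.2
        rw [h0] at h1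
        zify; push_cast at h1 ⊢
        omega
      rw [soloMap_monomial, monomial_eq_solo (n₁ := n₁) p₀, h0,
        hW (fun q => μ (uIdx n₁ q.1)) hu2, hu, pow_add, ← Finset.prod_pow_eq_pow_sum]
      simp only [map_mul, map_prod, map_pow, pairDet, map_sub, hv0, mul_zero, sub_zero, pow_zero,
        mul_one, mul_pow, Finset.prod_mul_distrib]
      change _ * (_ * (_ * ∏ q : {q : Fin n // q ≠ p₀}, _ ^ μ (vIdx n₁ q.1))) = _
      ring
    · rw [map_zero, map_zero, monomial_eq_solo (n₁ := n₁) p₀]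
      simp only [map_mul, map_pow, hv0, zero_pow h0]
      ring
  refine ⟨Q, sub_eq_zero.mp (eq_zero_of_vVar_dvd p₀ ?_
    (Ideal.mem_span_singleton.mp (Ideal.Quotient.eq.mp key)))⟩
  rw [map_sub, hlap, (soloMap_isWeightedHomogeneous h hv Q).2, sub_zero]

theorem pderiv_uVar (s : Fin n ⊕ Fin n) (p : Fin n) :
    pderiv s (uVar F n₁ p) = if s = uIdx n₁ p then 1 else 0 := by
  classical
  rw [uVar, pderiv_X, Pi.single_apply]
  exact if_congr eq_comm rfl rfl

theorem pderiv_vVar (s : Fin n ⊕ Fin n) (p : Fin n) :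
    pderiv s (vVar F n₁ p) = if s = vIdx n₁ p then 1 else 0 := by
  classical
  rw [vVar, pderiv_X, Pi.single_apply]
  exact if_congr eq_comm rfl rfl

theorem pderiv_vIdx_uVar_mul (p q r : Fin n) (a b : ℕ) :
    pderiv (vIdx n₁ r) (uVar F n₁ p ^ a * uVar F n₁ q ^ b) = 0 := by
  rw [Derivation.leibniz, Derivation.leibniz_pow, Derivation.leibniz_pow, pderiv_uVar, pderiv_uVar,
    if_neg vIdx_ne_uIdx, if_neg vIdx_ne_uIdx]
  simp

theorem IsSolo.isHarmonicVector_u (h : IsSolo n₁ p₀) {q : Fin n} (hq : q ≠ p₀) {m m₂ : ℕ} :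
    IsHarmonicVector n₁ n₁ (soloDeg n₁ p₀ (-m, -m₂))
      (fun i => sgn n₁ i * ((if i = p₀ then m else 0) + if i = q then m₂ else 0))
      (uVar F n₁ p₀ ^ m * uVar F n₁ q ^ m₂) := by
  convert ((isHarmonicVector_uVar (F := F) (n₁ := n₁) p₀).pow m).mul
    ((isHarmonicVector_uVar (F := F) (n₁ := n₁) q).pow m₂) using 1
  · rw [h.degVar_uIdx hq, degVar_uIdx_self]
    unfold soloDeg; split_ifs <;> ext <;> simp
  · ext i
    simp only [Pi.add_apply, Pi.smul_apply, Pi.single_apply]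
    by_cases h1 : i = p₀ <;> by_cases h2 : i = q <;> simp [h1, h2, mul_comm]
    all_goals simp_all
    try ring

theorem IsSolo.isScalarVector_u (h : IsSolo n₁ p₀) {q : Fin n} (hq : q ≠ p₀) {m m₂ : ℕ}
    (hm : m₂ = 0 ∨ ∀ r, r ≠ p₀ → r = q) :
    IsScalarVector n₁ p₀ (fun i => (if i = p₀ then m else 0) + if i = q then m₂ else 0) m₂
      (uVar F n₁ p₀ ^ m * uVar F n₁ q ^ m₂) := by
  refine ⟨(h.isHarmonicVector_u (F := F) hq).wt, fun r hr => ?_, fun r hr => ?_,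
    fun r s hr hs hrs => ?_⟩
  · rcases hm with rfl | hm
    · simp [hr]
    · simp [hm r hr, hq]
  · rw [h.soloAct_raise hr, pderiv_vIdx_uVar_mul, pderiv_vIdx_uVar_mul, map_zero, map_zero,
      sub_zero]
  · rcases hm with rfl | hm
    · rw [h.soloAct_rest hr hs hrs, pderiv_vIdx_uVar_mul, pow_zero, mul_one, Derivation.leibniz_pow,
        pderiv_uVar, if_neg (by rw [uIdx_inj]; exact hs)]
      simp
    · exact absurd ((hm r hr).trans (hm s hs).symm) hrs

variable {h12 : n₁ ≤ n₁} {ℓ₁ ℓ₂ : ℤ}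

/-- The modules generated by `u_{p₀} ^ m u_q ^ m₂`, where `m₂ = 0` unless `n = 2`. -/
theorem IsSolo.isIrreducible_and_isCompletelyPointed_u [CharZero F] (h : IsSolo n₁ p₀) {q : Fin n}
    (hq : q ≠ p₀) {m m₂ : ℕ} (hm : m₂ = 0 ∨ ∀ r, r ≠ p₀ → r = q)
    (hℓ : soloDeg n₁ p₀ (-m, -m₂) = (ℓ₁, ℓ₂)) :
    LieModule.IsIrreducible F (SLn F n) (harmonic F n h12 ℓ₁ ℓ₂) ∧
      IsCompletelyPointed F n (harmonic F n h12 ℓ₁ ℓ₂) := by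
  have : Nonempty {q : Fin n // q ≠ p₀} := ⟨⟨q, hq⟩⟩
  have hh := h.isHarmonicVector_u (F := F) hq (m := m) (m₂ := m₂)
  have hW : ∀ α : {q : Fin n // q ≠ p₀} → ℕ, ∑ q, α q = m₂ →
      ∏ r, uVar F n₁ r.1 ^ α r = uVar F n₁ q ^ m₂ := by
    intro α hα
    rcases hm with rfl | hm
    · rw [pow_zero]
      exact Finset.prod_eq_one fun r hr => by rw [Finset.sum_eq_zero_iff.mp hα r hr, pow_zero]
    · rw [← hα, ← Finset.prod_pow_eq_pow_sum]
      exact Finset.prod_congr rfl fun r _ => by rw [hm r.1 r.2]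
  have hspan := fun (f : Poly F n) hf hlap =>
    h.exists_soloMap_eq_of_u (F := F) hW hh (f := f) hf hlap
  rw [hℓ] at hh hspan
  refine (h.isScalarVector_u hq hm).isIrreducible_and_isCompletelyPointed h ?_ hh
    (mul_ne_zero (pow_ne_zero _ (uVar_ne_zero _)) (pow_ne_zero _ (uVar_ne_zero _))) hspan
  simp only [if_true, if_neg hq.symm]
  push_cast
  positivity

end SoloFamilies

/-! ### Powers of a determinant as scalar vectors, for `n = 3` -/

section SoloTriples

variable {F : Type*} [Field F] {n n₁ : ℕ} {p₀ : Fin n}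

theorem coeff_lap (f : Poly F n) (ν : Fin n ⊕ Fin n →₀ ℕ) :
    coeff ν (lap n₁ n₁ f) = -∑ p, if ν (uIdx n₁ p) = 0 then 0 else
      coeff (ν - Finsupp.single (uIdx n₁ p) 1 + Finsupp.single (vIdx n₁ p) 1) f *
        (ν (vIdx n₁ p) + 1) := by
  classical
  rw [lap_eq_sum, coeff_neg, coeff_sum]
  congr 1
  refine Finset.sum_congr rfl fun p _ => ?_
  rw [uVar, coeff_X_mul', coeff_pderiv]
  simp only [Finsupp.mem_support_iff, ne_eq, ite_not]
  congr 3
  simp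

/-- The coefficient recursion expressing that `f` is harmonic, from the coefficient in `lap f` of
the monomial that has `u_a` in place of a factor `v_a` of `μ`.  The index `p₀` does not contribute,
as `u_{p₀}` does not divide `μ`. -/
theorem coeff_eq_zero_of_lap_eq_zero [CharZero F] {a b : Fin n} (ha : a ≠ p₀) (hb : b ≠ p₀)
    (hab : a ≠ b) (hall : ∀ q, q = p₀ ∨ q = a ∨ q = b) {f : Poly F n} (hf : lap n₁ n₁ f = 0)
    {μ : Fin n ⊕ Fin n →₀ ℕ} (h0 : μ (uIdx n₁ p₀) = 0) (hμ : μ (vIdx n₁ a) ≠ 0)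
    (hstep : μ (uIdx n₁ b) ≠ 0 → coeff (μ - Finsupp.single (vIdx n₁ a) 1 +
      Finsupp.single (uIdx n₁ a) 1 - Finsupp.single (uIdx n₁ b) 1 +
      Finsupp.single (vIdx n₁ b) 1) f = 0) : coeff μ f = 0 := by
  classical
  obtain ⟨ν, hν⟩ : ∃ ν, ν = μ - Finsupp.single (vIdx n₁ a) 1 + Finsupp.single (uIdx n₁ a) 1 :=
    ⟨_, rfl⟩
  have h := coeff_lap (n₁ := n₁) f ν
  have huniv : (Finset.univ : Finset (Fin n)) = {p₀, a, b} := by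
    ext q; simpa using hall q
  have hle : Finsupp.single (vIdx n₁ a) 1 ≤ μ :=
    Finsupp.single_le_iff.mpr (Nat.one_le_iff_ne_zero.mpr hμ)
  have hνμ : ν - Finsupp.single (uIdx n₁ a) 1 + Finsupp.single (vIdx n₁ a) 1 = μ := by
    rw [hν, add_tsub_cancel_right, tsub_add_cancel_of_le hle]
  rw [← hν] at hstep
  have e0 : ν (uIdx n₁ p₀) = 0 := by simp [hν, h0, ha]
  have e1 : ν (uIdx n₁ a) ≠ 0 := by simp [hν]
  have e2 : ν (uIdx n₁ b) = μ (uIdx n₁ b) := by simp [hν, hab]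
  rw [hf, coeff_zero, huniv, Finset.sum_insert (by simp [ha.symm, hb.symm]), Finset.sum_pair hab,
    hνμ, if_pos e0, if_neg e1, e2, zero_add] at h
  have h3 : coeff μ f * ((ν (vIdx n₁ a) : F) + 1) = 0 := by
    by_cases hb0 : μ (uIdx n₁ b) = 0
    · rw [if_pos hb0, add_zero] at h
      exact neg_eq_zero.mp h.symm
    · rw [if_neg hb0, hstep hb0, zero_mul, add_zero] at h
      exact neg_eq_zero.mp h.symm
  exact (mul_eq_zero.mp h3).resolve_right (Nat.cast_add_one_ne_zero _)

variable {r s : Fin n}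

/-- In the terms without `u_{p₀}` of a harmonic polynomial, the degree in `u_r`, `v_r` is at
least `k`. -/
theorem IsSolo.coeff_eq_zero_of_lt [CharZero F] (h : IsSolo n₁ p₀) (hr : r ≠ p₀) (hs : s ≠ p₀)
    (hrs : r ≠ s) (hall : ∀ q, q = p₀ ∨ q = r ∨ q = s) {k : ℕ} {f : Poly F n}
    (hf : IsWeightedHomogeneous (degVar n n₁ n₁) f (soloDeg n₁ p₀ (k, -k)))
    (hlap : lap n₁ n₁ f = 0) (j : ℕ) : ∀ μ : Fin n ⊕ Fin n →₀ ℕ, μ (uIdx n₁ r) = j →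
      μ (uIdx n₁ p₀) = 0 → μ (vIdx n₁ r) + μ (uIdx n₁ r) < k → coeff μ f = 0 := by
  classical
  have hv : ∀ μ : Fin n ⊕ Fin n →₀ ℕ, μ (uIdx n₁ p₀) = 0 → μ (vIdx n₁ r) < k → coeff μ f ≠ 0 →
      μ (vIdx n₁ s) ≠ 0 := by
    intro μ h0 hlt hne hs0
    have hdeg := h.soloDeg_weight μ
    have he : (Finset.univ : Finset (Fin n)).erase p₀ = {r, s} := by
      ext q
      have := hall q
      simp only [Finset.mem_erase, Finset.mem_univ, and_true, Finset.mem_insert,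
        Finset.mem_singleton]
      constructor
      · tauto
      · rintro (rfl | rfl) <;> assumption
    rw [hf hne, soloDeg_soloDeg, Prod.mk.injEq, he, Finset.sum_pair hrs, h0, hs0] at hdeg
    have := hdeg.1
    push_cast at this
    omega
  induction j with
  | zero =>
    intro μ hj h0 hlt
    by_contra hne
    exact hne (coeff_eq_zero_of_lap_eq_zero hs hr hrs.symm (fun q => by have := hall q; tauto) hlap
      h0 (hv μ h0 (by omega) hne) fun h1 => absurd hj h1)
  | succ j ih =>
    intro μ hj h0 hlt
    by_contra hne
    refine hne (coeff_eq_zero_of_lap_eq_zero hs hr hrs.symm (fun q => by have := hall q; tauto) hlap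
      h0 (hv μ h0 (by omega) hne) fun _ => ih _ ?_ ?_ ?_)
    · simp [hj, hrs.symm]
    · simp [h0, hs]
    · simp [hrs.symm]
      omega

/-- Modulo `u_{p₀}` and `v_r` the vectors `(u_r v_s - u_s v_r) ^ k · Q(η)` agree with the harmonic
polynomials of their degree.  A harmonic polynomial in the ideal of these two variables is divisible
by `u_{p₀}`, and the quotient is harmonic of positive total degree, hence zero. -/
theorem IsSolo.exists_soloMap_eq_of_pairDet [CharZero F] (h : IsSolo n₁ p₀) (hr : r ≠ p₀)
    (hs : s ≠ p₀) (hrs : r ≠ s) (hall : ∀ q, q = p₀ ∨ q = r ∨ q = s) {k : ℕ} {w : Fin n → ℤ}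
    (hv : IsHarmonicVector n₁ n₁ (soloDeg n₁ p₀ (k, -k)) w (pairDet F n₁ r s ^ k)) {f : Poly F n}
    (hf : IsWeightedHomogeneous (degVar n n₁ n₁) f (soloDeg n₁ p₀ (k, -k)))
    (hlap : lap n₁ n₁ f = 0) : ∃ Q, soloMap n₁ p₀ (pairDet F n₁ r s ^ k) Q = f := by
  classical
  have he : (Finset.univ : Finset (Fin n)).erase p₀ = {r, s} := by
    ext q
    have := hall q
    simp only [Finset.mem_erase, Finset.mem_univ, and_true, Finset.mem_insert,
      Finset.mem_singleton]
    constructor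
    · tauto
    · rintro (rfl | rfl) <;> assumption
  have hprod : ∀ φ : Fin n → Poly F n, ∏ q : {q : Fin n // q ≠ p₀}, φ q.1 = φ r * φ s := by
    intro φ
    rw [← Finset.prod_pair hrs, ← he]
    exact (Finset.prod_subtype (Finset.univ.erase p₀) (p := fun q => q ≠ p₀) (by simp) φ).symm
  let J : Ideal (Poly F n) := Ideal.span (X '' {uIdx n₁ p₀, vIdx n₁ r})
  let g : (Fin n ⊕ Fin n →₀ ℕ) → Fin n → ℕ := fun μ q =>
    if q = r then μ (uIdx n₁ r) - k else μ (uIdx n₁ s)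
  let γ : (Fin n ⊕ Fin n →₀ ℕ) → {q : Fin n // q ≠ p₀} →₀ ℕ := fun μ =>
    Finsupp.equivFunOnFinite.symm fun q => g μ q.1
  let Q : MvPolynomial {q : Fin n // q ≠ p₀} F :=
    ∑ μ ∈ f.support, if μ (uIdx n₁ p₀) = 0 ∧ μ (vIdx n₁ r) = 0 then
      monomial (γ μ) ((-1) ^ (μ (uIdx n₁ r) - k) * (-1) ^ μ (uIdx n₁ s) * coeff μ f) else 0
  have key : Ideal.Quotient.mk J (soloMap n₁ p₀ (pairDet F n₁ r s ^ k) Q) =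
      Ideal.Quotient.mk J f := by
    have hu0 : Ideal.Quotient.mk J (uVar F n₁ p₀) = 0 :=
      Ideal.Quotient.eq_zero_iff_mem.mpr (Ideal.subset_span ⟨_, by simp, rfl⟩)
    have hvr : Ideal.Quotient.mk J (vVar F n₁ r) = 0 :=
      Ideal.Quotient.eq_zero_iff_mem.mpr (Ideal.subset_span ⟨_, by simp, rfl⟩)
    conv_rhs => rw [f.as_sum, map_sum]
    rw [map_sum, map_sum]
    refine Finset.sum_congr rfl fun μ hμ => ?_
    have hdeg := h.soloDeg_weight μ
    rw [hf (mem_support_iff.mp hμ), soloDeg_soloDeg, Prod.mk.injEq, he, Finset.sum_pair hrs,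
      Finset.sum_pair hrs] at hdeg
    split_ifs with h0
    · have hk : k ≤ μ (uIdx n₁ r) := by
        by_contra hlt
        exact mem_support_iff.mp hμ
          (h.coeff_eq_zero_of_lt hr hs hrs hall hf hlap _ μ rfl h0.1 (by omega))
      obtain ⟨a, ha⟩ := Nat.exists_eq_add_of_le hk
      have h1 := hdeg.1
      have h2 := hdeg.2
      have hvs : μ (vIdx n₁ s) = k := by rw [h0.1, h0.2] at h1; push_cast at h1; omega
      have hv0 : μ (vIdx n₁ p₀) = a + μ (uIdx n₁ s) := by rw [ha] at h2; push_cast at h2; omega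
      rw [soloMap_monomial, monomial_eq_solo (n₁ := n₁) p₀,
        hprod fun q => uVar F n₁ q ^ μ (uIdx n₁ q), hprod fun q => vVar F n₁ q ^ μ (vIdx n₁ q)]
      have hγ : ∏ q : {q : Fin n // q ≠ p₀}, pairDet F n₁ p₀ q.1 ^ γ μ q =
          pairDet F n₁ p₀ r ^ a * pairDet F n₁ p₀ s ^ μ (uIdx n₁ s) := by
        refine (hprod fun q => pairDet F n₁ p₀ q ^ g μ q).trans ?_
        simp [g, ha, hrs.symm]
      rw [hγ, h0.1, h0.2, hvs, hv0, ha, Nat.add_sub_cancel_left]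
      simp only [map_mul, map_pow, pairDet, map_sub, hu0, hvr, mul_zero, zero_mul, sub_zero,
        zero_sub, map_neg, map_one, pow_zero]
      rw [neg_pow (Ideal.Quotient.mk J (uVar F n₁ r) * _),
        neg_pow (Ideal.Quotient.mk J (uVar F n₁ s) * _)]
      rcases neg_one_pow_eq_or (Poly F n ⧸ J) a with h3 | h3 <;>
      rcases neg_one_pow_eq_or (Poly F n ⧸ J) (μ (uIdx n₁ s)) with h4 | h4 <;>
      rw [h3, h4] <;> ring
    · rw [map_zero, map_zero, monomial_eq_solo (n₁ := n₁) p₀,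
        hprod fun q => vVar F n₁ q ^ μ (vIdx n₁ q)]
      by_cases h1 : μ (uIdx n₁ p₀) = 0
      · simp only [map_mul, map_pow, hvr, zero_pow (fun h2 => h0 ⟨h1, h2⟩)]
        ring
      · simp only [map_mul, map_pow, hu0, zero_pow h1]
        ring
  refine ⟨Q, sub_eq_zero.mp ?_⟩
  have hsm := soloMap_isWeightedHomogeneous h hv Q
  have hmem : soloMap n₁ p₀ (pairDet F n₁ r s ^ k) Q - f ∈ J := Ideal.Quotient.eq.mp key
  have hglap : lap n₁ n₁ (soloMap n₁ p₀ (pairDet F n₁ r s ^ k) Q - f) = 0 := by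
    rw [map_sub, hlap, hsm.2, sub_zero]
  have hgdeg := hsm.1.sub hf
  generalize soloMap n₁ p₀ (pairDet F n₁ r s ^ k) Q - f = G at hmem hglap hgdeg
  -- the exponent of `v_r` in the terms without `u_{p₀}` can be lowered to zero
  have hcoeff : ∀ (j : ℕ) (μ : Fin n ⊕ Fin n →₀ ℕ), μ (vIdx n₁ r) = j → μ (uIdx n₁ p₀) = 0 →
      coeff μ G = 0 := by
    intro j
    induction j with
    | zero =>
      intro μ hj h0
      by_contra hne
      obtain ⟨i, hi, hi'⟩ := mem_ideal_span_X_image.mp hmem μ (mem_support_iff.mpr hne)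
      rcases hi with rfl | rfl
      · exact hi' h0
      · exact hi' hj
    | succ j ih =>
      intro μ hj h0
      refine coeff_eq_zero_of_lap_eq_zero hr hs hrs hall hglap h0 (by omega) fun _ => ih _ ?_ ?_
      · simp [hj, hrs.symm]
      · simp [h0, hr]
  obtain ⟨H, rfl⟩ : X (uIdx n₁ p₀) ∣ G :=
    X_dvd_of_forall_support fun μ hμ h0 => mem_support_iff.mp hμ (hcoeff _ μ rfl h0)
  have hHlap : lap n₁ n₁ H = 0 := by
    have h1 : lap n₁ n₁ (uVar F n₁ p₀ * H) = 0 := hglap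
    rw [lap_mul, lap_uVar, mul_zero, add_zero] at h1
    exact (mul_eq_zero.mp h1).resolve_left (uVar_ne_zero _)
  have hHdeg : IsWeightedHomogeneous (degVar n n₁ n₁) H
      (soloDeg n₁ p₀ (k, -k) - degVar n n₁ n₁ (uIdx n₁ p₀)) := by
    intro μ hμ
    have h1 := @hgdeg (Finsupp.single (uIdx n₁ p₀) 1 + μ) (by rwa [coeff_X_mul])
    rw [map_add, Finsupp.weight_single, one_smul] at h1
    exact eq_sub_of_add_eq' h1
  rw [eq_zero_of_lap_eq_zero ?_ hHdeg hHlap, mul_zero]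
  rw [degVar_uIdx_self]
  unfold soloDeg
  split_ifs <;> simp

variable {h12 : n₁ ≤ n₁} {ℓ₁ ℓ₂ : ℤ}

theorem pderiv_pairDet (t : Fin n ⊕ Fin n) (p q : Fin n) :
    pderiv t (pairDet F n₁ p q) =
      (if t = vIdx n₁ q then uVar F n₁ p else 0) + (if t = uIdx n₁ p then vVar F n₁ q else 0) -
      ((if t = vIdx n₁ p then uVar F n₁ q else 0) + if t = uIdx n₁ q then vVar F n₁ p else 0) := by
  simp only [pairDet, map_sub, Derivation.leibniz, pderiv_uVar, pderiv_vVar, smul_eq_mul, mul_ite,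
    mul_one, mul_zero]

theorem IsSolo.isHarmonicVector_pairDet_pow (h : IsSolo n₁ p₀) (hr : r ≠ p₀) (hs : s ≠ p₀)
    (hrs : r ≠ s) (hall : ∀ q, q = p₀ ∨ q = r ∨ q = s) (k : ℕ) :
    IsHarmonicVector n₁ n₁ (soloDeg n₁ p₀ (k, -k))
      (fun i => sgn n₁ i * if i = p₀ then 0 else (k : ℤ)) (pairDet F n₁ r s ^ k) := by
  convert (OscRep.isHarmonicVector_pairDet (F := F) (n₁ := n₁) r s).pow k using 1
  · rw [h.degVar_uIdx hr, h.degVar_uIdx hs]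
    unfold soloDeg; split_ifs <;> ext <;> simp
  · ext i
    simp only [Pi.add_apply, Pi.smul_apply, Pi.single_apply]
    rcases hall i with rfl | rfl | rfl
    · simp [hr.symm, hs.symm]
    · simp [hr, hrs, mul_comm]
    · simp [hs, hrs.symm, mul_comm]

theorem IsSolo.isScalarVector_pairDet_pow (h : IsSolo n₁ p₀) (hr : r ≠ p₀) (hs : s ≠ p₀)
    (hrs : r ≠ s) (hall : ∀ q, q = p₀ ∨ q = r ∨ q = s) (k : ℕ) :
    IsScalarVector n₁ p₀ (fun i => if i = p₀ then 0 else (k : ℤ)) k (pairDet F n₁ r s ^ k) := by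
  refine ⟨(h.isHarmonicVector_pairDet_pow (F := F) hr hs hrs hall k).wt, fun q hq => if_neg hq,
    fun q hq => ?_, fun a b ha hb hab => ?_⟩
  · have h1 : pderiv (uIdx n₁ p₀) (pairDet F n₁ r s ^ k) = 0 := by
      rw [Derivation.leibniz_pow, pderiv_pairDet]
      simp [hr.symm, hs.symm]
    have h2 : pderiv (vIdx n₁ p₀) (pairDet F n₁ r s ^ k) = 0 := by
      rw [Derivation.leibniz_pow, pderiv_pairDet]
      simp [hr.symm, hs.symm]
    rw [h.soloAct_raise hq, h2, pderiv_comm, h1, map_zero, map_zero, sub_zero]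
  · rw [h.soloAct_rest ha hb hab, Derivation.leibniz_pow, Derivation.leibniz_pow, pderiv_pairDet,
      pderiv_pairDet]
    rcases hall a with rfl | rfl | rfl
    · exact absurd rfl ha
    · rcases hall b with rfl | rfl | rfl
      · exact absurd rfl hb
      · exact absurd rfl hab
      · simp [hrs.symm]
        ring
    · rcases hall b with rfl | rfl | rfl
      · exact absurd rfl hb
      · simp [hrs]
        ring
      · exact absurd rfl hab

/-- For `n = 3` the module generated by `(u_r v_s - u_s v_r) ^ k`. -/
theorem IsSolo.isIrreducible_and_isCompletelyPointed_pairDet [CharZero F] (h : IsSolo n₁ p₀)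
    (hr : r ≠ p₀) (hs : s ≠ p₀) (hrs : r ≠ s) (hall : ∀ q, q = p₀ ∨ q = r ∨ q = s) {k : ℕ}
    (hℓ : soloDeg n₁ p₀ (k, -k) = (ℓ₁, ℓ₂)) :
    LieModule.IsIrreducible F (SLn F n) (harmonic F n h12 ℓ₁ ℓ₂) ∧
      IsCompletelyPointed F n (harmonic F n h12 ℓ₁ ℓ₂) := by
  have : Nonempty {q : Fin n // q ≠ p₀} := ⟨⟨r, hr⟩⟩
  have hh := h.isHarmonicVector_pairDet_pow (F := F) hr hs hrs hall k
  have hspan := fun (f : Poly F n) hf hlap =>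
    h.exists_soloMap_eq_of_pairDet (F := F) hr hs hrs hall hh (f := f) hf hlap
  rw [hℓ] at hh hspan
  refine (h.isScalarVector_pairDet_pow hr hs hrs hall k).isIrreducible_and_isCompletelyPointed h
    ?_ hh (pow_ne_zero _ (pairDet_ne_zero hrs)) hspan
  simp only [if_true]
  positivity

end SoloTriples

/-! ### The case `n = n₂ = 2`, `n₁ = 1` -/

section RankOne

variable {F : Type*} [Field F]

/-- The monomial `x₁^a y₁^b x₂^c y₂^d`. -/
def quadMon (F : Type*) [Field F] (a b c d : ℕ) : Poly F 2 :=
  X (.inl 0) ^ a * X (.inr 0) ^ b * X (.inl 1) ^ c * X (.inr 1) ^ d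

/-- The polynomial with residue `x₁^a x₂^N y₂^L` modulo `y₁` that is harmonic if `N ≤ a` or
`L ≤ a`.  In this case no exponent is truncated in a term with nonzero coefficient. -/
def stringVec (F : Type*) [Field F] (a N L : ℕ) : Poly F 2 :=
  ∑ t ∈ Finset.range (L + 1), ((N.choose t * L.descFactorial t : ℕ) : F) •
    quadMon F (a - t) t (N - t) (L - t)

theorem lap_one_two (f : Poly F 2) : lap 1 2 f =
    -(X (.inl 0) * pderiv (.inr 0) f) + pderiv (.inl 1) (pderiv (.inr 1) f) := by
  rw [lap_apply, Fin.sum_univ_two]; simp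

theorem act_zero_one (f : Poly F 2) : act 1 2 0 1 f =
    pderiv (.inl 0) (pderiv (.inl 1) f) - X (.inr 1) * pderiv (.inr 0) f := by
  rw [act_apply]; simp

theorem act_one_zero (f : Poly F 2) : act 1 2 1 0 f =
    -(X (.inl 1) * (X (.inl 0) * f)) - X (.inr 0) * pderiv (.inr 1) f := by
  rw [act_apply]; simp

/-- Harmonic polynomials are determined by their residues modulo `y₁`. -/
theorem eq_of_dvd_sub [CharZero F] {f g : Poly F 2} (hf : lap 1 2 f = 0) (hg : lap 1 2 g = 0)
    (h : X (.inr 0) ∣ f - g) : f = g := by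
  refine sub_eq_zero.mp (eq_zero_of_X_dvd (fun f => pderiv (.inl 1) (pderiv (.inr 1) f))
    (s := .inl 0) (t := .inr 0) (by simp) (fun q => ?_) ?_ h)
  · simp [Derivation.leibniz, pderiv_X]
  · have h1 : lap 1 2 (f - g) = 0 := by rw [map_sub, hf, hg, sub_zero]
    rw [lap_one_two, neg_add_eq_zero] at h1
    exact h1.symm

theorem stringVec_coeff_succ (N L t : ℕ) :
    (t + 1) * (N.choose (t + 1) * L.descFactorial (t + 1)) =
      (N - t) * (L - t) * (N.choose t * L.descFactorial t) := by
  have := Nat.choose_succ_right_eq N t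
  rw [Nat.descFactorial_succ]
  calc _ = (N.choose (t + 1) * (t + 1)) * ((L - t) * L.descFactorial t) := by ring
    _ = _ := by rw [this]; ring

/-- The sum of the images of the terms telescopes. -/
theorem lap_stringVec {a N L : ℕ} (h : N ≤ a ∨ L ≤ a) : lap 1 2 (stringVec F a N L) = 0 := by
  let A : ℕ → Poly F 2 := fun t => ((t * (N.choose t * L.descFactorial t) : ℕ) : F) •
    quadMon F (a + 1 - t) (t - 1) (N - t) (L - t)
  have key : ∀ t, lap 1 2 (((N.choose t * L.descFactorial t : ℕ) : F) •
      quadMon F (a - t) t (N - t) (L - t)) = A (t + 1) - A t := by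
    intro t
    by_cases h0 : N.choose t * L.descFactorial t = 0
    · simp only [A]
      rw [stringVec_coeff_succ, h0]; simp
    · have h1 : t ≤ N := by
        by_contra hlt
        exact h0 (by rw [Nat.choose_eq_zero_of_lt (by omega), zero_mul])
      have h2 : t ≤ L := by
        by_contra hlt
        exact h0 (by rw [Nat.descFactorial_of_lt (by omega), mul_zero])
      have h3 : a + 1 - t = a - t + 1 := by omega
      have h4 : a + 1 - (t + 1) = a - t := by omega
      have h5 : N - (t + 1) = N - t - 1 := by omega
      have h6 : L - (t + 1) = L - t - 1 := by omega
      simp only [A]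
      rw [stringVec_coeff_succ, h3, h4, h5, h6, map_smul, lap_one_two]
      simp only [quadMon, Derivation.leibniz, Derivation.leibniz_pow, pderiv_X, smul_eq_mul]
      simp [MvPolynomial.smul_eq_C_mul]
      ring
  unfold stringVec
  rw [map_sum, Finset.sum_congr rfl fun t _ => key t, Finset.sum_range_sub]
  simp [A]

theorem isHarmonicVector_stringVec {a N L : ℕ} (h : N ≤ a ∨ L ≤ a) :
    IsHarmonicVector 1 2 ((N : ℤ) - a, (L : ℤ)) ![-(a : ℤ), (N : ℤ) - L] (stringVec F a N L) := by
  have key : ∀ {M : Type} [AddCommGroup M] (ω : Fin 2 ⊕ Fin 2 → M) (m : M),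
      (∀ t, t ≤ N → t ≤ L → t ≤ a → (a - t) • ω (.inl 0) + t • ω (.inr 0) + (N - t) • ω (.inl 1) +
        (L - t) • ω (.inr 1) = m) → IsWeightedHomogeneous ω (stringVec F a N L) m := by
    intro M _ ω m hm
    refine IsWeightedHomogeneous.sum _ _ _ fun t _ => ?_
    by_cases h0 : N.choose t * L.descFactorial t = 0
    · rw [h0, Nat.cast_zero, zero_smul]; exact isWeightedHomogeneous_zero _ _ _
    have h1 : t ≤ N := by
      by_contra hlt
      exact h0 (by rw [Nat.choose_eq_zero_of_lt (by omega), zero_mul])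
    have h2 : t ≤ L := by
      by_contra hlt
      exact h0 (by rw [Nat.descFactorial_of_lt (by omega), mul_zero])
    refine Submodule.smul_mem (weightedHomogeneousSubmodule F ω m) _ ?_
    rw [← hm t h1 h2 (by omega)]
    exact ((((isWeightedHomogeneous_X F ω _).pow _).mul ((isWeightedHomogeneous_X F ω _).pow _)).mul
      ((isWeightedHomogeneous_X F ω _).pow _)).mul ((isWeightedHomogeneous_X F ω _).pow _)
  refine ⟨key _ _ fun t h1 h2 h3 => ?_, key _ _ fun t h1 h2 h3 => ?_, lap_stringVec h⟩
  · ext <;> simp [degVar] <;> omega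
  · ext i
    fin_cases i <;> simp [wtVar, sgn] <;> omega

/-- The terms of `stringVec` modulo `y₁ ^ 2`. -/
theorem exists_stringVec_eq (a N L : ℕ) : ∃ R : Poly F 2, stringVec F a N L =
    quadMon F a 0 N L + X (.inr 0) * (((N * L : ℕ) : F) • quadMon F (a - 1) 0 (N - 1) (L - 1)) +
        X (.inr 0) ^ 2 * R := by
  have key : ∀ (c : ℕ → F) (k : ℕ), ∃ R : Poly F 2,
      ∑ t ∈ Finset.range (k + 1 + 1), c t • quadMon F (a - t) t (N - t) (L - t) =
        c 0 • quadMon F a 0 N L + X (.inr 0) * (c 1 • quadMon F (a - 1) 0 (N - 1) (L - 1)) +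
          X (.inr 0) ^ 2 * R := by
    intro c k
    refine ⟨∑ t ∈ Finset.range k, c (t + 1 + 1) •
      quadMon F (a - (t + 1 + 1)) t (N - (t + 1 + 1)) (L - (t + 1 + 1)), ?_⟩
    rw [Finset.sum_range_succ', Finset.sum_range_succ', Finset.mul_sum, add_assoc,
      add_comm (∑ t ∈ Finset.range k, _)]
    refine congrArg₂ (· + ·) ?_ (Finset.sum_congr rfl fun t _ => ?_)
    · simp only [quadMon, MvPolynomial.smul_eq_C_mul, zero_add, Nat.sub_zero, pow_zero, pow_one]
      ring
    · simp only [quadMon, MvPolynomial.smul_eq_C_mul, pow_succ]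
      ring
  unfold stringVec
  rcases L with _ | L
  · exact ⟨0, by simp⟩
  · obtain ⟨R, hR⟩ := key (fun t => ((N.choose t * (L + 1).descFactorial t : ℕ) : F)) L
    refine ⟨R, hR.trans ?_⟩
    simp only [Nat.choose_one_right, Nat.choose_zero_right, Nat.descFactorial_zero,
      Nat.descFactorial_one, mul_one, Nat.cast_one, one_smul]

/-- Both sides are harmonic, so that they can be compared modulo `y₁`. -/
theorem act_one_zero_stringVec [CharZero F] {a N L : ℕ} (h : N ≤ a ∨ L ≤ a) :
    act 1 2 1 0 (stringVec F a N L) = -stringVec F (a + 1) (N + 1) L := by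
  have h' : N + 1 ≤ a + 1 ∨ L ≤ a + 1 := by omega
  refine eq_of_dvd_sub (lap_act (by omega) _ _ (lap_stringVec h))
    (by rw [map_neg, lap_stringVec h', neg_zero]) ?_
  obtain ⟨R, hR⟩ := exists_stringVec_eq (F := F) a N L
  obtain ⟨R', hR'⟩ := exists_stringVec_eq (F := F) (a + 1) (N + 1) L
  rw [act_one_zero]
  generalize pderiv (.inr 1) (stringVec F a N L) = D
  rw [hR, hR']
  generalize ((N * L : ℕ) : F) • quadMon F _ _ _ _ = S
  generalize (((N + 1) * L : ℕ) : F) • quadMon F _ _ _ _ = S'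
  have e1 : quadMon F (a + 1) 0 (N + 1) L = X (.inl 1) * X (.inl 0) * quadMon F a 0 N L := by
    unfold quadMon; ring
  rw [e1]
  generalize quadMon F a 0 N L = A
  refine ⟨-(X (.inl 1) * X (.inl 0) * (S + X (.inr 0) * R)) - D + S' + X (.inr 0) * R', ?_⟩
  ring

/-- Both sides are harmonic, so that they can be compared modulo `y₁`.  For `L = a + 1` the
coefficient on the right is zero. -/
theorem act_zero_one_stringVec [CharZero F] {a N L : ℕ} (h : N ≤ a ∨ L ≤ a + 1) :
    act 1 2 0 1 (stringVec F (a + 1) (N + 1) L) =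
      (((N : F) + 1) * ((a : F) + 1 - L)) • stringVec F a N L := by
  have h' : N + 1 ≤ a + 1 ∨ L ≤ a + 1 := by omega
  refine eq_of_dvd_sub (lap_act (by omega) _ _ (lap_stringVec h'))
    ?_ ?_
  · rw [map_smul]
    rcases eq_or_ne L (a + 1) with rfl | hL
    · simp
    · rw [lap_stringVec (by omega), smul_zero]
  obtain ⟨R, hR⟩ := exists_stringVec_eq (F := F) (a + 1) (N + 1) L
  obtain ⟨R', hR'⟩ := exists_stringVec_eq (F := F) a N L
  rw [act_zero_one, hR, hR']
  obtain ⟨S, hS⟩ : ∃ S : Poly F 2, S = (((N + 1) * L : ℕ) : F) •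
      quadMon F (a + 1 - 1) 0 (N + 1 - 1) (L - 1) := ⟨_, rfl⟩
  rw [← hS]
  generalize ((N * L : ℕ) : F) • quadMon F _ _ _ _ = S'
  have e1 : X (.inr 1) * S = C (((N : F) + 1) * L) * quadMon F a 0 N L := by
    rw [hS, MvPolynomial.smul_eq_C_mul]
    rcases L with _ | L
    · simp
    · simp only [Nat.add_sub_cancel, pow_succ, quadMon]
      push_cast
      ring
  have e2 : pderiv (.inl 0) (pderiv (.inl 1) (quadMon F (a + 1) 0 (N + 1) L)) =
      C (((N : F) + 1) * (a + 1)) * quadMon F a 0 N L := by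
    simp [quadMon, Derivation.leibniz, Derivation.leibniz_pow, pderiv_X]
    ring
  have e3 : pderiv (.inr 0) (quadMon F (a + 1) 0 (N + 1) L) = 0 := by
    simp [quadMon, Derivation.leibniz, Derivation.leibniz_pow, pderiv_X]
  have e4 : ∀ G : Poly F 2, pderiv (.inl 0) (pderiv (.inl 1) (X (.inr 0) * G)) =
      X (.inr 0) * pderiv (.inl 0) (pderiv (.inl 1) G) := by
    intro G
    simp [Derivation.leibniz, pderiv_X]
  have e5 : ∀ G : Poly F 2, pderiv (.inr 0) (X (.inr 0) * G) =
      X (.inr 0) * pderiv (.inr 0) G + G := by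
    intro G
    simp [Derivation.leibniz, pderiv_X]
  refine ⟨pderiv (.inl 0) (pderiv (.inl 1) (S + X (.inr 0) * R)) - X (.inr 1) *
    (pderiv (.inr 0) (S + X (.inr 0) * R) + R) -
      C (((N : F) + 1) * ((a : F) + 1 - L)) * (S' + X (.inr 0) * R'), ?_⟩
  rw [show ∀ A : Poly F 2, A + X (.inr 0) * S + X (.inr 0) ^ 2 * R =
    A + X (.inr 0) * (S + X (.inr 0) * R) by intro A; ring, map_add, map_add, map_add, e2, e3, e4,
    e5, zero_add, MvPolynomial.smul_eq_C_mul]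
  simp only [map_mul, map_add, map_sub, map_one, map_natCast] at e1 ⊢
  linear_combination (-1) * e1

end RankOne

/-! ### Structure of the modules for `n = n₂ = 2`, `n₁ = 1` -/

section RankOneModules

variable {F : Type*} [Field F]

theorem coeff_lap_one_two (f : Poly F 2) (ν : Fin 2 ⊕ Fin 2 →₀ ℕ) :
    coeff ν (lap 1 2 f) = -(if ν (.inl 0) = 0 then 0 else
      coeff (ν - Finsupp.single (.inl 0) 1 + Finsupp.single (.inr 0) 1) f * (ν (.inr 0) + 1)) +
      coeff (ν + Finsupp.single (.inl 1) 1 + Finsupp.single (.inr 1) 1) f * (ν (.inr 1) + 1) *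
        (ν (.inl 1) + 1) := by
  classical
  rw [lap_one_two, coeff_add, coeff_neg, coeff_X_mul', coeff_pderiv, coeff_pderiv, coeff_pderiv]
  simp only [Finsupp.mem_support_iff, ne_eq, ite_not]
  congr 3
  · simp
  · simp

/-- In the terms of a harmonic polynomial, the exponent of `x₁` is at least that of `x₂` or that
of `y₂`. -/
theorem coeff_eq_zero_of_lt_of_lt [CharZero F] {f : Poly F 2} (hf : lap 1 2 f = 0) (k : ℕ) :
    ∀ μ : Fin 2 ⊕ Fin 2 →₀ ℕ, μ (.inl 0) = k → k < μ (.inl 1) → k < μ (.inr 1) →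
      coeff μ f = 0 := by
  classical
  induction k with
  | zero =>
    intro μ h0 h1 h2
    have h := coeff_lap_one_two f (μ - Finsupp.single (.inl 1) 1 - Finsupp.single (.inr 1) 1)
    have hμ : μ - Finsupp.single (.inl 1) 1 - Finsupp.single (.inr 1) 1 +
        Finsupp.single (.inl 1) 1 + Finsupp.single (.inr 1) 1 = μ := by
      ext s
      rcases s with i | i <;> fin_cases i <;> simp <;> omega
    rw [hμ, hf, coeff_zero, if_pos (by simpa using h0), neg_zero, zero_add] at h
    have h3 := (mul_eq_zero.mp h.symm).resolve_right (Nat.cast_add_one_ne_zero _)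
    exact (mul_eq_zero.mp h3).resolve_right (Nat.cast_add_one_ne_zero _)
  | succ k ih =>
    intro μ h0 h1 h2
    have h := coeff_lap_one_two f (μ - Finsupp.single (.inl 1) 1 - Finsupp.single (.inr 1) 1)
    have hμ : μ - Finsupp.single (.inl 1) 1 - Finsupp.single (.inr 1) 1 +
        Finsupp.single (.inl 1) 1 + Finsupp.single (.inr 1) 1 = μ := by
      ext s
      rcases s with i | i <;> fin_cases i <;> simp <;> omega
    have h4 := ih (μ - Finsupp.single (.inl 1) 1 - Finsupp.single (.inr 1) 1 -
      Finsupp.single (.inl 0) 1 + Finsupp.single (.inr 0) 1) (by simp [h0]) (by simp; omega)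
      (by simp; omega)
    rw [hμ, hf, coeff_zero, h4, zero_mul, ite_self, neg_zero, zero_add] at h
    have h3 := (mul_eq_zero.mp h.symm).resolve_right (Nat.cast_add_one_ne_zero _)
    exact (mul_eq_zero.mp h3).resolve_right (Nat.cast_add_one_ne_zero _)

theorem monomial_eq_quadMon (μ : Fin 2 ⊕ Fin 2 →₀ ℕ) (c : F) :
    monomial μ c = c • quadMon F (μ (.inl 0)) (μ (.inr 0)) (μ (.inl 1)) (μ (.inr 1)) := by
  rw [monomial_eq, Finsupp.prod_fintype _ _ (by simp), Fintype.prod_sum_type, Fin.prod_univ_two,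
    Fin.prod_univ_two, quadMon, MvPolynomial.smul_eq_C_mul]
  ring

theorem stringVec_ne_zero {a N L : ℕ} : stringVec F a N L ≠ 0 := by
  intro h0
  obtain ⟨R, hR⟩ := exists_stringVec_eq (F := F) a N L
  have := congrArg (eval fun s : Fin 2 ⊕ Fin 2 => if s = .inr 0 then (0 : F) else 1)
    (hR.symm.trans h0)
  simp [quadMon] at this

/-- A harmonic polynomial is the combination of the vectors `stringVec` with the same residue
modulo `y₁`. -/
theorem mem_span_stringVec [CharZero F] {ℓ₁ : ℤ} {L : ℕ} {S : Submodule F (Poly F 2)}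
    (hS : ∀ a N : ℕ, (N : ℤ) - a = ℓ₁ → N ≤ a ∨ L ≤ a → stringVec F a N L ∈ S) {f : Poly F 2}
    (hf : IsWeightedHomogeneous (degVar 2 1 2) f (ℓ₁, (L : ℤ))) (hlap : lap 1 2 f = 0) : f ∈ S := by
  let g : Poly F 2 := ∑ μ ∈ f.support, if μ (.inr 0) = 0 then
    coeff μ f • stringVec F (μ (.inl 0)) (μ (.inl 1)) L else 0
  have hdeg : ∀ μ ∈ f.support,
      (μ (.inl 1) : ℤ) - μ (.inl 0) = ℓ₁ ∧ μ (.inr 0) + μ (.inr 1) = L := by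
    intro μ hμ
    have h := hf (mem_support_iff.mp hμ)
    rw [weight_degVar, Fin.sum_univ_two, Fin.sum_univ_two, Prod.mk.injEq] at h
    simp [sgn] at h
    omega
  have hval : ∀ μ ∈ f.support, μ (.inr 0) = 0 → μ (.inl 1) ≤ μ (.inl 0) ∨ L ≤ μ (.inl 0) := by
    intro μ hμ h0
    by_contra! hlt
    have := hdeg μ hμ
    exact mem_support_iff.mp hμ (coeff_eq_zero_of_lt_of_lt hlap _ μ rfl hlt.1 (by omega))
  have hfg : f = g := by
    refine eq_of_dvd_sub hlap ?_ ?_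
    · simp only [g]
      rw [map_sum]
      refine Finset.sum_eq_zero fun μ hμ => ?_
      split_ifs with h0
      · rw [map_smul, lap_stringVec (hval μ hμ h0), smul_zero]
      · rw [map_zero]
    · conv_rhs => rw [f.as_sum]
      simp only [g]
      rw [← Finset.sum_sub_distrib]
      refine Finset.dvd_sum fun μ hμ => ?_
      split_ifs with h0
      · obtain ⟨R, hR⟩ := exists_stringVec_eq (F := F) (μ (.inl 0)) (μ (.inl 1)) L
        have h1 : μ (.inr 1) = L := by have := hdeg μ hμ; omega
        rw [hR, monomial_eq_quadMon, h0, h1, add_assoc, smul_add, ← sub_sub, sub_self, zero_sub,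
          dvd_neg, MvPolynomial.smul_eq_C_mul]
        refine Dvd.dvd.mul_left (dvd_add (dvd_mul_right _ _) ?_) _
        rw [pow_two, mul_assoc]
        exact dvd_mul_right _ _
      · rw [sub_zero]
        exact X_dvd_monomial.mpr (Or.inr h0)
  rw [hfg]
  refine S.sum_mem fun μ hμ => ?_
  split_ifs with h0
  · exact S.smul_mem _ (hS _ _ (hdeg μ hμ).1 (hval μ hμ h0))
  · exact S.zero_mem

variable {ℓ₁ : ℤ} {L : ℕ} {h12 : 1 ≤ 2}

/-- The irreducible modules: the vectors of the family are connected by `E_{2,1}` and, with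
nonvanishing coefficients, by `E_{1,2}`. -/
theorem isIrreducible_and_isCompletelyPointed_one_two [CharZero F] {a₀ N₀ : ℕ}
    (hℓ : (N₀ : ℤ) - a₀ = ℓ₁) (hL : L ≤ a₀)
    (hmin : ∀ a N : ℕ, (N : ℤ) - a = ℓ₁ → N ≤ a ∨ L ≤ a → a₀ ≤ a) :
    LieModule.IsIrreducible F (SLn F 2) (harmonic F 2 h12 ℓ₁ L) ∧
      IsCompletelyPointed F 2 (harmonic F 2 h12 ℓ₁ L) := by
  refine isIrreducible_and_isCompletelyPointed (fun k : ℕ => stringVec F (a₀ + k) (N₀ + k) L)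
    (fun k => ![-((a₀ + k : ℕ) : ℤ), ((N₀ + k : ℕ) : ℤ) - L]) (fun k k' h => ?_) (fun k => ?_)
    (fun k => stringVec_ne_zero) (fun f hf hlap => ?_) fun S hS k k' hk => ?_
  · have := congrFun h 0
    simpa using this
  · have := isHarmonicVector_stringVec (F := F) (a := a₀ + k) (N := N₀ + k) (L := L)
      (Or.inr (by omega))
    rwa [show ((N₀ + k : ℕ) : ℤ) - (a₀ + k : ℕ) = ℓ₁ by push_cast; omega] at this
  · refine mem_span_stringVec (fun a N hN hval => ?_) hf hlap
    have := hmin a N hN hval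
    refine Submodule.subset_span ⟨a - a₀, ?_⟩
    change stringVec F (a₀ + (a - a₀)) (N₀ + (a - a₀)) L = _
    rw [show a₀ + (a - a₀) = a by omega, show N₀ + (a - a₀) = N by omega]
  · have hup : ∀ j, stringVec F (a₀ + j) (N₀ + j) L ∈ S →
        stringVec F (a₀ + (j + 1)) (N₀ + (j + 1)) L ∈ S := by
      intro j hj
      have h1 := hS 1 0 (by decide) _ hj
      rwa [act_one_zero_stringVec (Or.inr (by omega)), S.neg_mem_iff] at h1
    have hdown : ∀ j, stringVec F (a₀ + (j + 1)) (N₀ + (j + 1)) L ∈ S →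
        stringVec F (a₀ + j) (N₀ + j) L ∈ S := by
      intro j hj
      have h1 := hS 0 1 (by decide) _ hj
      rw [← add_assoc, ← add_assoc, act_zero_one_stringVec (Or.inr (by omega)),
        S.smul_mem_iff] at h1
      · exact h1
      · refine mul_ne_zero (Nat.cast_add_one_ne_zero _) ?_
        have h2 : (((a₀ + j : ℕ) : ℤ) + 1 - L : ℤ) ≠ 0 := by push_cast; omega
        exact_mod_cast (Int.cast_ne_zero (α := F)).mpr h2
    have h0 : stringVec F (a₀ + 0) (N₀ + 0) L ∈ S := by
      induction k with
      | zero => exact hk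
      | succ k ih => exact ih (hdown k hk)
    induction k' with
    | zero => exact h0
    | succ k' ih => exact hup k' ih

/-- For `ℓ₂ > -ℓ₁ ≥ 0` the vectors `stringVec a` with `a ≥ ℓ₂` span a proper submodule. -/
theorem not_isIrreducible_one_two [CharZero F] {m : ℕ} (hm : m < L) :
    ¬ LieModule.IsIrreducible F (SLn F 2) (harmonic F 2 h12 (-m) L) := by
  intro hirr
  have hb : ∀ k : ℕ, IsHarmonicVector 1 2 (-(m : ℤ), (L : ℤ)) ![-((m + k : ℕ) : ℤ), (k : ℤ) - L]
      (stringVec F (m + k) k L) := by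
    intro k
    have := isHarmonicVector_stringVec (F := F) (a := m + k) (N := k) (L := L)
      (Or.inl (by omega))
    rwa [show (k : ℤ) - (m + k : ℕ) = -m by push_cast; omega] at this
  let S : Submodule F (Poly F 2) :=
    Submodule.span F (Set.range fun k : ℕ => stringVec F (L + k) (L - m + k) L)
  have hLk : ∀ k, L + k = m + (L - m + k) := fun k => by omega
  have hgen : ∀ k, stringVec F (L + k) (L - m + k) L ∈ S := fun k => Submodule.subset_span ⟨k, rfl⟩
  have hS : ∀ i j, ∀ f ∈ S, act 1 2 i j f ∈ S := by
    intro i j f hf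
    have hle : S ≤ S.comap (act 1 2 i j) := by
      refine Submodule.span_le.mpr ?_
      rintro _ ⟨k, rfl⟩
      change act 1 2 i j (stringVec F (L + k) (L - m + k) L) ∈ S
      fin_cases i <;> fin_cases j
      · have h1 := hb (L - m + k)
        rw [← hLk] at h1
        change act 1 2 0 0 _ ∈ S
        rw [act_self h1.wt]
        exact S.smul_mem _ (hgen k)
      · change act 1 2 0 1 _ ∈ S
        rcases k with _ | k
        · obtain ⟨L', rfl⟩ : ∃ L', L = L' + 1 := ⟨L - 1, by omega⟩
          rw [add_zero, add_zero, show L' + 1 - m = (L' - m) + 1 by omega,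
            act_zero_one_stringVec (Or.inl (by omega))]
          simp
        · rw [← add_assoc, ← add_assoc, act_zero_one_stringVec (Or.inl (by omega))]
          exact S.smul_mem _ (hgen k)
      · change act 1 2 1 0 _ ∈ S
        rw [act_one_zero_stringVec (Or.inl (by omega))]
        exact S.neg_mem (hgen (k + 1))
      · have h1 := hb (L - m + k)
        rw [← hLk] at h1
        change act 1 2 1 1 _ ∈ S
        rw [act_self h1.wt]
        exact S.smul_mem _ (hgen k)
    exact hle hf
  let N : LieSubmodule F (SLn F 2) (harmonic F 2 h12 (-m) L) :=
    { toSubmodule := S.comap (harmonic F 2 h12 (-m) L).toSubmodule.subtype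
      lie_mem := by
        intro A x hx
        change (⁅A, x.1⁆ : Osc F 2 1 2) ∈ S
        rw [lie_def]
        exact S.sum_mem fun i _ => S.sum_mem fun j _ => S.smul_mem _ (hS i j _ hx) }
  have hbL := hb (L - m + 0)
  rw [← hLk] at hbL
  rcases eq_bot_or_eq_top N with hN | hN
  · have h1 : (⟨_, hbL.mem⟩ : harmonic F 2 h12 (-m) L) ∈ N := hgen 0
    rw [hN, LieSubmodule.mem_bot] at h1
    exact stringVec_ne_zero (congrArg Subtype.val h1)
  -- the vector `stringVec m` is outside: its weight is different from those in the submodule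
  · have h1 : (⟨_, (hb 0).mem⟩ : harmonic F 2 h12 (-m) L) ∈ N := by rw [hN]; trivial
    have h2 : stringVec F (m + 0) 0 L ∈ S := h1
    obtain ⟨μ, hμ⟩ := MvPolynomial.ne_zero_iff.mp (stringVec_ne_zero (F := F) (a := m + 0) (N := 0)
      (L := L))
    have hle : S ≤ LinearMap.ker (lcoeff F μ) := by
      refine Submodule.span_le.mpr ?_
      rintro _ ⟨k, rfl⟩
      change coeff μ (stringVec F (L + k) (L - m + k) L) = 0
      by_contra hne
      have h3 := hb (L - m + k)
      rw [← hLk] at h3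
      have h4 := congrFun ((h3.wt hne).symm.trans ((hb 0).wt hμ)) 0
      simp at h4
      omega
    exact hμ (hle h2)

end RankOneModules

/-! ### Highest-weight vectors -/

section HighestWeights

variable {F : Type*} [Field F] {n n₁ n₂ : ℕ}

theorem fundWeight_apply (k : ℕ) (A : cartan F n) :
    fundWeight F n k A = ∑ i : Fin n, if i.val < k then A.1.1 i i else 0 := rfl

/-- Weights are compared up to a multiple of the trace. -/
theorem weightOf_eq {w : Fin n → ℤ} {x y : F} {k l : ℕ} (c : F)
    (h : ∀ i : Fin n, ((w i + wtShift n₁ n₂ i : ℤ) : F) =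
      (if i.val < k then x else 0) + (if i.val < l then y else 0) + c) :
    weightOf F n₁ n₂ w = x • fundWeight F n k + y • fundWeight F n l := by
  ext A
  have htr : ∑ i, A.1.1 i i = 0 := LinearMap.mem_ker.mp A.1.2
  have htr' : ∑ i, c * A.1.1 i i = 0 := by rw [← Finset.mul_sum, htr, mul_zero]
  rw [weightOf_apply, LinearMap.add_apply, LinearMap.smul_apply, LinearMap.smul_apply,
    fundWeight_apply, fundWeight_apply, smul_eq_mul, smul_eq_mul, Finset.mul_sum, Finset.mul_sum,
    ← Finset.sum_add_distrib, ← sub_eq_zero, ← Finset.sum_sub_distrib]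
  refine Eq.trans (Finset.sum_congr rfl fun i _ => ?_) htr'
  rw [h]
  split_ifs <;> ring

theorem weightOf_eq_smul {w : Fin n → ℤ} {x : F} {k : ℕ} (c : F)
    (h : ∀ i : Fin n, ((w i + wtShift n₁ n₂ i : ℤ) : F) = (if i.val < k then x else 0) + c) :
    weightOf F n₁ n₂ w = x • fundWeight F n k := by
  have := weightOf_eq (F := F) (n₁ := n₁) (n₂ := n₂) (w := w) (x := x) (y := 0) (k := k) (l := 0) c
    (by simpa using h)
  simpa using this

theorem xv_eq {k : ℕ} (i : Fin n) (h : i.val + 1 = k) :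
    xv F n n₁ n₂ k = (X (.inl i) : Poly F n) := by
  subst h
  have h1 : 1 ≤ i.val + 1 ∧ i.val + 1 ≤ n := ⟨by omega, i.2⟩
  unfold xv
  rw [dif_pos h1]
  rfl

theorem yv_eq {k : ℕ} (i : Fin n) (h : i.val + 1 = k) :
    yv F n n₁ n₂ k = (X (.inr i) : Poly F n) := by
  subst h
  have h1 : 1 ≤ i.val + 1 ∧ i.val + 1 ≤ n := ⟨by omega, i.2⟩
  unfold yv
  rw [dif_pos h1]
  rfl

variable {h12 : n₁ ≤ n₂} {ℓ₁ ℓ₂ : ℤ}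

theorem exists_isHighestWeightVector {v : Osc F n n₁ n₂} {χ : Module.Dual F (cartan F n)}
    {f : Poly F n} {w : Fin n → ℤ} (e : v = f) (hf : IsHarmonicVector n₁ n₂ (ℓ₁, ℓ₂) w f)
    (h0 : f ≠ 0) (hE : ∀ i j : Fin n, i < j → act n₁ n₂ i j f = 0)
    (hχ : weightOf F n₁ n₂ w = χ) :
    ∃ hv : v ∈ harmonic F n h12 ℓ₁ ℓ₂,
      IsHighestWeightVector (⟨v, hv⟩ : harmonic F n h12 ℓ₁ ℓ₂) χ := by
  subst e
  subst hχ
  exact ⟨hf.mem, hf.isHighestWeightVector h0 hE⟩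

/-- For `n₂ = n` the powers of `x_p`, where `p` is next to the boundary between the indices up to
`n₁` and the others. -/
theorem xPow_isHighestWeightVector (h2 : n₂ = n) {p : Fin n} (hp : p.val = n₁ ∨ p.val + 1 = n₁)
    {m : ℕ} {v : Osc F n n₁ n₂} {χ : Module.Dual F (cartan F n)}
    (hv : v = (X (.inl p) ^ m : Poly F n)) (hℓ : sgn n₁ p * m = ℓ₁)
    (hχ : weightOf F n₁ n₂ (fun i => sgn n₁ i * if i = p then (m : ℤ) else 0) = χ) :
    ∃ hv : v ∈ harmonic F n h12 ℓ₁ 0,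
      IsHighestWeightVector (⟨v, hv⟩ : harmonic F n h12 ℓ₁ 0) χ := by
  have hmon : monomial (xExp (Pi.single p m)) (1 : F) = (X (.inl p) ^ m : Poly F n) := by
    have he : xExp (Pi.single p m) = Finsupp.single (.inl p) m := by
      ext (i | i)
      · simp [Finsupp.single_apply, Pi.single_apply, eq_comm]
      · simp
    rw [X_pow_eq_monomial, he]
  have hh := isHarmonicVector_xExp (n₁ := n₁) h2 (α := Pi.single p m) (ℓ := ℓ₁)
    (by rw [← hℓ]; simp [Pi.single_apply]) (1 : F)
  rw [hmon] at hh
  refine exists_isHighestWeightVector hv hh (pow_ne_zero _ (X_ne_zero _)) (fun i j hij => ?_) ?_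
  · have hx : ∀ k, k ≠ p → pderiv (.inl k) (X (.inl p) ^ m : Poly F n) = 0 := by
      intro k hk
      rw [Derivation.leibniz_pow, pderiv_X_of_ne (by simpa using hk.symm)]
      simp
    have hy : ∀ k, pderiv (.inr k) (X (.inl p) ^ m : Poly F n) = 0 := by
      intro k
      rw [Derivation.leibniz_pow, pderiv_X_of_ne (by simp)]
      simp
    have hi2 : i.val < n₂ := h2 ▸ i.2
    have hj2 : j.val < n₂ := h2 ▸ j.2
    have hij' : i.val < j.val := hij
    rw [act_apply, if_pos hj2, if_pos hi2, hy, mul_zero, sub_zero, if_neg hij.ne, sub_zero]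
    by_cases hi : i.val < n₁
    · by_cases hj : j.val < n₁
      · rw [if_pos hi, if_pos hj, hx i (fun e => by subst e; omega), mul_zero, neg_zero]
      · rw [if_pos hi, if_neg hj]
        by_cases hjp : j = p
        · rw [pderiv_comm, hx i (fun e => hij.ne (e.trans hjp.symm)), map_zero]
        · rw [hx j hjp, map_zero]
    · have hj : ¬ j.val < n₁ := by omega
      rw [if_neg hi, if_neg hj, hx j (fun e => by subst e; omega), mul_zero]
  · rw [← hχ]
    congr 1
    ext i
    simp [Pi.single_apply]

/-- Scalar vectors are highest-weight vectors if the solo index is the first one and lies below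
`n₁`, or the last one and lies above `n₁`. -/
theorem IsScalarVector.isHighestWeightVector {p₀ : Fin n} {d : Fin n → ℤ} {e : ℤ} {f : Poly F n}
    {h11 : n₁ ≤ n₁} (h : IsSolo n₁ p₀) (hp : p₀.val = 0 ∧ n₁ = 1 ∨ p₀.val + 1 = n ∧ n₁ + 1 = n)
    (hf : IsScalarVector n₁ p₀ d e f)
    (hh : IsHarmonicVector n₁ n₁ (ℓ₁, ℓ₂) (fun i => sgn n₁ i * d i) f) (h0 : f ≠ 0)
    {v : Osc F n n₁ n₁} (hv : v = f) {χ : Module.Dual F (cartan F n)}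
    (hχ : χ = -((d p₀ + e + 2 : ℤ) : F) • fundWeight F n n₁) :
    ∃ hv : v ∈ harmonic F n h11 ℓ₁ ℓ₂,
      IsHighestWeightVector (⟨v, hv⟩ : harmonic F n h11 ℓ₁ ℓ₂) χ := by
  refine exists_isHighestWeightVector hv hh h0 (fun i j hij => ?_) ?_
  · have hij' : i.val < j.val := hij
    have hi2 := i.2
    have hj2 := j.2
    rcases hp with ⟨hp, hn⟩ | ⟨hp, hn⟩
    · have hact : act n₁ n₁ i j f = soloAct F n₁ p₀ i j f := by
        unfold soloAct; rw [if_pos (by omega)]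
      have hj : j ≠ p₀ := fun e => by subst e; omega
      rw [hact]
      by_cases hi : i = p₀
      · subst hi; exact hf.raise j hj
      · exact hf.rest i j hi hj hij.ne
    · have hact : act n₁ n₁ i j f = -soloAct F n₁ p₀ j i f := by
        unfold soloAct; rw [if_neg (by omega), LinearMap.neg_apply, neg_neg]
      have hi : i ≠ p₀ := fun e => by subst e; omega
      rw [hact, neg_eq_zero]
      by_cases hj : j = p₀
      · subst hj; exact hf.raise i hi
      · exact hf.rest j i hj hi hij.ne'
  · rw [hχ]
    refine weightOf_eq_smul (if p₀.val < n₁ then (e : F) + 1 else (d p₀ : F) + 1) fun i => ?_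
    rw [wtShift_self]
    have hi2 := i.2
    by_cases hi : i = p₀
    · subst hi
      unfold sgn
      split_ifs <;> push_cast <;> ring
    · have h1 := h i hi
      rw [hf.deg_rest i hi]
      unfold sgn
      by_cases c : p₀.val < n₁
      · have : ¬ i.val < n₁ := by tauto
        simp only [c, this, if_true, if_false]
        push_cast; ring
      · have : i.val < n₁ := by tauto
        simp only [c, this, if_true, if_false]
        push_cast; ring

theorem etaVector_eq (m₁ m₂ : ℕ) : etaVector F 2 1 2 m₁ m₂ = stringVec F m₂ (m₁ + m₂) m₂ := by
  unfold etaVector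
  rw [xv_eq (k := 1) (0 : Fin 2) rfl, xv_eq (k := 2) (1 : Fin 2) rfl,
    yv_eq (k := 1) (0 : Fin 2) rfl, yv_eq (k := 2) (1 : Fin 2) rfl]
  rfl

theorem isSolo_zero {p₀ : Fin n} (hp : p₀.val = 0) (h1 : n₁ = 1) : IsSolo n₁ p₀ := by
  intro q hq
  have : q.val ≠ p₀.val := fun e => hq (Fin.ext e)
  omega

theorem isSolo_last {p₀ : Fin n} (hp : p₀.val + 1 = n) (h1 : n₁ + 1 = n) : IsSolo n₁ p₀ := by
  intro q hq
  have : q.val ≠ p₀.val := fun e => hq (Fin.ext e)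
  have := q.2
  omega

end HighestWeights

/-! ### The classification -/

section Classification

variable {F : Type*} [Field F] [CharZero F] {n n₁ n₂ : ℕ} {h12 : n₁ ≤ n₂} {ℓ₁ ℓ₂ : ℤ}

theorem Listed.isIrreducible_and_isCompletelyPointed (hn : 2 ≤ n) (h1 : 1 ≤ n₁)
    {v : Osc F n n₁ n₂} {χ : Module.Dual F (cartan F n)} (h : Listed F n n₁ n₂ ℓ₁ ℓ₂ v χ) :
    LieModule.IsIrreducible F (SLn F n) (harmonic F n h12 ℓ₁ ℓ₂) ∧
      IsCompletelyPointed F n (harmonic F n h12 ℓ₁ ℓ₂) := by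
  rcases h with ⟨ha, hb, h⟩ | ⟨ha, hb, h⟩ | ⟨ha, hb, h⟩ | ⟨ha, hb, h⟩
  · have hℓ : ℓ₂ = 0 := by
      rcases h with ⟨m, _, h, _⟩ | ⟨m, _, h, _⟩ <;> exact h
    subst hℓ
    exact xModule_isIrreducible_and_isCompletelyPointed h1 (by omega) hb ℓ₁
  · rcases h with ⟨m, -, hℓ, -⟩ | ⟨m, -, hℓ, -⟩ | ⟨hn2, m₁, m₂, hm, hℓ₁, hℓ₂, -⟩ |
      ⟨hn2, m₁, m₂, hm₁, hm₂, hℓ₁, hℓ₂, -⟩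
    · subst hℓ
      exact xModule_isIrreducible_and_isCompletelyPointed h1 (by omega) hb ℓ₁
    · subst hℓ
      exact xModule_isIrreducible_and_isCompletelyPointed h1 (by omega) hb ℓ₁
    · subst hn2
      obtain rfl : n₁ = 1 := by omega
      subst ha hℓ₂
      exact isIrreducible_and_isCompletelyPointed_one_two (a₀ := m₁) (N₀ := 0) (by omega) hm
        fun a N h3 h4 => by omega
    · subst hn2
      obtain rfl : n₁ = 1 := by omega
      subst ha hℓ₂
      exact isIrreducible_and_isCompletelyPointed_one_two (a₀ := m₂) (N₀ := m₁ + m₂)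
        (by omega) le_rfl fun a N h3 h4 => by omega
  · subst ha
    subst hb
    let p : Fin n := ⟨0, by omega⟩
    let q : Fin n := ⟨1, by omega⟩
    have hsolo : IsSolo 1 p := isSolo_zero rfl rfl
    have hqp : q ≠ p := by simp [p, q]
    rcases h with ⟨m, hℓ₁, hℓ₂, -⟩ | ⟨hn3, m, hℓ₁, hℓ₂, -⟩ | ⟨hn2, m₁, m₂, hℓ₁, hℓ₂, -⟩
    · refine hsolo.isIrreducible_and_isCompletelyPointed_u (q := q) hqp (m := m) (m₂ := 0)
        (Or.inl rfl) ?_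
      rw [hℓ₁, hℓ₂]; simp [soloDeg, p]
    · subst hn3
      refine hsolo.isIrreducible_and_isCompletelyPointed_pairDet (r := 1) (s := 2) (k := m + 1)
        (by simp [p]) (by simp [p]) (by decide) (fun q => by fin_cases q <;> simp [p]) ?_
      rw [hℓ₁, hℓ₂]; simp [soloDeg, p]; ring
    · subst hn2
      refine hsolo.isIrreducible_and_isCompletelyPointed_u (q := q) hqp (m := m₁) (m₂ := m₂)
        (Or.inr fun r hr => ?_) ?_
      · have h1 : r.val ≠ 0 := fun e => hr (Fin.ext e)
        exact Fin.ext (show r.val = 1 by omega)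
      rw [hℓ₁, hℓ₂]; simp [soloDeg, p]
  · obtain rfl : n₁ = n₂ := by omega
    have hn1 : n₁ + 1 = n := by clear h; omega
    have hn0 : 0 < n := by clear h; omega
    have hpn' : n - 1 + 1 = n := Nat.sub_add_cancel hn0
    let p : Fin n := ⟨n - 1, Nat.sub_lt hn0 Nat.one_pos⟩
    let q : Fin n := ⟨0, hn0⟩
    have hpn : p.val + 1 = n := hpn'
    have hsolo : IsSolo n₁ p := isSolo_last hpn hn1
    have hqp : q ≠ p := fun e => by
      have e' : 0 = n - 1 := congrArg Fin.val e
      clear h; omega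
    have hp : ¬ p.val < n₁ := fun e => by
      have e' : n - 1 < n₁ := e
      clear h; omega
    rcases h with ⟨m, hℓ₁, hℓ₂, -⟩ | ⟨hn3, m, hℓ₁, hℓ₂, -⟩
    · refine hsolo.isIrreducible_and_isCompletelyPointed_u (q := q) hqp (m := m) (m₂ := 0)
        (Or.inl rfl) ?_
      rw [hℓ₁, hℓ₂, soloDeg, if_neg hp]; simp
    · subst hn3
      refine hsolo.isIrreducible_and_isCompletelyPointed_pairDet (r := 0) (s := 1) (k := m + 1)
        (by simp [p]) (by simp [p]) (by decide) (fun q => by fin_cases q <;> simp [p]) ?_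
      rw [hℓ₁, hℓ₂, soloDeg, if_neg hp]; simp; ring

theorem Listed.isHighestWeightVector (hn : 2 ≤ n) (h1 : 1 ≤ n₁)
    {v : Osc F n n₁ n₂} {χ : Module.Dual F (cartan F n)} (h : Listed F n n₁ n₂ ℓ₁ ℓ₂ v χ) :
    ∃ hv : v ∈ harmonic F n h12 ℓ₁ ℓ₂,
      IsHighestWeightVector (⟨v, hv⟩ : harmonic F n h12 ℓ₁ ℓ₂) χ := by
  -- the powers of the last variable on the left of the boundary between `n₁` and `n₁ + 1`
  have hleft : ∀ m k : ℕ, k = n₁ → n₂ = n → n₁ < n → ℓ₁ = -m → ℓ₂ = 0 → v = xv F n n₁ n₂ k ^ m →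
      χ = (m : F) • fundWeight F n (k - 1) - ((m : F) + 1) • fundWeight F n k →
      ∃ hv : v ∈ harmonic F n h12 ℓ₁ ℓ₂,
        IsHighestWeightVector (⟨v, hv⟩ : harmonic F n h12 ℓ₁ ℓ₂) χ := by
    rintro m k rfl hb hk hℓ₁ rfl hv hχ
    rw [xv_eq ⟨k - 1, by omega⟩ (by simp only; omega)] at hv
    refine xPow_isHighestWeightVector hb (p := ⟨k - 1, by omega⟩) (Or.inr (by simp only; omega)) hv
      (by rw [hℓ₁, sgn, if_pos (by simp only; omega)]; ring) ?_
    have hχ' : χ = (m : F) • fundWeight F n (k - 1) + (-((m : F) + 1)) • fundWeight F n k := by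
      rw [hχ]
      ext A
      simp only [LinearMap.sub_apply, LinearMap.add_apply, LinearMap.smul_apply, smul_eq_mul]
      ring
    rw [hχ']
    refine weightOf_eq 0 fun i => ?_
    have hi2 : i.val < n₂ := hb ▸ i.2
    unfold sgn wtShift
    rw [if_pos hi2]
    simp only [Fin.ext_iff]
    split_ifs <;> first | omega | (push_cast; ring)
  -- the powers of the variable on the right of that boundary
  have hright : ∀ m : ℕ, n₂ = n → n₁ < n → ℓ₁ = m → ℓ₂ = 0 → v = xv F n n₁ n₂ (n₁ + 1) ^ m →
      χ = -((m : F) + 1) • fundWeight F n n₁ + (m : F) • fundWeight F n (n₁ + 1) →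
      ∃ hv : v ∈ harmonic F n h12 ℓ₁ ℓ₂,
        IsHighestWeightVector (⟨v, hv⟩ : harmonic F n h12 ℓ₁ ℓ₂) χ := by
    rintro m hb hk hℓ₁ rfl hv hχ
    rw [xv_eq ⟨n₁, hk⟩ rfl] at hv
    refine xPow_isHighestWeightVector hb (p := ⟨n₁, hk⟩) (Or.inl rfl) hv
      (by rw [hℓ₁, sgn, if_neg (lt_irrefl _)]; ring) ?_
    rw [hχ]
    refine weightOf_eq 0 fun i => ?_
    have hi2 : i.val < n₂ := hb ▸ i.2
    unfold sgn wtShift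
    rw [if_pos hi2]
    simp only [Fin.ext_iff]
    split_ifs <;> first | omega | (push_cast; ring)
  rcases h with ⟨ha, hb, h⟩ | ⟨ha, hb, h⟩ | ⟨ha, hb, h⟩ | ⟨ha, hb, h⟩
  · rcases h with ⟨m, hℓ₁, hℓ₂, hv, hχ⟩ | ⟨m, hℓ₁, hℓ₂, hv, hχ⟩
    · exact hright m hb (by omega) hℓ₁ hℓ₂ hv hχ
    · exact hleft m n₁ rfl hb (by omega) hℓ₁ hℓ₂ hv hχ
  · rcases h with ⟨m, hℓ₁, hℓ₂, hv, hχ⟩ | ⟨m, hℓ₁, hℓ₂, hv, hχ⟩ |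
      ⟨hn2, m₁, m₂, hm, hℓ₁, hℓ₂, hv, hχ⟩ | ⟨hn2, m₁, m₂, hm₁, hm₂, hℓ₁, hℓ₂, hv, hχ⟩
    · exact hleft m (n - 1) (by omega) hb (by omega) hℓ₁ hℓ₂ hv (by rw [hχ, Nat.sub_sub])
    · have hzero : fundWeight F n n = 0 := by
        ext A
        rw [fundWeight_apply, LinearMap.zero_apply]
        refine Eq.trans (Finset.sum_congr rfl fun i _ => if_pos i.2) ?_
        exact LinearMap.mem_ker.mp A.1.2
      refine hright m hb (by omega) hℓ₁ hℓ₂ (by rw [hv]; congr 2; omega) ?_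
      rw [hχ, show n₁ + 1 = n by omega, hzero, smul_zero, add_zero, show n - 1 = n₁ by omega]
    · subst hn2
      obtain rfl : n₁ = 1 := by omega
      subst ha hℓ₂ hℓ₁
      have hh := isHarmonicVector_stringVec (F := F) (a := m₁) (N := 0) (L := m₂)
        (Or.inl (Nat.zero_le _))
      have hq : stringVec F m₁ 0 m₂ = quadMon F m₁ 0 0 m₂ := by
        unfold stringVec
        rw [Finset.sum_eq_single 0]
        · simp
        · intro t _ ht
          rw [Nat.choose_eq_zero_of_lt (by omega)]; simp
        · simp
      rw [Nat.cast_zero, zero_sub] at hh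
      refine exists_isHighestWeightVector (f := stringVec F m₁ 0 m₂) ?_ hh stringVec_ne_zero
        (fun i j hij => ?_) ?_
      · rw [hv, hq, xv_eq (k := 1) (0 : Fin 2) rfl, yv_eq (k := 2) (1 : Fin 2) rfl]
        unfold quadMon
        rw [pow_zero, pow_zero, mul_one, mul_one]
        rfl
      · obtain ⟨rfl, rfl⟩ : i = 0 ∧ j = 1 := by
          revert i j; decide
        rw [hq, act_zero_one]
        simp [quadMon, Derivation.leibniz, Derivation.leibniz_pow, pderiv_X]
      · rw [hχ]
        refine weightOf_eq_smul (-(m₂ : F)) fun i => ?_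
        fin_cases i <;> simp [wtShift]
        ring
    · subst hn2
      obtain rfl : n₁ = 1 := by omega
      subst ha hℓ₂ hℓ₁
      have hh := isHarmonicVector_stringVec (F := F) (a := m₂) (N := m₁ + m₂) (L := m₂)
        (Or.inr le_rfl)
      rw [Nat.cast_add, add_sub_cancel_right] at hh
      refine exists_isHighestWeightVector (f := stringVec F m₂ (m₁ + m₂) m₂)
        (hv.trans (etaVector_eq m₁ m₂)) hh stringVec_ne_zero (fun i j hij => ?_) ?_
      · obtain ⟨rfl, rfl⟩ : i = 0 ∧ j = 1 := by
          revert i j; decide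
        obtain ⟨m₂, rfl⟩ : ∃ k, m₂ = k + 1 := ⟨m₂ - 1, by omega⟩
        rw [← add_assoc, act_zero_one_stringVec (Or.inr le_rfl)]
        simp
      · rw [hχ]
        refine weightOf_eq_smul (m₁ : F) fun i => ?_
        fin_cases i <;> simp [wtShift]
        ring
  · subst ha
    subst hb
    let p : Fin n := ⟨0, by omega⟩
    have hsolo : IsSolo 1 p := isSolo_zero rfl rfl
    have hdeg : ∀ ℓ, soloDeg 1 p ℓ = ℓ := fun ℓ => if_pos Nat.one_pos
    -- the vectors `x₁ ^ m₁ * y₂ ^ m₂`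
    have hmul : ∀ m₁ m₂ : ℕ, (m₂ = 0 ∨ n = 2) → ℓ₁ = -m₁ → ℓ₂ = -m₂ →
        v = xv F n 1 1 1 ^ m₁ * yv F n 1 1 2 ^ m₂ →
        χ = -((m₁ : F) + m₂ + 2) • fundWeight F n 1 →
        ∃ hv : v ∈ harmonic F n h12 ℓ₁ ℓ₂,
          IsHighestWeightVector (⟨v, hv⟩ : harmonic F n h12 ℓ₁ ℓ₂) χ := by
      rintro m₁ m₂ hm rfl rfl hv hχ
      let q : Fin n := ⟨1, by omega⟩
      have hqp : q ≠ p := by simp [p, q]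
      have hh := hsolo.isHarmonicVector_u (F := F) hqp (m := m₁) (m₂ := m₂)
      rw [hdeg] at hh
      refine IsScalarVector.isHighestWeightVector hsolo (Or.inl ⟨rfl, rfl⟩)
        (hsolo.isScalarVector_u hqp (hm.imp id fun hn2 r hr => ?_)) hh
        (mul_ne_zero (pow_ne_zero _ (uVar_ne_zero _)) (pow_ne_zero _ (uVar_ne_zero _))) ?_ ?_
      · have h1 : r.val ≠ 0 := fun e => hr (Fin.ext e)
        exact Fin.ext (show r.val = 1 by omega)
      · rw [hv, xv_eq (k := 1) p rfl, yv_eq (k := 2) q rfl]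
        rfl
      · rw [hχ]
        simp [hqp.symm]
    rcases h with ⟨m, hℓ₁, hℓ₂, hv, hχ⟩ | ⟨hn3, m, hℓ₁, hℓ₂, hv, hχ⟩ |
      ⟨hn2, m₁, m₂, hℓ₁, hℓ₂, hv, hχ⟩
    · exact hmul m 0 (Or.inl rfl) hℓ₁ (by rw [hℓ₂]; simp) (by rw [hv]; simp) (by rw [hχ]; simp)
    · subst hn3
      have h10 : (1 : Fin 3) ≠ p := by simp [p]
      have h20 : (2 : Fin 3) ≠ p := by simp [p]
      have h21 : (2 : Fin 3) ≠ 1 := by decide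
      have hall : ∀ q : Fin 3, q = p ∨ q = 2 ∨ q = 1 := fun q => by fin_cases q <;> simp [p]
      obtain rfl : ℓ₁ = ((m + 1 : ℕ) : ℤ) := by rw [hℓ₁]; push_cast; ring
      obtain rfl : ℓ₂ = -((m + 1 : ℕ) : ℤ) := by rw [hℓ₂]; push_cast; ring
      have hh := hsolo.isHarmonicVector_pairDet_pow (F := F) h20 h10 h21 hall (m + 1)
      rw [hdeg] at hh
      refine IsScalarVector.isHighestWeightVector hsolo (Or.inl ⟨rfl, rfl⟩)
        (hsolo.isScalarVector_pairDet_pow h20 h10 h21 hall (m + 1)) hh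
        (pow_ne_zero _ (pairDet_ne_zero h21)) ?_ ?_
      · rw [hv, zeta₂, xv_eq (k := 1 + 1) (1 : Fin 3) rfl, xv_eq (k := 1 + 2) (2 : Fin 3) rfl,
          yv_eq (k := 1 + 1) (1 : Fin 3) rfl, yv_eq (k := 1 + 2) (2 : Fin 3) rfl]
        have e : (X (.inl 1) * X (.inr 2) - X (.inl 2) * X (.inr 1) : Poly F 3) =
            pairDet F 1 2 1 := by
          change _ = (X (.inr 2) * X (.inl 1) - X (.inr 1) * X (.inl 2) : Poly F 3)
          ring
        exact congrArg (· ^ (m + 1)) e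
      · rw [hχ]
        push_cast
        simp only [if_true]
        congr 2
        ring
    · exact hmul m₁ m₂ (Or.inr hn2) hℓ₁ hℓ₂ hv hχ
  · obtain rfl : n₁ = n₂ := by omega
    have hn1 : n₁ + 1 = n := by clear h; omega
    have hn0 : 0 < n := by clear h; omega
    have hpn' : n - 1 + 1 = n := Nat.sub_add_cancel hn0
    let p : Fin n := ⟨n - 1, Nat.sub_lt hn0 Nat.one_pos⟩
    have hpn : p.val + 1 = n := hpn'
    have hsolo : IsSolo n₁ p := isSolo_last hpn hn1
    have hp : ¬ p.val < n₁ := fun e => by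
      have e' : n - 1 < n₁ := e
      clear h; omega
    have hdeg : ∀ ℓ, soloDeg n₁ p ℓ = ℓ.swap := fun ℓ => if_neg hp
    rcases h with ⟨m, hℓ₁, hℓ₂, hv, hχ⟩ | ⟨hn3, m, hℓ₁, hℓ₂, hv, hχ⟩
    · subst hℓ₁ hℓ₂
      let q : Fin n := ⟨0, by omega⟩
      have hqp : q ≠ p := by simp only [p, q, ne_eq, Fin.mk.injEq]; omega
      have hh := hsolo.isHarmonicVector_u (F := F) hqp (m := m) (m₂ := 0)
      rw [hdeg, Prod.swap_prod_mk, Nat.cast_zero, neg_zero] at hh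
      refine IsScalarVector.isHighestWeightVector hsolo (Or.inr ⟨hpn, hn1⟩)
        (hsolo.isScalarVector_u hqp (Or.inl rfl)) hh
        (mul_ne_zero (pow_ne_zero _ (uVar_ne_zero _)) (pow_ne_zero _ (uVar_ne_zero _))) ?_ ?_
      · have hu : uVar F n₁ p = X (.inr p) := by rw [uVar, uIdx, if_neg hp]
        rw [hv, yv_eq p hpn, hu, pow_zero, mul_one]
        rfl
      · rw [hχ, show n - 1 = n₁ by omega]
        simp [hqp.symm]
    · subst hn3
      obtain rfl : n₁ = 2 := by omega
      have h0 : (0 : Fin 3) ≠ p := by simp [p]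
      have h10 : (1 : Fin 3) ≠ p := by simp [p]
      have h01 : (0 : Fin 3) ≠ 1 := by decide
      have hall : ∀ q : Fin 3, q = p ∨ q = 0 ∨ q = 1 := fun q => by fin_cases q <;> simp [p]
      obtain rfl : ℓ₂ = ((m + 1 : ℕ) : ℤ) := by rw [hℓ₂]; push_cast; ring
      obtain rfl : ℓ₁ = -((m + 1 : ℕ) : ℤ) := by rw [hℓ₁]; push_cast; ring
      have hh := hsolo.isHarmonicVector_pairDet_pow (F := F) h0 h10 h01 hall (m + 1)
      rw [hdeg, Prod.swap_prod_mk] at hh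
      refine IsScalarVector.isHighestWeightVector hsolo (Or.inr ⟨hpn, hn1⟩)
        (hsolo.isScalarVector_pairDet_pow h0 h10 h01 hall (m + 1)) hh
        (pow_ne_zero _ (pairDet_ne_zero h01)) ?_ ?_
      · rw [hv, zeta₁, xv_eq (k := 2 - 1) (0 : Fin 3) rfl, xv_eq (k := 2) (1 : Fin 3) rfl,
          yv_eq (k := 2 - 1) (0 : Fin 3) rfl, yv_eq (k := 2) (1 : Fin 3) rfl]
        rfl
      · rw [hχ]
        push_cast
        simp only [if_true]
        congr 2
        ring

/-- Outside the list, the module is zero, or reducible (for `n = n₂ = 2` and `ℓ₂ > -ℓ₁ ≥ 0`), or not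
completely pointed. -/
theorem exists_listed (hn : 2 ≤ n) (h1 : 1 ≤ n₁) (h2 : n₂ ≤ n)
    (hirr : LieModule.IsIrreducible F (SLn F n) (harmonic F n h12 ℓ₁ ℓ₂))
    (hcp : IsCompletelyPointed F n (harmonic F n h12 ℓ₁ ℓ₂)) :
    ∃ (v : Osc F n n₁ n₂) (χ : Module.Dual F (cartan F n)), Listed F n n₁ n₂ ℓ₁ ℓ₂ v χ := by
  rcases h12.lt_or_eq with hlt | rfl
  · rcases h2.lt_or_eq with hlt' | rfl
    · exact absurd hcp (not_isCompletelyPointed_of_lt_of_lt h1 hlt hlt')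
    rcases lt_trichotomy ℓ₂ 0 with hℓ₂ | hℓ₂ | hℓ₂
    · -- the degree in the `yᵢ` cannot be negative
      refine absurd hirr (not_isIrreducible_of_eq_zero fun f hf _ => ?_)
      by_contra hne
      obtain ⟨μ, hμ⟩ := MvPolynomial.ne_zero_iff.mp hne
      have hdeg := congrArg Prod.snd (hf hμ)
      have hs : ∀ i : Fin n₂, sgn n₂ i = -1 := fun i => if_pos i.2
      rw [weight_degVar] at hdeg
      simp only [hs, neg_mul, one_mul, Finset.sum_neg_distrib, neg_neg] at hdeg
      have : (0 : ℤ) ≤ ∑ i : Fin n₂, (μ (.inr i) : ℤ) := Finset.sum_nonneg fun _ _ => by positivity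
      omega
    · rcases Nat.lt_or_ge (n₁ + 1) n₂ with hn1 | hn1
      · rcases le_total 0 ℓ₁ with h0 | h0
        · exact ⟨_, _, Or.inl ⟨hn1, rfl, Or.inl ⟨ℓ₁.toNat, by omega, hℓ₂, rfl, rfl⟩⟩⟩
        · exact ⟨_, _, Or.inl ⟨hn1, rfl, Or.inr ⟨(-ℓ₁).toNat, by omega, hℓ₂, rfl, rfl⟩⟩⟩
      · have hn1' : n₁ + 1 = n₂ := by omega
        rcases le_total 0 ℓ₁ with h0 | h0
        · exact ⟨_, _, Or.inr (Or.inl ⟨hn1', rfl,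
            Or.inr (Or.inl ⟨ℓ₁.toNat, by omega, hℓ₂, rfl, rfl⟩)⟩)⟩
        · exact ⟨_, _, Or.inr (Or.inl ⟨hn1', rfl,
            Or.inl ⟨(-ℓ₁).toNat, by omega, hℓ₂, rfl, rfl⟩⟩)⟩
    · rcases Nat.lt_or_ge (n₁ + 1) n₂ with hn1 | hn1
      · exact absurd hcp (not_isCompletelyPointed_of_add_one_lt h1 hn1 rfl hℓ₂)
      have hn1' : n₁ + 1 = n₂ := by omega
      rcases Nat.lt_or_ge 1 n₁ with hn2 | hn2
      · exact absurd hcp (not_isCompletelyPointed_of_add_one_eq hn2 hn1' rfl hℓ₂)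
      obtain rfl : n₁ = 1 := by omega
      obtain rfl : n₂ = 2 := by omega
      obtain ⟨L, rfl⟩ := Int.eq_ofNat_of_zero_le hℓ₂.le
      rcases le_or_gt ℓ₁ 0 with h0 | h0
      · obtain ⟨m, hm⟩ := Int.eq_ofNat_of_zero_le (neg_nonneg.mpr h0)
        obtain rfl : ℓ₁ = -m := by omega
        rcases Nat.lt_or_ge m L with hmL | hmL
        · exact absurd hirr (not_isIrreducible_one_two hmL)
        · exact ⟨_, _, Or.inr (Or.inl ⟨rfl, rfl,
            Or.inr (Or.inr (Or.inl ⟨rfl, m, L, hmL, rfl, rfl, rfl, rfl⟩))⟩)⟩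
      · exact ⟨_, _, Or.inr (Or.inl ⟨rfl, rfl, Or.inr (Or.inr (Or.inr
          ⟨rfl, ℓ₁.toNat, L, by omega, by omega, by omega, rfl, rfl, rfl⟩))⟩)⟩
  · rcases h2.lt_or_eq with hlt | heq
    swap
    · exact absurd hcp (not_isCompletelyPointed_of_eq heq)
    have hsum : ℓ₁ + ℓ₂ ≤ 0 := by
      by_contra hpos
      exact not_isIrreducible_of_eq_zero
        (fun f hf hlap => eq_zero_of_lap_eq_zero (ℓ := (ℓ₁, ℓ₂)) (not_le.mp hpos) hf hlap) hirr
    -- the second degree with respect to a solo index is not positive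
    have hnonpos : ∀ {p : Fin n}, IsSolo n₁ p → (soloDeg n₁ p (ℓ₁, ℓ₂)).2 ≤ 0 := by
      intro p hp
      by_contra hpos
      exact not_isIrreducible_of_eq_zero
        (fun f hf hlap => hp.eq_zero_of_pos (not_le.mp hpos) hf hlap) hirr
    let p : Fin n := ⟨0, by omega⟩
    let q : Fin n := ⟨n - 1, by omega⟩
    have hqn : q.val + 1 = n := by simp only [q]; omega
    by_cases hfirst : n₁ = 1
    · subst hfirst
      have hsolo : IsSolo 1 p := isSolo_zero rfl rfl
      have hdeg : ∀ ℓ, soloDeg 1 p ℓ = ℓ := fun ℓ => if_pos Nat.one_pos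
      have hℓ₂ := hnonpos hsolo
      rw [hdeg] at hℓ₂
      rcases hn.lt_or_eq with hn3 | hn2
      swap
      · subst hn2
        have hℓ₁ := hnonpos (isSolo_last hqn rfl)
        rw [soloDeg, if_neg (by simp [q])] at hℓ₁
        exact ⟨_, _, Or.inr (Or.inr (Or.inl ⟨rfl, rfl, Or.inr (Or.inr
          ⟨rfl, (-ℓ₁).toNat, (-ℓ₂).toNat, by simp at hℓ₁; omega, by simp at hℓ₂; omega,
            rfl, rfl⟩)⟩))⟩
      let r : Fin n := ⟨1, by omega⟩
      let s : Fin n := ⟨2, by omega⟩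
      have hrp : r ≠ p := by simp [r, p]
      have hsp : s ≠ p := by simp [s, p]
      have hrs : r ≠ s := by simp [r, s]
      rcases eq_or_lt_of_le hℓ₂ with h0 | h0
      · exact ⟨_, _, Or.inr (Or.inr (Or.inl ⟨rfl, rfl, Or.inl
          ⟨(-ℓ₁).toNat, by simp at h0; omega, h0, rfl, rfl⟩⟩))⟩
      have h0' : ℓ₂ ≤ -1 := by simp at h0; omega
      rcases eq_or_lt_of_le hsum with hz | hz
      swap
      · exact absurd hcp (hsolo.not_isCompletelyPointed_of_three hrp hsp hrs (hdeg _) h0'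
          (by omega))
      rcases Nat.lt_or_ge 3 n with hn4 | hn4
      · let t : Fin n := ⟨3, hn4⟩
        exact absurd hcp (hsolo.not_isCompletelyPointed_of_four hrp hsp (t := t)
          (by simp [t, p]) hrs
          (by simp [r, t]) (by simp [s, t]) (k := ℓ₁)
          (by rw [hdeg, show -ℓ₁ = ℓ₂ by omega]) (by omega))
      · exact ⟨_, _, Or.inr (Or.inr (Or.inl ⟨rfl, rfl, Or.inr (Or.inl
          ⟨by omega, (ℓ₁ - 1).toNat, by omega, by omega, rfl, rfl⟩)⟩))⟩
    · rcases Nat.lt_or_ge (n₁ + 1) n with hn1 | hn1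
      · exact absurd hcp (not_isCompletelyPointed_of_two_two (by omega) hn1 hsum)
      have hn1' : n₁ + 1 = n := by omega
      have hsolo : IsSolo n₁ q := isSolo_last hqn hn1'
      have hdeg : ∀ ℓ, soloDeg n₁ q ℓ = ℓ.swap := fun ℓ => if_neg (by omega)
      have hℓ₁ : ℓ₁ ≤ 0 := by
        have := hnonpos hsolo
        rwa [hdeg] at this
      let r : Fin n := ⟨0, by omega⟩
      let s : Fin n := ⟨1, by omega⟩
      have hrq : r ≠ q := by simp only [r, q, ne_eq, Fin.mk.injEq]; omega
      have hsq : s ≠ q := by simp only [s, q, ne_eq, Fin.mk.injEq]; omega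
      have hrs : r ≠ s := by simp [r, s]
      rcases eq_or_lt_of_le hℓ₁ with h0 | h0
      · exact ⟨_, _, Or.inr (Or.inr (Or.inr ⟨by omega, by omega, Or.inl
          ⟨(-ℓ₂).toNat, h0, by omega, rfl, rfl⟩⟩))⟩
      rcases eq_or_lt_of_le hsum with hz | hz
      swap
      · exact absurd hcp (hsolo.not_isCompletelyPointed_of_three hrq hsq hrs (hdeg (ℓ₂, ℓ₁))
          (by omega) (by omega))
      rcases Nat.lt_or_ge 3 n with hn4 | hn4
      · let t : Fin n := ⟨2, by omega⟩
        exact absurd hcp (hsolo.not_isCompletelyPointed_of_four hrq hsq (t := t)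
          (by simp only [t, q, ne_eq, Fin.mk.injEq]; omega) hrs
          (by simp [r, t]) (by simp [s, t]) (k := ℓ₂)
          (by rw [hdeg, show -ℓ₂ = ℓ₁ by omega]; rfl) (by omega))
      · exact ⟨_, _, Or.inr (Or.inr (Or.inr ⟨by omega, by omega, Or.inr
          ⟨by omega, (ℓ₂ - 1).toNat, by omega, by omega, rfl, rfl⟩⟩))⟩

end Classification

end OscRep

end

theorem mainTheorem3 (F : Type*) [Field F] [CharZero F] (n n₁ n₂ : ℕ) (hn : 2 ≤ n)
    (h1 : 1 ≤ n₁) (h12 : n₁ ≤ n₂) (h2 : n₂ ≤ n) (ℓ₁ ℓ₂ : ℤ) :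
    ((LieModule.IsIrreducible F (OscRep.SLn F n) (OscRep.harmonic F n h12 ℓ₁ ℓ₂) ∧
        OscRep.IsCompletelyPointed F n (OscRep.harmonic F n h12 ℓ₁ ℓ₂)) ↔
      ∃ (v : OscRep.Osc F n n₁ n₂) (χ : Module.Dual F (OscRep.cartan F n)),
        OscRep.Listed F n n₁ n₂ ℓ₁ ℓ₂ v χ) ∧
    ∀ (v : OscRep.Osc F n n₁ n₂) (χ : Module.Dual F (OscRep.cartan F n)),
      OscRep.Listed F n n₁ n₂ ℓ₁ ℓ₂ v χ →
        ∃ hv : v ∈ OscRep.harmonic F n h12 ℓ₁ ℓ₂,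
          OscRep.IsHighestWeightVector
            (⟨v, hv⟩ : OscRep.harmonic F n h12 ℓ₁ ℓ₂) χ :=
  ⟨⟨fun h => OscRep.exists_listed hn h1 h2 h.1 h.2,
    fun ⟨_, _, h⟩ => h.isIrreducible_and_isCompletelyPointed hn h1⟩,
  fun _ _ h => h.isHighestWeightVector hn h1⟩
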